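/- **Definitions.** For a bipartite graph $H$ with left vertex set $U$, $|U|=k$, and right vertex set $V$, let $\mathcal B(H)$ be the system of polynomial equations in the variables $(x_u)_{u\in U},(y_v)_{v\in V}$ $$x_u^2=x_u\ (u\in U),\qquad y_v^2=y_v\ (v\in V),\qquad |x|+|y|=k,\qquad x_uy_v=0\ \text{ whenever } \{u,v\} \text{ is not an edge of } H,$$ where $|x|=\sum_{u}x_u$, $|y|=\sum_{v}y_v$, and each equation $f=0$ is read as the two inequalities $f\ge 0$, $-f\ge0$. A system $\{f_1\ge 0,\dots,f_m\ge 0\}$ has a *degree-$d$ sum-of-squares proof* of $g\ge 0$ if $g=\sum_{S\subseteq[m]}s_S\prod_{i\in S}f_i$ with all $s_S$ sums of squares of polynomials and all summands of degree at most $d$. If all these polynomials have rational coefficients, the *total bit complexity* of the proof is the number of bits needed to write down all coefficients of the $f_i$, of $g$ and of the $s_S$. For real $b$ we say that $\mathcal B(H)$ *certifies $|x|^a|y|\le b$ in degree $d$ and bit complexity $B$* if it has a degree-$d$ sum-of-squares proof of $b-|x|^a|y|\ge 0$, and, for some rational $c\le b$, a degree-$d$ sum-of-squares proof of $c-|x|^a|y|\ge0$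 of total bit complexity at most $B$. Let $B(k,m,p)$ be the random bipartite graph with $k$ left and $m$ right vertices in which each of the $km$ possible edges is present independently with probability $p$. **Theorem.** There are absolute constants $A>0$ and $K\in\mathbb N$ such that for every $\varepsilon>0$ there is $N$ with the following property. Let $1\le k\le n$ be integers, let $0<p<1$, and let $H\sim B(k,n-k,p)$. With probability at least $0.99$ both of the following hold. 1. If $n\ge N$ and $p,\,1-p\ge n^{-(1-\varepsilon)}$, then $\mathcal B(H)$ certifies $$|x|\,|y|\le A\,\frac{np}{1-p}$$ in degree $4$ and bit complexity $Kn^{K}$. 2. For every integer $r\ge1$ with $$k\ \ge\ A\,\max\left\{\sqrt{rn\log n}\;\frac{\max\{\frac{p}{1-p},\frac{1-p}{p}\}^{r}\,p^{r}}{(1-p)^{r+1}},\ \ \frac{p\log n}{1-p}\right\},$$ $\mathcal B(H)$ certifies $$|x|^{4r}|y|\le(1000r)^{10r}\,n\left(\frac{n\,\max\{\frac{p}{1-p},\frac{1-p}{p}\}^{r}\,p^{r}}{k\,(1-p)^{r+1}}\right)^{4}$$ in degree $6r+2$ and bit complexity $Kn^{Kr}$. (For $p\ge\frac12$ the first term in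 the lower bound on $k$ is $\sqrt{rn\log n}\,p^{2r}/(1-p)^{2r+1}$.) -/

import Mathlib

open MvPolynomial MeasureTheory ProbabilityTheory

noncomputable section

/-- A bipartite graph with left vertex set `Fin k` and right vertex set `Fin m`, given by its
adjacency table: `{u, v}` is an edge iff `H (u, v) = true`. -/
abbrev BipGraph (k m : ℕ) : Type := Fin k × Fin m → Bool

/-- The random bipartite graph `B(k, m, p)`: each of the `k * m` possible edges is present with
probability `p`, independently. -/
def randomBip (k m : ℕ) (p : unitInterval) : Measure (BipGraph k m) :=
  Measure.pi fun _ => bernoulliMeasure true false p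

/-- Sum-of-squares proofs with real coefficients: `{f i ≥ 0 | i}` derives `g ≥ 0` in degree `d` if
`g = ∑_S s_S * ∏_{i ∈ S} f i`, the sum running over all sets `S` of constraints, where every `s_S`
is a sum of squares and every summand has degree at most `d`. -/
def SoSDerives {σ ι : Type} [Fintype ι] (f : ι → MvPolynomial σ ℝ) (d : ℕ)
    (g : MvPolynomial σ ℝ) : Prop :=
  ∃ s : Finset ι → MvPolynomial σ ℝ,
    (∀ S, IsSumSq (s S)) ∧
    (∀ S, (s S * ∏ i ∈ S, f i).totalDegree ≤ d) ∧
    g = ∑ S, s S * ∏ i ∈ S, f i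

/-- The number of bits of a rational number in lowest terms: a sign bit and the binary lengths of
numerator and denominator. -/
def ratBits (q : ℚ) : ℕ := 1 + q.num.natAbs.size + q.den.size

/-- The number of bits needed to write down the (nonzero) coefficients of a rational polynomial. -/
def polyBits {σ : Type} (f : MvPolynomial σ ℚ) : ℕ := ∑ a ∈ f.support, ratBits (f.coeff a)

/-- Sum-of-squares proofs of bounded total bit complexity: `{f i ≥ 0 | i}` derives `g ≥ 0` in degree
`d` and total bit complexity `B` if all polynomials of the proof have rational coefficients, and the
coefficients of all the constraints `f i`, of the conclusion `g` and of all the multipliers `s_S`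
take at most `B` bits altogether. The multipliers have rational coefficients and are sums of squares
of real polynomials. -/
def SoSDerivesBits {σ ι : Type} [Fintype ι] (f : ι → MvPolynomial σ ℚ) (d B : ℕ)
    (g : MvPolynomial σ ℚ) : Prop :=
  ∃ s : Finset ι → MvPolynomial σ ℚ,
    (∀ S, IsSumSq (MvPolynomial.map (algebraMap ℚ ℝ) (s S))) ∧
    (∀ S, (s S * ∏ i ∈ S, f i).totalDegree ≤ d) ∧
    g = ∑ S, s S * ∏ i ∈ S, f i ∧
    (∑ i, polyBits (f i)) + polyBits g + ∑ S, polyBits (s S) ≤ B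

/-- The polynomial `|x| = ∑_u x_u` in the variables `x_u` (`u` a left vertex), `y_v` (`v` a right
vertex). -/
def sizeX (R : Type) [CommRing R] (k m : ℕ) : MvPolynomial (Fin k ⊕ Fin m) R :=
  ∑ u : Fin k, X (Sum.inl u)

/-- The polynomial `|y| = ∑_v y_v`. -/
def sizeY (R : Type) [CommRing R] (k m : ℕ) : MvPolynomial (Fin k ⊕ Fin m) R :=
  ∑ v : Fin m, X (Sum.inr v)

/-- Names of the equations of the biclique system: one for each left vertex, one for each right
vertex, one for the total size, one for each non-edge. -/
abbrev BicliqueIdx {k m : ℕ} (H : BipGraph k m) : Type :=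
  Fin k ⊕ Fin m ⊕ Unit ⊕ {e : Fin k × Fin m // H e = false}

/-- The biclique system `B(H)` of a bipartite graph with `k` left vertices, each polynomial standing
for the equation "polynomial = 0": `x_u² = x_u`, `y_v² = y_v`, `|x| + |y| = k`, and `x_u y_v = 0`
for every non-edge. -/
def bicliqueEq (R : Type) [CommRing R] {k m : ℕ} (H : BipGraph k m) :
    BicliqueIdx H → MvPolynomial (Fin k ⊕ Fin m) R
  | .inl u => X (Sum.inl u) ^ 2 - X (Sum.inl u)
  | .inr (.inl v) => X (Sum.inr v) ^ 2 - X (Sum.inr v)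
  | .inr (.inr (.inl _)) => sizeX R k m + sizeY R k m - C (k : R)
  | .inr (.inr (.inr e)) => X (Sum.inl e.1.1) * X (Sum.inr e.1.2)

/-- The biclique system as a system of inequalities "polynomial `≥ 0`": each equation `f = 0` is the
pair `f ≥ 0`, `-f ≥ 0`. -/
def bicliqueSystem (R : Type) [CommRing R] {k m : ℕ} (H : BipGraph k m) :
    BicliqueIdx H × Bool → MvPolynomial (Fin k ⊕ Fin m) R
  | (i, true) => bicliqueEq R H i
  | (i, false) => - bicliqueEq R H i

/-- `B(H)` has a degree-`d` sum-of-squares proof of `|x|^a * |y| ≤ b`, of total bit complexity at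
most `B`. Since the real number `b` need not be rational, the bit complexity is that of a proof of
`|x|^a * |y| ≤ c` for some rational `c ≤ b`. -/
def BicliqueCertificate {k m : ℕ} (H : BipGraph k m) (d a : ℕ) (b : ℝ) (B : ℕ) : Prop :=
  SoSDerives (bicliqueSystem ℝ H) d (C b - sizeX ℝ k m ^ a * sizeY ℝ k m) ∧
  ∃ c : ℚ, (c : ℝ) ≤ b ∧
    SoSDerivesBits (bicliqueSystem ℚ H) d B (C c - sizeX ℚ k m ^ a * sizeY ℚ k m)

end

/-- The sum of the absolute values of the coefficients. -/
def l1 {σ : Type} (p : MvPolynomial σ ℤ) : ℕ := ∑ a ∈ p.support, (p.coeff a).natAbs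

section L1
variable {σ : Type}

lemma l1_eq_sum (p : MvPolynomial σ ℤ) (s : Finset (σ →₀ ℕ)) (h : p.support ⊆ s) :
    l1 p = ∑ a ∈ s, (p.coeff a).natAbs := by
  unfold l1
  refine Finset.sum_subset h fun a _ ha => ?_
  rw [notMem_support_iff.mp ha]; rfl

lemma l1_zero : l1 (0 : MvPolynomial σ ℤ) = 0 := by simp [l1]

lemma l1_monomial (a : σ →₀ ℕ) (c : ℤ) : l1 (monomial a c) = c.natAbs := by
  classical
  rw [l1_eq_sum _ {a} support_monomial_subset]
  simp

lemma l1_add_le (p q : MvPolynomial σ ℤ) : l1 (p + q) ≤ l1 p + l1 q := by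
  classical
  rw [l1_eq_sum (p + q) (p.support ∪ q.support) support_add,
    l1_eq_sum p (p.support ∪ q.support) Finset.subset_union_left,
    l1_eq_sum q (p.support ∪ q.support) Finset.subset_union_right, ← Finset.sum_add_distrib]
  refine Finset.sum_le_sum fun a _ => ?_
  rw [coeff_add]; exact Int.natAbs_add_le _ _

lemma l1_neg (p : MvPolynomial σ ℤ) : l1 (-p) = l1 p := by
  simp [l1, support_neg]

lemma l1_sum_le {ι : Type*} (s : Finset ι) (f : ι → MvPolynomial σ ℤ) :
    l1 (∑ i ∈ s, f i) ≤ ∑ i ∈ s, l1 (f i) := by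
  classical
  induction s using Finset.induction_on with
  | empty => simp [l1_zero]
  | insert a s ha ih =>
    rw [Finset.sum_insert ha, Finset.sum_insert ha]
    exact (l1_add_le _ _).trans (by gcongr)

lemma l1_mul_le (p q : MvPolynomial σ ℤ) : l1 (p * q) ≤ l1 p * l1 q := by
  have key : ∀ (a : σ →₀ ℕ) (c : ℤ), l1 (monomial a c * q) ≤ c.natAbs * l1 q := by
    intro a c
    conv_lhs => rw [q.as_sum, Finset.mul_sum]
    refine (l1_sum_le _ _).trans ?_
    rw [l1, Finset.mul_sum]
    refine Finset.sum_le_sum fun b _ => ?_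
    rw [monomial_mul, l1_monomial, Int.natAbs_mul]
  conv_lhs => rw [p.as_sum, Finset.sum_mul]
  refine (l1_sum_le _ _).trans ?_
  rw [l1, Finset.sum_mul]
  exact Finset.sum_le_sum fun a _ => key a _

/-- `p` has degree at most `d` and coefficients of total size at most `L`. -/
def Sized (p : MvPolynomial σ ℤ) (d L : ℕ) : Prop := p.totalDegree ≤ d ∧ l1 p ≤ L

namespace Sized
variable {p q : MvPolynomial σ ℤ} {d e L M : ℕ}

lemma mono (h : Sized p d L) (hd : d ≤ e) (hL : L ≤ M) : Sized p e M :=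
  ⟨h.1.trans hd, h.2.trans hL⟩

lemma zero : Sized (0 : MvPolynomial σ ℤ) d L := ⟨by simp, by simp [l1_zero]⟩

lemma const (c : ℤ) : Sized (C c : MvPolynomial σ ℤ) d c.natAbs :=
  ⟨by rw [totalDegree_C]; exact Nat.zero_le _, by rw [C_apply, l1_monomial]⟩

lemma natCast (c : ℕ) : Sized (c : MvPolynomial σ ℤ) d c := by
  have := const (σ := σ) (d := d) (c : ℤ)
  simpa using this

lemma one : Sized (1 : MvPolynomial σ ℤ) d 1 := by
  have := natCast (σ := σ) (d := d) 1
  simpa using this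

lemma X (i : σ) : Sized (MvPolynomial.X i : MvPolynomial σ ℤ) 1 1 :=
  ⟨by simp, by rw [MvPolynomial.X, l1_monomial]; rfl⟩

lemma add (hp : Sized p d L) (hq : Sized q d M) : Sized (p + q) d (L + M) :=
  ⟨(totalDegree_add _ _).trans (max_le hp.1 hq.1),
    (l1_add_le _ _).trans (Nat.add_le_add hp.2 hq.2)⟩

lemma neg (hp : Sized p d L) : Sized (-p) d L :=
  ⟨by rw [totalDegree_neg]; exact hp.1, by rw [l1_neg]; exact hp.2⟩

lemma sub (hp : Sized p d L) (hq : Sized q d M) : Sized (p - q) d (L + M) := by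
  rw [sub_eq_add_neg]; exact hp.add hq.neg

lemma mul (hp : Sized p d L) (hq : Sized q e M) : Sized (p * q) (d + e) (L * M) :=
  ⟨(totalDegree_mul _ _).trans (Nat.add_le_add hp.1 hq.1),
    (l1_mul_le _ _).trans (Nat.mul_le_mul hp.2 hq.2)⟩

lemma pow (hp : Sized p d L) (r : ℕ) : Sized (p ^ r) (r * d) (L ^ r) := by
  induction r with
  | zero => simpa using one (σ := σ) (d := 0)
  | succ r ih =>
    rw [pow_succ, pow_succ]
    exact (ih.mul hp).mono (by rw [Nat.succ_mul]) le_rfl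

lemma sum {ι : Type*} {s : Finset ι} {f : ι → MvPolynomial σ ℤ}
    (h : ∀ i ∈ s, Sized (f i) d L) : Sized (∑ i ∈ s, f i) d (s.card * L) := by
  refine ⟨totalDegree_finsetSum_le fun i hi => (h i hi).1, (l1_sum_le _ _).trans ?_⟩
  exact Finset.sum_le_card_nsmul _ _ _ fun i hi => (h i hi).2

lemma prod {n : ℕ} {f : Fin n → MvPolynomial σ ℤ}
    (h : ∀ i, Sized (f i) 1 L) : Sized (∏ i, f i) n (L ^ n) := by
  induction n with
  | zero => simpa using one (σ := σ) (d := 0)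
  | succ r ih =>
    rw [Fin.prod_univ_succ]
    exact ((h 0).mul (ih fun i => h i.succ)).mono (by omega) (by rw [pow_succ, mul_comm])

end Sized
end L1

/-- An integer polynomial that is a sum of squares of real polynomials. -/
def RealSOS {σ : Type} (p : MvPolynomial σ ℤ) : Prop :=
  IsSumSq (MvPolynomial.map (Int.castRingHom ℝ) p)

namespace RealSOS
variable {σ : Type} {p q : MvPolynomial σ ℤ}

lemma zero : RealSOS (0 : MvPolynomial σ ℤ) := by
  unfold RealSOS; rw [map_zero]; exact IsSumSq.zero

lemma sq (p : MvPolynomial σ ℤ) : RealSOS (p ^ 2) := by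
  unfold RealSOS; rw [pow_two, map_mul]; exact IsSumSq.mul_self _

lemma add (hp : RealSOS p) (hq : RealSOS q) : RealSOS (p + q) := by
  unfold RealSOS; rw [map_add]; exact IsSumSq.add hp hq

lemma mul (hp : RealSOS p) (hq : RealSOS q) : RealSOS (p * q) := by
  unfold RealSOS; rw [map_mul]; exact IsSumSq.mul hp hq

lemma sum {ι : Type*} {s : Finset ι} {f : ι → MvPolynomial σ ℤ}
    (h : ∀ i ∈ s, RealSOS (f i)) : RealSOS (∑ i ∈ s, f i) := by
  unfold RealSOS; rw [map_sum]; exact IsSumSq.sum h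

lemma natCast (c : ℕ) : RealSOS (c : MvPolynomial σ ℤ) := by
  unfold RealSOS; rw [map_natCast]; exact IsSumSq.natCast c

lemma one : RealSOS (1 : MvPolynomial σ ℤ) := by
  simpa using natCast (σ := σ) 1

end RealSOS

/-- A sum-of-squares proof with integer coefficients: `G = t₀ + ∑ (sⱼ⁺ - sⱼ⁻) fⱼ` where all
multipliers are sums of squares of real polynomials, all summands have degree at most `d`, and
each multiplier has coefficients of total size at most `L`. -/
def IntCert {σ J : Type} [Fintype J] (f : J → MvPolynomial σ ℤ) (d L : ℕ)
    (G : MvPolynomial σ ℤ) : Prop :=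
  ∃ (t : MvPolynomial σ ℤ) (s : J → Bool → MvPolynomial σ ℤ),
    RealSOS t ∧ Sized t d L ∧
    (∀ j b, RealSOS (s j b) ∧ (s j b * f j).totalDegree ≤ d ∧ l1 (s j b) ≤ L) ∧
    G = t + ∑ j, (s j true * f j - s j false * f j)

namespace IntCert
variable {σ J : Type} [Fintype J] {f : J → MvPolynomial σ ℤ} {d e L M : ℕ}
  {G G' q : MvPolynomial σ ℤ}

lemma mono (h : IntCert f d L G) (hd : d ≤ e) (hL : L ≤ M) : IntCert f e M G := by
  obtain ⟨t, s, h1, h2, h3, h4⟩ := h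
  exact ⟨t, s, h1, h2.mono hd hL, fun j b => ⟨(h3 j b).1, (h3 j b).2.1.trans hd,
    (h3 j b).2.2.trans hL⟩, h4⟩

lemma sos (h : RealSOS q) (hs : Sized q d L) : IntCert f d L q :=
  ⟨q, fun _ _ => 0, h, hs, fun _ _ => ⟨RealSOS.zero, by simp, by simp [l1_zero]⟩, by simp⟩

lemma zero : IntCert f d L 0 := sos RealSOS.zero Sized.zero

lemma add (h : IntCert f d L G) (h' : IntCert f d M G') : IntCert f d (L + M) (G + G') := by
  obtain ⟨t, s, h1, h2, h3, h4⟩ := h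
  obtain ⟨t', s', h1', h2', h3', h4'⟩ := h'
  refine ⟨t + t', fun j b => s j b + s' j b, h1.add h1', h2.add h2', fun j b => ?_, ?_⟩
  · refine ⟨(h3 j b).1.add (h3' j b).1, ?_, (l1_add_le _ _).trans
      (Nat.add_le_add (h3 j b).2.2 (h3' j b).2.2)⟩
    rw [add_mul]
    exact (totalDegree_add _ _).trans (max_le (h3 j b).2.1 (h3' j b).2.1)
  · rw [h4, h4', add_add_add_comm, ← Finset.sum_add_distrib]
    congr 1
    exact Finset.sum_congr rfl fun j _ => by ring

lemma sum {ι : Type*} {s : Finset ι} {g : ι → MvPolynomial σ ℤ}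
    (h : ∀ i ∈ s, IntCert f d L (g i)) : IntCert f d (s.card * L) (∑ i ∈ s, g i) := by
  classical
  induction s using Finset.induction_on with
  | empty => simpa using zero
  | insert a s ha ih =>
    rw [Finset.sum_insert ha, Finset.card_insert_of_notMem ha]
    exact ((h a (by simp)).add (ih fun i hi => h i (by simp [hi]))).mono le_rfl
      (by rw [Nat.succ_mul, add_comm])

lemma sos_mul (h : IntCert f d L G) (hq : RealSOS q) (hs : Sized q e M) :
    IntCert f (e + d) (M * L) (q * G) := by
  obtain ⟨t, s, h1, h2, h3, h4⟩ := h
  refine ⟨q * t, fun j b => q * s j b, hq.mul h1, hs.mul h2, fun j b => ?_, ?_⟩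
  · refine ⟨hq.mul (h3 j b).1, ?_, (l1_mul_le _ _).trans (Nat.mul_le_mul hs.2 (h3 j b).2.2)⟩
    rw [mul_assoc]
    exact (totalDegree_mul _ _).trans (Nat.add_le_add hs.1 (h3 j b).2.1)
  · rw [h4, mul_add, Finset.mul_sum]
    congr 1
    exact Finset.sum_congr rfl fun j _ => by ring

lemma nat_mul (h : IntCert f d L G) (c : ℕ) : IntCert f d (c * L) (c * G) := by
  simpa using h.sos_mul (RealSOS.natCast c) (Sized.natCast (d := 0) c)

lemma sos_mul_eqn (hq : RealSOS q) (hs : Sized q e M) (hf : ∀ j, (f j).totalDegree ≤ 2) (j : J) :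
    IntCert f (e + 2) M (q * f j) := by
  classical
  refine ⟨0, fun i b => if i = j ∧ b = true then q else 0, RealSOS.zero, Sized.zero,
    fun i b => ?_, ?_⟩
  · dsimp only
    split_ifs with h
    · exact ⟨hq, (totalDegree_mul _ _).trans (Nat.add_le_add hs.1 (hf i)), hs.2⟩
    · exact ⟨RealSOS.zero, by simp, by simp [l1_zero]⟩
  · rw [Finset.sum_eq_single j] <;> simp +contextual

lemma sos_mul_neg_eqn (hq : RealSOS q) (hs : Sized q e M) (hf : ∀ j, (f j).totalDegree ≤ 2)
    (j : J) : IntCert f (e + 2) M (q * -f j) := by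
  classical
  refine ⟨0, fun i b => if i = j ∧ b = false then q else 0, RealSOS.zero, Sized.zero,
    fun i b => ?_, ?_⟩
  · dsimp only
    split_ifs with h
    · exact ⟨hq, (totalDegree_mul _ _).trans (Nat.add_le_add hs.1 (hf i)), hs.2⟩
    · exact ⟨RealSOS.zero, by simp, by simp [l1_zero]⟩
  · rw [Finset.sum_eq_single j] <;> simp +contextual

end IntCert

/-- `G` lies in the ideal generated by the `f j`, with multipliers of degree at most `e` and
coefficients of total size at most `L`. -/
def IdealCert {σ J : Type} [Fintype J] (f : J → MvPolynomial σ ℤ) (e L : ℕ)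
    (G : MvPolynomial σ ℤ) : Prop :=
  ∃ h : J → MvPolynomial σ ℤ, (∀ j, Sized (h j) e L) ∧ G = ∑ j, h j * f j

namespace IdealCert
variable {σ J : Type} [Fintype J] {f : J → MvPolynomial σ ℤ} {d e L M : ℕ}
  {G G' q : MvPolynomial σ ℤ}

lemma mono (h : IdealCert f d L G) (hd : d ≤ e) (hL : L ≤ M) : IdealCert f e M G := by
  obtain ⟨t, h1, h2⟩ := h
  exact ⟨t, fun j => (h1 j).mono hd hL, h2⟩

lemma zero : IdealCert f d L 0 := ⟨fun _ => 0, fun _ => Sized.zero, by simp⟩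

lemma eqn (j : J) : IdealCert f d 1 (f j) := by
  classical
  refine ⟨fun i => if i = j then 1 else 0, fun i => ?_, by simp⟩
  dsimp only
  split_ifs
  · exact Sized.one
  · exact Sized.zero

lemma add (h : IdealCert f d L G) (h' : IdealCert f d M G') : IdealCert f d (L + M) (G + G') := by
  obtain ⟨t, h1, h2⟩ := h
  obtain ⟨t', h1', h2'⟩ := h'
  exact ⟨fun j => t j + t' j, fun j => (h1 j).add (h1' j), by
    rw [h2, h2', ← Finset.sum_add_distrib]; exact Finset.sum_congr rfl fun j _ => by ring⟩

lemma neg (h : IdealCert f d L G) : IdealCert f d L (-G) := by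
  obtain ⟨t, h1, h2⟩ := h
  exact ⟨fun j => - t j, fun j => (h1 j).neg, by rw [h2]; simp⟩

lemma sum {ι : Type*} {s : Finset ι} {g : ι → MvPolynomial σ ℤ}
    (h : ∀ i ∈ s, IdealCert f d L (g i)) : IdealCert f d (s.card * L) (∑ i ∈ s, g i) := by
  classical
  induction s using Finset.induction_on with
  | empty => simpa using zero
  | insert a s ha ih =>
    rw [Finset.sum_insert ha, Finset.card_insert_of_notMem ha]
    exact ((h a (by simp)).add (ih fun i hi => h i (by simp [hi]))).mono le_rfl
      (by rw [Nat.succ_mul, add_comm])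

lemma intCert (h : IdealCert f e L G) (hf : ∀ j, (f j).totalDegree ≤ 2) :
    IntCert f (2 * e + 2) ((L + 1) ^ 2) (4 * G) := by
  obtain ⟨t, h1, h2⟩ := h
  have hp : ∀ j, Sized ((t j + 1) ^ 2) (2 * e) ((L + 1) ^ 2) := fun j => ((h1 j).add .one).pow 2
  have hm : ∀ j, Sized ((t j - 1) ^ 2) (2 * e) ((L + 1) ^ 2) := fun j => ((h1 j).sub .one).pow 2
  refine ⟨0, fun j b => if b then (t j + 1) ^ 2 else (t j - 1) ^ 2, RealSOS.zero, Sized.zero,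
    fun j b => ?_, ?_⟩
  · cases b
    · exact ⟨RealSOS.sq _, (totalDegree_mul _ _).trans (Nat.add_le_add (hm j).1 (hf j)), (hm j).2⟩
    · exact ⟨RealSOS.sq _, (totalDegree_mul _ _).trans (Nat.add_le_add (hp j).1 (hf j)), (hp j).2⟩
  · rw [h2, Finset.mul_sum, zero_add]
    exact Finset.sum_congr rfl fun j _ => by simp only [if_true, Bool.false_eq_true, if_false]; ring

end IdealCert

lemma Sized.mul_idealCert {σ J : Type} [Fintype J] {f : J → MvPolynomial σ ℤ} {d e L M : ℕ}
    {G q : MvPolynomial σ ℤ} (hs : Sized q e M) (h : IdealCert f d L G) :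
    IdealCert f (e + d) (M * L) (q * G) := by
  obtain ⟨t, h1, h2⟩ := h
  exact ⟨fun j => q * t j, fun j => hs.mul (h1 j), by
    rw [h2, Finset.mul_sum]; exact Finset.sum_congr rfl fun j _ => by ring⟩

lemma IntCert.congr {σ J : Type} [Fintype J] {f : J → MvPolynomial σ ℤ} {d L : ℕ}
    {G G' : MvPolynomial σ ℤ} (h : IntCert f d L G) (e : G' = G) : IntCert f d L G' := e ▸ h

lemma IdealCert.congr {σ J : Type} [Fintype J] {f : J → MvPolynomial σ ℤ} {d L : ℕ}
    {G G' : MvPolynomial σ ℤ} (h : IdealCert f d L G) (e : G' = G) : IdealCert f d L G' := e ▸ h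

lemma ratBits_div_le (z : ℤ) (hz : z ≠ 0) {W : ℕ} (hW : 0 < W) :
    ratBits ((z : ℚ) / W) ≤ z.natAbs * (2 + W.size) := by
  have e : ((z : ℚ) / W) = Rat.divInt z (W : ℤ) := by rw [Rat.divInt_eq_div]; simp
  have h1 : ((z : ℚ) / W).num.natAbs ≤ z.natAbs := by
    rw [e]
    exact Nat.le_of_dvd (Int.natAbs_pos.mpr hz)
      (Int.natAbs_dvd_natAbs.mpr (Rat.num_dvd z (by positivity)))
  have h2 : ((z : ℚ) / W).den ≤ W := by
    rw [e]
    exact Nat.le_of_dvd hW (by exact_mod_cast Rat.den_dvd z W)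
  have h3 : (z.natAbs).size ≤ z.natAbs := Nat.size_le.mpr Nat.lt_two_pow_self
  have h4 : 1 ≤ z.natAbs := Int.natAbs_pos.mpr hz
  unfold ratBits
  have h5 := Nat.size_le_size h1
  have h6 := Nat.size_le_size h2
  nlinarith

/-- The rational polynomial `p / W`. -/
noncomputable def ratPoly {σ : Type} (W : ℕ) (p : MvPolynomial σ ℤ) : MvPolynomial σ ℚ :=
  C (1 / (W : ℚ)) * MvPolynomial.map (Int.castRingHom ℚ) p

lemma polyBits_ratPoly_le {σ : Type} {W : ℕ} (hW : 0 < W) (p : MvPolynomial σ ℤ) :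
    polyBits (ratPoly W p) ≤ l1 p * (2 + W.size) := by
  have hc : ∀ a, (ratPoly W p).coeff a = ((p.coeff a : ℤ) : ℚ) / W := by
    intro a
    rw [ratPoly, coeff_C_mul, coeff_map]; simp; ring
  have hs : (ratPoly W p).support ⊆ p.support := by
    intro a ha
    rw [mem_support_iff, hc] at ha
    rw [mem_support_iff]
    rintro h; simp [h] at ha
  unfold polyBits l1
  rw [Finset.sum_mul]
  calc ∑ a ∈ (ratPoly W p).support, ratBits ((ratPoly W p).coeff a)
      ≤ ∑ a ∈ (ratPoly W p).support, (p.coeff a).natAbs * (2 + W.size) := by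
        refine Finset.sum_le_sum fun a ha => ?_
        rw [hc]
        exact ratBits_div_le _ (mem_support_iff.mp (hs ha)) hW
    _ ≤ _ := Finset.sum_le_sum_of_subset hs

lemma polyBits_map_le {σ : Type} (p : MvPolynomial σ ℤ) :
    polyBits (MvPolynomial.map (Int.castRingHom ℚ) p) ≤ 3 * l1 p := by
  have := polyBits_ratPoly_le Nat.one_pos p
  have e : ratPoly 1 p = MvPolynomial.map (Int.castRingHom ℚ) p := by simp [ratPoly]
  rw [e, Nat.size_one] at this
  linarith

/-- The empty set and the singletons. -/
def optSet {ι : Type} (o : Option ι) : Finset ι := o.toFinset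

lemma optSet_injective {ι : Type} : Function.Injective (optSet (ι := ι)) := by
  intro a b h
  cases a <;> cases b <;> simp_all [optSet, Option.toFinset]

lemma sosDerives_of_option {σ ι : Type} [Fintype ι] {f : ι → MvPolynomial σ ℝ} {d : ℕ}
    {g : MvPolynomial σ ℝ} (u : Option ι → MvPolynomial σ ℝ) (h1 : ∀ o, IsSumSq (u o))
    (h2 : (u none).totalDegree ≤ d) (h3 : ∀ i, (u (some i) * f i).totalDegree ≤ d)
    (h4 : g = u none + ∑ i, u (some i) * f i) : SoSDerives f d g := by
  classical
  have hr : ∀ S, Function.extend optSet u 0 S = 0 ∨ ∃ o, optSet o = S := by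
    intro S
    by_cases h : ∃ o, optSet o = S
    · exact Or.inr h
    · left; rw [Function.extend_apply' _ _ _ h]; rfl
  refine ⟨Function.extend optSet u 0, fun S => ?_, fun S => ?_, ?_⟩
  · rcases hr S with h | ⟨o, rfl⟩
    · rw [h]; exact IsSumSq.zero
    · rw [optSet_injective.extend_apply]; exact h1 o
  · rcases hr S with h | ⟨o, rfl⟩
    · rw [h]; simp
    · rw [optSet_injective.extend_apply]
      cases o with
      | none => simpa [optSet] using h2
      | some i => simpa [optSet] using h3 i
  · rw [← Fintype.sum_of_injective optSet optSet_injective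
      (fun o => u o * ∏ i ∈ optSet o, f i), Fintype.sum_option, h4]
    · simp [optSet]
    · intro S hS
      rcases hr S with h | h
      · rw [h, zero_mul]
      · exact absurd h hS
    · intro o; rw [optSet_injective.extend_apply]

lemma sosDerivesBits_of_option {σ ι : Type} [Fintype ι] {f : ι → MvPolynomial σ ℚ} {d B : ℕ}
    {g : MvPolynomial σ ℚ} (u : Option ι → MvPolynomial σ ℚ)
    (h1 : ∀ o, IsSumSq (MvPolynomial.map (algebraMap ℚ ℝ) (u o)))
    (h2 : (u none).totalDegree ≤ d) (h3 : ∀ i, (u (some i) * f i).totalDegree ≤ d)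
    (h4 : g = u none + ∑ i, u (some i) * f i)
    (h5 : (∑ i, polyBits (f i)) + polyBits g + ∑ o, polyBits (u o) ≤ B) :
    SoSDerivesBits f d B g := by
  classical
  have hr : ∀ S, Function.extend optSet u 0 S = 0 ∨ ∃ o, optSet o = S := by
    intro S
    by_cases h : ∃ o, optSet o = S
    · exact Or.inr h
    · left; rw [Function.extend_apply' _ _ _ h]; rfl
  refine ⟨Function.extend optSet u 0, fun S => ?_, fun S => ?_, ?_, ?_⟩
  · rcases hr S with h | ⟨o, rfl⟩
    · rw [h, map_zero]; exact IsSumSq.zero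
    · rw [optSet_injective.extend_apply]; exact h1 o
  · rcases hr S with h | ⟨o, rfl⟩
    · rw [h]; simp
    · rw [optSet_injective.extend_apply]
      cases o with
      | none => simpa [optSet] using h2
      | some i => simpa [optSet] using h3 i
  · rw [← Fintype.sum_of_injective optSet optSet_injective
      (fun o => u o * ∏ i ∈ optSet o, f i), Fintype.sum_option, h4]
    · simp [optSet]
    · intro S hS
      rcases hr S with h | h
      · rw [h, zero_mul]
      · exact absurd h hS
    · intro o; rw [optSet_injective.extend_apply]
  · rw [← Fintype.sum_of_injective optSet optSet_injective (fun o => polyBits (u o))]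
    · exact h5
    · intro S hS
      rcases hr S with h | h
      · rw [h]; simp [polyBits]
      · exact absurd h hS
    · intro o; rw [optSet_injective.extend_apply]

section Biclique
variable {k m : ℕ}

lemma map_sizeX (R : Type) [CommRing R] :
    MvPolynomial.map (Int.castRingHom R) (sizeX ℤ k m) = sizeX R k m := by simp [sizeX]

lemma map_sizeY (R : Type) [CommRing R] :
    MvPolynomial.map (Int.castRingHom R) (sizeY ℤ k m) = sizeY R k m := by simp [sizeY]

lemma map_bicliqueEq (R : Type) [CommRing R] (H : BipGraph k m) (i : BicliqueIdx H) :
    MvPolynomial.map (Int.castRingHom R) (bicliqueEq ℤ H i) = bicliqueEq R H i := by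
  rcases i with u | v | _ | e <;> simp [bicliqueEq, map_sizeX, map_sizeY]

lemma sized_sizeX : Sized (sizeX ℤ k m) 1 k := by
  have := Sized.sum (s := Finset.univ) fun (u : Fin k) _ =>
    Sized.X (Sum.inl u : Fin k ⊕ Fin m)
  simpa [sizeX] using this

lemma sized_sizeY : Sized (sizeY ℤ k m) 1 m := by
  have := Sized.sum (s := Finset.univ) fun (u : Fin m) _ =>
    Sized.X (Sum.inr u : Fin k ⊕ Fin m)
  simpa [sizeY] using this

lemma sized_bicliqueEq (H : BipGraph k m) (i : BicliqueIdx H) :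
    Sized (bicliqueEq ℤ H i) 2 (2 * k + m + 2) := by
  rcases i with u | v | _ | e
  · exact (((Sized.X _).pow 2).sub ((Sized.X _).mono (by norm_num) le_rfl)).mono le_rfl (by omega)
  · exact (((Sized.X _).pow 2).sub ((Sized.X _).mono (by norm_num) le_rfl)).mono le_rfl (by omega)
  · refine (((sized_sizeX.add sized_sizeY).sub (Sized.const _)).mono (by norm_num) ?_)
    simp; omega
  · exact ((Sized.X _).mul (Sized.X _)).mono le_rfl (by omega)

lemma card_bicliqueIdx_le (H : BipGraph k m) :
    Fintype.card (BicliqueIdx H) ≤ k + m + 1 + k * m := by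
  have : Fintype.card {e : Fin k × Fin m // H e = false} ≤ k * m := by
    simpa using Fintype.card_subtype_le fun e : Fin k × Fin m => H e = false
  simp only [Fintype.card_sum, Fintype.card_fin, Fintype.card_unit]
  omega

variable {H : BipGraph k m} {a d c W L B : ℕ} {b : ℝ}

lemma isSumSq_C_real {σ : Type} {r : ℝ} (hr : 0 ≤ r) : IsSumSq (C r : MvPolynomial σ ℝ) := by
  rw [← Real.mul_self_sqrt hr, map_mul]; exact IsSumSq.mul_self _

lemma bicliqueSystem_eq (R : Type) [CommRing R] (i : BicliqueIdx H × Bool) :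
    bicliqueSystem R H i = if i.2 then bicliqueEq R H i.1 else - bicliqueEq R H i.1 := by
  rcases i with ⟨i, _ | _⟩ <;> rfl

set_option maxHeartbeats 1000000 in
/-- Certificates from integer certificates of `W * (c - |x|^a |y|) ≥ 0`. -/
theorem IntCert.bicliqueCertificate (hW : 0 < W) (hc : (c : ℝ) ≤ b)
    (h : IntCert (bicliqueEq ℤ H) d L ((W : MvPolynomial (Fin k ⊕ Fin m) ℤ) * (c - sizeX ℤ k m ^ a * sizeY ℤ k m)))
    (hB : 2 * (k + m + 1 + k * m) * (3 * (2 * k + m + 2)) + 3 * (c + k ^ a * m)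
      + (1 + 2 * (k + m + 1 + k * m)) * (L * (2 + W.size)) ≤ B) :
    BicliqueCertificate H d a b B := by
  obtain ⟨t, s, h1, h2, h3, h4⟩ := h
  have hWR : (W : ℝ) ≠ 0 := by positivity
  have hWQ : (W : ℚ) ≠ 0 := by positivity
  have hmapdeg : ∀ (R : Type) [CommRing R] (p : MvPolynomial (Fin k ⊕ Fin m) ℤ),
      (MvPolynomial.map (Int.castRingHom R) p).totalDegree ≤ p.totalDegree := by
    intro R _ p
    exact Finset.sup_mono (support_map_subset _ _)
  have hcdeg : ∀ (R : Type) [CommRing R] (x : R) (p : MvPolynomial (Fin k ⊕ Fin m) R),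
      (C x * p).totalDegree ≤ p.totalDegree := by
    intro R _ x p
    refine (totalDegree_mul _ _).trans ?_
    simp
  constructor
  · refine sosDerives_of_option (fun o => match o with
      | none => C (1 / (W : ℝ)) * MvPolynomial.map (Int.castRingHom ℝ) t + C (b - c)
      | some (j, β) => C (1 / (W : ℝ)) * MvPolynomial.map (Int.castRingHom ℝ) (s j β))
      ?_ ?_ ?_ ?_
    · rintro (_ | ⟨j, β⟩)
      · exact ((isSumSq_C_real (by positivity)).mul h1).add (isSumSq_C_real (by linarith))
      · exact (isSumSq_C_real (by positivity)).mul (h3 j β).1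
    · refine (totalDegree_add _ _).trans (max_le ((hcdeg _ _ _).trans ((hmapdeg _ _).trans h2.1)) ?_)
      rw [totalDegree_C]; exact Nat.zero_le _
    · rintro ⟨j, β⟩
      have key : (C (1 / (W : ℝ)) * MvPolynomial.map (Int.castRingHom ℝ) (s j β) *
          bicliqueEq ℝ H j).totalDegree ≤ d := by
        rw [mul_assoc, ← map_bicliqueEq, ← map_mul]
        exact (hcdeg _ _ _).trans ((hmapdeg _ _).trans (h3 j β).2.1)
      dsimp only
      rw [bicliqueSystem_eq]
      split_ifs
      · exact key
      · rw [mul_neg, totalDegree_neg]; exact key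
    · have h5 := congrArg (MvPolynomial.map (Int.castRingHom ℝ)) h4
      simp only [map_mul, map_sub, map_add, map_pow, map_natCast, map_sum, map_sizeX, map_sizeY,
        map_bicliqueEq] at h5
      have h6 : C (c : ℝ) - sizeX ℝ k m ^ a * sizeY ℝ k m = C (1 / (W : ℝ)) *
          ((W : MvPolynomial (Fin k ⊕ Fin m) ℝ) * ((c : MvPolynomial (Fin k ⊕ Fin m) ℝ) - sizeX ℝ k m ^ a * sizeY ℝ k m)) := by
        rw [← mul_assoc, ← map_natCast (C (σ := Fin k ⊕ Fin m) (R := ℝ)) W, ← C_mul]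
        simp [hWR]
      rw [Fintype.sum_prod_type]
      simp only [Fintype.sum_bool, bicliqueSystem_eq, if_true, Bool.false_eq_true, if_false]
      rw [show C b - sizeX ℝ k m ^ a * sizeY ℝ k m
        = (C (c : ℝ) - sizeX ℝ k m ^ a * sizeY ℝ k m) + C (b - c) by rw [C_sub]; ring, h6, h5,
        mul_add, Finset.mul_sum]
      rw [add_right_comm]
      congr 1
      exact Finset.sum_congr rfl fun j _ => by ring
  · refine ⟨c, by simpa using hc, ?_⟩
    have hcomp : (algebraMap ℚ ℝ).comp (Int.castRingHom ℚ) = Int.castRingHom ℝ :=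
      RingHom.ext_int _ _
    have hsos : ∀ p : MvPolynomial (Fin k ⊕ Fin m) ℤ, RealSOS p →
        IsSumSq (MvPolynomial.map (algebraMap ℚ ℝ) (ratPoly W p)) := by
      intro p hp
      rw [ratPoly, map_mul, map_C, MvPolynomial.map_map, hcomp]
      exact (isSumSq_C_real (by simp)).mul hp
    have h5 := congrArg (MvPolynomial.map (Int.castRingHom ℚ)) h4
    simp only [map_mul, map_sub, map_add, map_pow, map_natCast, map_sum, map_sizeX, map_sizeY,
        map_bicliqueEq] at h5
    refine sosDerivesBits_of_option (fun o => match o with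
      | none => ratPoly W t
      | some (j, β) => ratPoly W (s j β)) ?_ ?_ ?_ ?_ ?_
    · rintro (_ | ⟨j, β⟩)
      · exact hsos _ h1
      · exact hsos _ (h3 j β).1
    · exact (hcdeg _ _ _).trans ((hmapdeg _ _).trans h2.1)
    · rintro ⟨j, β⟩
      have key : (ratPoly W (s j β) * bicliqueEq ℚ H j).totalDegree ≤ d := by
        rw [ratPoly, mul_assoc, ← map_bicliqueEq, ← map_mul]
        exact (hcdeg _ _ _).trans ((hmapdeg _ _).trans (h3 j β).2.1)
      dsimp only
      rw [bicliqueSystem_eq]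
      split_ifs
      · exact key
      · rw [mul_neg, totalDegree_neg]; exact key
    · have h6 : C (c : ℚ) - sizeX ℚ k m ^ a * sizeY ℚ k m = C (1 / (W : ℚ)) *
          ((W : MvPolynomial (Fin k ⊕ Fin m) ℚ) * ((c : MvPolynomial (Fin k ⊕ Fin m) ℚ) - sizeX ℚ k m ^ a * sizeY ℚ k m)) := by
        rw [← mul_assoc, ← map_natCast (C (σ := Fin k ⊕ Fin m) (R := ℚ)) W, ← C_mul]
        simp [hWQ]
      rw [Fintype.sum_prod_type]
      simp only [Fintype.sum_bool, bicliqueSystem_eq, if_true, Bool.false_eq_true, if_false]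
      rw [h6, h5, mul_add, Finset.mul_sum]
      simp only [ratPoly]
      congr 1
      exact Finset.sum_congr rfl fun j _ => by ring
    · refine le_trans ?_ hB
      have hcard := card_bicliqueIdx_le H
      have e1 : ∑ i, polyBits (bicliqueSystem ℚ H i)
          ≤ 2 * (k + m + 1 + k * m) * (3 * (2 * k + m + 2)) := by
        have : ∀ i, polyBits (bicliqueSystem ℚ H i) ≤ 3 * (2 * k + m + 2) := by
          rintro ⟨i, β⟩
          have e : bicliqueSystem ℚ H (i, β) = MvPolynomial.map (Int.castRingHom ℚ)
              (if β then bicliqueEq ℤ H i else - bicliqueEq ℤ H i) := by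
            rw [bicliqueSystem_eq]
            cases β <;> simp [map_bicliqueEq]
          rw [e]
          refine (polyBits_map_le _).trans ?_
          have := (sized_bicliqueEq H i).2
          split_ifs
          · omega
          · rw [l1_neg]; omega
        calc ∑ i, polyBits (bicliqueSystem ℚ H i)
            ≤ ∑ i : BicliqueIdx H × Bool, 3 * (2 * k + m + 2) := Finset.sum_le_sum fun i _ => this i
          _ = Fintype.card (BicliqueIdx H) * 2 * (3 * (2 * k + m + 2)) := by simp
          _ ≤ _ := Nat.mul_le_mul_right _ (by linarith)
      have e2 : polyBits (C (c : ℚ) - sizeX ℚ k m ^ a * sizeY ℚ k m) ≤ 3 * (c + k ^ a * m) := by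
        have e : C (c : ℚ) - sizeX ℚ k m ^ a * sizeY ℚ k m = MvPolynomial.map (Int.castRingHom ℚ)
            ((c : MvPolynomial (Fin k ⊕ Fin m) ℤ) - sizeX ℤ k m ^ a * sizeY ℤ k m) := by simp [map_sizeX, map_sizeY]
        rw [e]
        refine (polyBits_map_le _).trans ?_
        have := ((Sized.natCast (d := a * 1 + 1) c).sub ((sized_sizeX.pow a).mul (sized_sizeY (k := k) (m := m)))).2
        omega
      have e3 : ∀ p : MvPolynomial (Fin k ⊕ Fin m) ℤ, l1 p ≤ L →
          polyBits (ratPoly W p) ≤ L * (2 + W.size) := fun p hp =>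
        (polyBits_ratPoly_le hW p).trans (by gcongr)
      refine Nat.add_le_add (Nat.add_le_add e1 e2) ?_
      rw [Fintype.sum_option, add_mul, one_mul]
      refine Nat.add_le_add (e3 _ h2.2) ?_
      calc ∑ i : BicliqueIdx H × Bool, polyBits (ratPoly W (s i.1 i.2))
          ≤ ∑ i : BicliqueIdx H × Bool, L * (2 + W.size) :=
            Finset.sum_le_sum fun i _ => e3 _ (h3 i.1 i.2).2.2
        _ = Fintype.card (BicliqueIdx H) * 2 * (L * (2 + W.size)) := by simp
        _ ≤ _ := Nat.mul_le_mul_right _ (by linarith)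

end Biclique

open scoped MatrixOrder in
lemma isSumSq_quadForm {σ : Type} {k : ℕ} {A : Matrix (Fin k) (Fin k) ℝ} (hA : A.PosSemidef)
    (e : Fin k → σ) :
    IsSumSq (∑ j, ∑ l, C (A j l) * (X (e j) * X (e l)) : MvPolynomial σ ℝ) := by
  obtain ⟨B, rfl⟩ := CStarAlgebra.nonneg_iff_eq_star_mul_self.mp hA.nonneg
  have : (∑ j, ∑ l, C ((star B * B) j l) * (X (e j) * X (e l)) : MvPolynomial σ ℝ)
      = ∑ i, (∑ j, C (B i j) * X (e j)) * (∑ j, C (B i j) * X (e j)) := by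
    simp only [Matrix.mul_apply, Matrix.star_apply, star_trivial, map_sum, map_mul,
      Finset.mul_sum, Finset.sum_mul]
    rw [Finset.sum_comm' (t' := Finset.univ) (s' := fun _ => Finset.univ) (by simp)]
    rw [Finset.sum_congr rfl fun j _ => Finset.sum_comm]
    rw [Finset.sum_comm]
    refine Finset.sum_congr rfl fun i _ => ?_
    rw [Finset.sum_comm]
    exact Finset.sum_congr rfl fun j _ => Finset.sum_congr rfl fun l _ => by ring
  rw [this]
  exact IsSumSq.sum_mul_self _ _

/-- Signed weights of edges and non-edges. -/
def signed (w s : ℕ) (b : Bool) : ℤ := if b then w else -s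

lemma natAbs_signed_le (w s : ℕ) (b : Bool) : (signed w s b).natAbs ≤ w + s := by
  cases b <;> simp [signed]

section Biclique
variable {k m : ℕ}

/-- The linear form in the left variables given by a right vertex. -/
noncomputable def colForm (H : BipGraph k m) (w s : ℕ) (v : Fin m) :
    MvPolynomial (Fin k ⊕ Fin m) ℤ :=
  ∑ u, C (signed w s (H (u, v))) * X (Sum.inl u)

variable (H : BipGraph k m) (w s : ℕ)

lemma sized_colForm (v : Fin m) : Sized (colForm H w s v) 1 (k * (w + s)) := by
  have := Sized.sum (s := Finset.univ) (f := fun u => C (signed w s (H (u, v))) *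
    (X (Sum.inl u) : MvPolynomial (Fin k ⊕ Fin m) ℤ)) (d := 1) (L := w + s) fun u _ =>
    (((Sized.const (d := 0) (signed w s (H (u, v)))).mono le_rfl (natAbs_signed_le w s _)).mul
      (Sized.X (Sum.inl u))).mono (by simp) (by simp)
  rwa [Finset.card_univ, Fintype.card_fin] at this

lemma colForm_idealCert (v : Fin m) :
    IdealCert (bicliqueEq ℤ H) 0 (k * (w + s))
      (X (Sum.inr v) * ((w : MvPolynomial (Fin k ⊕ Fin m) ℤ) * sizeX ℤ k m - colForm H w s v)) := by
  have e : X (Sum.inr v) * ((w : MvPolynomial (Fin k ⊕ Fin m) ℤ) * sizeX ℤ k m - colForm H w s v)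
      = ∑ u, C ((w : ℤ) - signed w s (H (u, v))) * (X (Sum.inl u) * X (Sum.inr v)) := by
    rw [sizeX, colForm, Finset.mul_sum, ← Finset.sum_sub_distrib, Finset.mul_sum]
    refine Finset.sum_congr rfl fun u _ => ?_
    rw [C_sub]; simp only [map_natCast]; ring
  rw [e]
  have := IdealCert.sum (f := bicliqueEq ℤ H) (d := 0) (L := w + s) (s := Finset.univ)
    (g := fun u => C ((w : ℤ) - signed w s (H (u, v))) *
    (X (Sum.inl u) * X (Sum.inr v) : MvPolynomial (Fin k ⊕ Fin m) ℤ)) fun u _ => by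
      by_cases h : H (u, v) = true
      · simpa [h, signed] using IdealCert.zero
      · have h' : H (u, v) = false := by simpa using h
        have := (Sized.const (d := 0) ((w : ℤ) + s)).mul_idealCert
          (IdealCert.eqn (f := bicliqueEq ℤ H) (d := 0) (.inr (.inr (.inr ⟨(u, v), h'⟩))))
        simp only [h', signed]
        have e2 : (w : ℤ) - (if false = true then (w : ℤ) else -s) = w + s := by simp
        rw [e2]
        exact this.mono (by norm_num) (by rw [mul_one]; omega)
  simpa using this

lemma bicliqueEq_degree (i : BicliqueIdx H) : (bicliqueEq ℤ H i).totalDegree ≤ 2 :=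
  (sized_bicliqueEq H i).1

variable {H w s}

lemma realSOS_spectral {Λ : ℕ}
    (hΛ : ∀ x : Fin k → ℝ, ∑ v, (∑ u, (signed w s (H (u, v)) : ℝ) * x u) ^ 2 ≤ Λ * ∑ u, x u ^ 2) :
    RealSOS ((Λ : MvPolynomial (Fin k ⊕ Fin m) ℤ) * ∑ u : Fin k, X (Sum.inl u) ^ 2
      - ∑ v, colForm H w s v ^ 2) := by
  set M : Matrix (Fin k) (Fin m) ℝ := fun u v => (signed w s (H (u, v)) : ℝ) with hM
  have hpsd : ((Λ : ℝ) • (1 : Matrix (Fin k) (Fin k) ℝ) - M * M.transpose).PosSemidef := by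
    rw [Matrix.posSemidef_iff_dotProduct_mulVec]
    constructor
    · rw [Matrix.IsHermitian, Matrix.conjTranspose_sub]
      simp [Matrix.conjTranspose_eq_transpose_of_trivial]
    · intro x
      rw [Matrix.sub_mulVec, dotProduct_sub, ← Matrix.mulVec_mulVec, Matrix.dotProduct_mulVec (star x) M]
      have h1 : Matrix.vecMul (star x) M = fun v => ∑ u, M u v * x u := by
        ext v; simp [Matrix.vecMul, dotProduct, mul_comm]
      have h2 : Matrix.mulVec M.transpose x = fun v => ∑ u, M u v * x u := by
        ext v; simp [Matrix.mulVec, dotProduct]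
      rw [h1, h2, Matrix.smul_mulVec, Matrix.one_mulVec]
      have := hΛ x
      simp only [dotProduct, star_trivial, Pi.smul_apply, smul_eq_mul, Finset.mul_sum] at this ⊢
      rw [sub_nonneg]
      refine le_trans (le_of_eq ?_) (this.trans (le_of_eq ?_))
      · exact Finset.sum_congr rfl fun v _ => by rw [hM]; simp only [pow_two, Finset.mul_sum]
      · exact Finset.sum_congr rfl fun v _ => by ring
  have := isSumSq_quadForm hpsd (fun u => (Sum.inl u : Fin k ⊕ Fin m))
  unfold RealSOS
  convert this using 1
  simp only [map_sub, map_mul, map_natCast, map_sum, map_pow, map_X, colForm, map_C,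
    Matrix.sub_apply, Matrix.smul_apply, Matrix.mul_apply, Matrix.transpose_apply, sub_mul,
    Finset.sum_sub_distrib]
  simp only [eq_intCast]
  congr 1
  · simp [Matrix.one_apply, Finset.mul_sum, pow_two, apply_ite C, ite_mul]
  · simp only [hM, pow_two, Finset.mul_sum, Finset.sum_mul]
    rw [Finset.sum_comm]
    refine Finset.sum_congr rfl fun j _ => ?_
    rw [Finset.sum_comm]
    exact Finset.sum_congr rfl fun l _ => Finset.sum_congr rfl fun v _ => by ring

end Biclique

section Biclique
variable {k m : ℕ} {H : BipGraph k m} {w s n : ℕ}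

lemma sos_lagrange (y f : Fin m → MvPolynomial (Fin k ⊕ Fin m) ℤ) :
    2 * ((∑ v, y v ^ 2) * ∑ v, f v ^ 2 - (∑ v, y v * f v) ^ 2)
      = ∑ v, ∑ v', (y v * f v' - y v' * f v) ^ 2 := by
  have : ∀ v v', (y v * f v' - y v' * f v) ^ 2
      = y v ^ 2 * f v' ^ 2 + f v ^ 2 * y v' ^ 2 - 2 * ((y v * f v) * (y v' * f v')) := by
    intros; ring
  simp_rw [this, Finset.sum_sub_distrib, Finset.sum_add_distrib, ← Finset.mul_sum,
    ← Finset.sum_mul]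
  ring

lemma sized_sumSqX : Sized (∑ u : Fin k, X (Sum.inl u) ^ 2 : MvPolynomial (Fin k ⊕ Fin m) ℤ) 2 k := by
  have := Sized.sum (s := Finset.univ) fun (u : Fin k) _ =>
    (Sized.X (Sum.inl u : Fin k ⊕ Fin m)).pow 2
  simpa using this

lemma sized_sumSqY : Sized (∑ u : Fin m, X (Sum.inr u) ^ 2 : MvPolynomial (Fin k ⊕ Fin m) ℤ) 2 m := by
  have := Sized.sum (s := Finset.univ) fun (u : Fin m) _ =>
    (Sized.X (Sum.inr u : Fin k ⊕ Fin m)).pow 2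
  simpa using this

/-- A spectral bound on the signed adjacency matrix gives a degree-4 certificate. -/
theorem intCert_of_spectral {Λ c : ℕ} (hn : 20 ≤ n) (hk : k ≤ n) (hm : m ≤ n) (hws : w + s ≤ n)
    (hΛn : Λ ≤ n ^ 6) (hcn : c ≤ n ^ 6) (hc : Λ ≤ c * w ^ 2)
    (hΛ : ∀ x : Fin k → ℝ, ∑ v, (∑ u, (signed w s (H (u, v)) : ℝ) * x u) ^ 2 ≤ Λ * ∑ u, x u ^ 2) :
    IntCert (bicliqueEq ℤ H) 4 (n ^ 40)
      (((4 * Λ * w ^ 2 : ℕ) : MvPolynomial (Fin k ⊕ Fin m) ℤ) *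
        (c - sizeX ℤ k m ^ 1 * sizeY ℤ k m)) := by
  have hw : w ≤ n := by omega
  have hn1 : 1 ≤ n := by omega
  set a : MvPolynomial (Fin k ⊕ Fin m) ℤ := sizeX ℤ k m with ha
  set b : MvPolynomial (Fin k ⊕ Fin m) ℤ := sizeY ℤ k m with hb
  set f := colForm H w s with hf
  set y : Fin m → MvPolynomial (Fin k ⊕ Fin m) ℤ := fun v => X (Sum.inr v) with hy
  set z := ∑ v, y v * f v with hz
  set a' : MvPolynomial (Fin k ⊕ Fin m) ℤ := ∑ u : Fin k, X (Sum.inl u) ^ 2 with ha'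
  set b' := ∑ v, y v ^ 2 with hb'
  have hsf : ∀ v, Sized (f v) 1 (n ^ 2) := fun v => (sized_colForm H w s v).mono le_rfl (by
    rw [pow_two]; exact Nat.mul_le_mul hk hws)
  have hsy : ∀ v, Sized (y v) 1 1 := fun v => Sized.X _
  have hsz : Sized z 2 (n ^ 3) := (Sized.sum fun v _ => (hsy v).mul (hsf v)).mono le_rfl (by
    rw [Finset.card_univ, Fintype.card_fin, one_mul, pow_succ' n 2]; gcongr)
  have hsb' : Sized b' 2 n := sized_sumSqY.mono le_rfl hm
  have hsa' : Sized a' 2 n := sized_sumSqX.mono le_rfl hk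
  have hsb : Sized b 1 n := sized_sizeY.mono le_rfl hm
  have h2n : ∀ e, n ^ e + n ^ e ≤ n ^ (e + 1) := fun e => by
    rw [pow_succ, ← mul_two]; gcongr; omega
  have c4 : Sized (4 : MvPolynomial (Fin k ⊕ Fin m) ℤ) 0 n := by
    simpa using (Sized.natCast (σ := Fin k ⊕ Fin m) (d := 0) 4).mono le_rfl (by omega : 4 ≤ n)
  have p4 : RealSOS (4 : MvPolynomial (Fin k ⊕ Fin m) ℤ) := by
    simpa using RealSOS.natCast (σ := Fin k ⊕ Fin m) 4
  have c2 : Sized (2 : MvPolynomial (Fin k ⊕ Fin m) ℤ) 0 n := by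
    simpa using (Sized.natCast (σ := Fin k ⊕ Fin m) (d := 0) 2).mono le_rfl (by omega : 2 ≤ n)
  have p2 : RealSOS (2 : MvPolynomial (Fin k ⊕ Fin m) ℤ) := by
    simpa using RealSOS.natCast (σ := Fin k ⊕ Fin m) 2
  have cw : Sized (w : MvPolynomial (Fin k ⊕ Fin m) ℤ) 0 n := (Sized.natCast w).mono le_rfl hw
  have cw2 : Sized ((w : MvPolynomial (Fin k ⊕ Fin m) ℤ) ^ 2) 0 (n ^ 2) := cw.pow 2
  have cΛ : Sized (Λ : MvPolynomial (Fin k ⊕ Fin m) ℤ) 0 (n ^ 6) :=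
    (Sized.natCast Λ).mono le_rfl hΛn
  have pw : ∀ {e e' : ℕ}, e ≤ e' → n ^ e ≤ n ^ e' := fun h => Nat.pow_le_pow_right hn1 h
  have t1 : IntCert (bicliqueEq ℤ H) 4 (n ^ 35) (4 * ((Λ : MvPolynomial (Fin k ⊕ Fin m) ℤ) - (w : MvPolynomial (Fin k ⊕ Fin m) ℤ) * z) ^ 2) := by
    have h1 : Sized ((Λ : MvPolynomial (Fin k ⊕ Fin m) ℤ) - (w : MvPolynomial (Fin k ⊕ Fin m) ℤ) * z) 2 (n ^ 7) :=
      ((cΛ.mono (by norm_num) le_rfl).sub ((cw.mul hsz).mono (by norm_num)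
        ((pow_succ' n 3).symm.le.trans (pw (by norm_num : 4 ≤ 6))))).mono le_rfl (h2n 6)
    refine (IntCert.sos (p4.mul (RealSOS.sq _)) (c4.mul (h1.pow 2))).mono (by norm_num) ?_
    rw [← pow_mul, ← pow_succ']; exact pw (by norm_num)
  have t2 : IntCert (bicliqueEq ℤ H) 4 (n ^ 35)
      (4 * ((w : MvPolynomial (Fin k ⊕ Fin m) ℤ) ^ 2 * (b' * ∑ v, f v ^ 2 - z ^ 2))) := by
    have e : 4 * ((w : MvPolynomial (Fin k ⊕ Fin m) ℤ) ^ 2 * (b' * ∑ v, f v ^ 2 - z ^ 2))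
        = 2 * w ^ 2 * ∑ v, ∑ v', (y v * f v' - y v' * f v) ^ 2 := by
      rw [← sos_lagrange]; ring
    rw [e]
    have h1 : ∀ v v', Sized ((y v * f v' - y v' * f v) ^ 2) 4 (n ^ 6) := fun v v' =>
      ((((hsy v).mul (hsf v')).sub ((hsy v').mul (hsf v))).pow 2).mono (by norm_num) (by
        rw [one_mul, show n ^ 6 = (n ^ 3) ^ 2 by ring]
        gcongr; exact h2n 2)
    have h2 : Sized (∑ v, ∑ v', (y v * f v' - y v' * f v) ^ 2) 4 (n ^ 8) :=
      (Sized.sum fun v _ => Sized.sum fun v' _ => h1 v v').mono le_rfl (by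
        rw [Finset.card_univ, Fintype.card_fin, show n ^ 8 = n * (n * n ^ 6) by ring]; gcongr)
    refine (IntCert.sos ((p2.mul (RealSOS.sq _)).mul (RealSOS.sum fun v _ => RealSOS.sum
      fun v' _ => RealSOS.sq _)) ((c2.mul cw2).mul h2)).mono (by norm_num) ?_
    rw [show n * n ^ 2 * n ^ 8 = n ^ 11 by ring]; exact pw (by norm_num)
  have t3 : IntCert (bicliqueEq ℤ H) 4 (n ^ 35)
      (4 * ((w : MvPolynomial (Fin k ⊕ Fin m) ℤ) ^ 2 * (b' * (Λ * a' - ∑ v, f v ^ 2)))) := by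
    have h1 : Sized (∑ v, f v ^ 2) 2 (n ^ 7) :=
      (Sized.sum fun v _ => (hsf v).pow 2).mono le_rfl (by
        rw [Finset.card_univ, Fintype.card_fin]
        calc m * (n ^ 2) ^ 2 ≤ n * (n ^ 2) ^ 2 := by gcongr
          _ = n ^ 5 := by ring
          _ ≤ _ := pw (by norm_num))
    have h2 : Sized ((Λ : MvPolynomial (Fin k ⊕ Fin m) ℤ) * a' - ∑ v, f v ^ 2) 2 (n ^ 8) :=
      (((cΛ.mul hsa').mono (by norm_num) (by rw [← pow_succ])).sub h1).mono le_rfl (h2n 7)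
    refine (IntCert.sos (p4.mul ((RealSOS.sq _).mul ((RealSOS.sum fun v _ => RealSOS.sq _).mul
      (realSOS_spectral hΛ)))) (c4.mul (cw2.mul (hsb'.mul h2)))).mono (by norm_num) ?_
    rw [show n * (n ^ 2 * (n * n ^ 8)) = n ^ 12 by ring]; exact pw (by norm_num)
  have t4 : IntCert (bicliqueEq ℤ H) 4 (n ^ 35)
      (4 * (2 * (Λ * (w * -(∑ v, y v * (w * a - f v)))))) := by
    have h1 : IdealCert (bicliqueEq ℤ H) 0 (n ^ 3) (∑ v, y v * (w * a - f v)) :=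
      (IdealCert.sum fun v _ => colForm_idealCert H w s v).mono le_rfl (by
        rw [Finset.card_univ, Fintype.card_fin, show n ^ 3 = n * (n * n) by ring]; gcongr)
    refine ((c2.mul_idealCert (cΛ.mul_idealCert (cw.mul_idealCert h1.neg))).intCert
      (bicliqueEq_degree H)).mono (by norm_num) ?_
    rw [show n * (n ^ 6 * (n * n ^ 3)) = n ^ 11 by ring]
    calc (n ^ 11 + 1) ^ 2 ≤ (n ^ 12) ^ 2 := by
          gcongr
          exact le_trans (by gcongr; exact Nat.one_le_pow _ _ hn1) (h2n 11)
      _ = n ^ 24 := by ring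
      _ ≤ _ := pw (by norm_num)
  have t5 : IntCert (bicliqueEq ℤ H) 4 (n ^ 35)
      (4 * ((w : MvPolynomial (Fin k ⊕ Fin m) ℤ) ^ 2 * (Λ * (b * (a - a'))))) := by
    have h1 : IdealCert (bicliqueEq ℤ H) 0 n (a - a') := by
      have : a - a' = ∑ u, -bicliqueEq ℤ H (.inl u) := by
        rw [ha, sizeX, ha', ← Finset.sum_sub_distrib]
        exact Finset.sum_congr rfl fun u _ => by simp [bicliqueEq]
      rw [this]
      exact (IdealCert.sum fun u _ => (IdealCert.eqn _).neg).mono le_rfl (by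
        rw [Finset.card_univ, Fintype.card_fin]; omega)
    refine ((cw2.mul_idealCert (cΛ.mul_idealCert (hsb.mul_idealCert h1))).intCert
      (bicliqueEq_degree H)).mono (by norm_num) ?_
    rw [show n ^ 2 * (n ^ 6 * (n * n)) = n ^ 10 by ring]
    calc (n ^ 10 + 1) ^ 2 ≤ (n ^ 11) ^ 2 := by
          gcongr
          exact le_trans (by gcongr; exact Nat.one_le_pow _ _ hn1) (h2n 10)
      _ = n ^ 22 := by ring
      _ ≤ _ := pw (by norm_num)
  have t6 : IntCert (bicliqueEq ℤ H) 4 (n ^ 35)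
      (4 * ((w : MvPolynomial (Fin k ⊕ Fin m) ℤ) ^ 2 * (Λ * (∑ v, a' * -bicliqueEq ℤ H (.inr (.inl v)))))) := by
    have h1 : IntCert (bicliqueEq ℤ H) 4 (n * n) (∑ v, a' * -bicliqueEq ℤ H (.inr (.inl v))) :=
      (IntCert.sum fun v _ => IntCert.sos_mul_neg_eqn (RealSOS.sum fun u _ => RealSOS.sq _) hsa'
        (bicliqueEq_degree H) _).mono le_rfl (by
        rw [Finset.card_univ, Fintype.card_fin]; gcongr)
    refine (((h1.sos_mul (RealSOS.natCast Λ) cΛ).sos_mul (RealSOS.sq _) cw2).sos_mul p4 c4).mono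
      (by norm_num) ?_
    rw [show n * (n ^ 2 * (n ^ 6 * (n * n))) = n ^ 11 by ring]; exact pw (by norm_num)
  have t7 : IntCert (bicliqueEq ℤ H) 4 (n ^ 35)
      (((4 * Λ * (c * w ^ 2 - Λ) : ℕ)) : MvPolynomial (Fin k ⊕ Fin m) ℤ) := by
    refine IntCert.sos (RealSOS.natCast _) ((Sized.natCast _).mono le_rfl ?_)
    calc 4 * Λ * (c * w ^ 2 - Λ) ≤ n * n ^ 6 * (n ^ 6 * n ^ 2) := by
          gcongr
          · omega
          · exact (Nat.sub_le _ _).trans (by gcongr)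
      _ = n ^ 15 := by ring
      _ ≤ _ := pw (by norm_num)
  refine ((((((((t1.add t2).add t3).add t4).add t5).add t6).add t7).mono le_rfl (M := n ^ 40) ?_)) |>.congr ?_
  · rw [show n ^ 40 = n ^ 5 * n ^ 35 by ring]
    have : 20 ≤ n ^ 5 := hn.trans (by simpa using pw (by norm_num : 1 ≤ 5))
    nlinarith [Nat.zero_le (n ^ 35)]
  · have hb2 : ∑ v, a' * -bicliqueEq ℤ H (.inr (.inl v)) = a' * (b - b') := by
      rw [← Finset.mul_sum, hb, sizeY, hb', ← Finset.sum_sub_distrib]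
      congr 1
      exact Finset.sum_congr rfl fun u _ => by simp [bicliqueEq, hy]
    have hz2 : ∑ v, y v * (w * a - f v) = w * a * b - z := by
      rw [hz, hb, sizeY, Finset.mul_sum, ← Finset.sum_sub_distrib]
      exact Finset.sum_congr rfl fun u _ => by simp only [hy]; ring
    rw [hb2, hz2]
    push_cast [Nat.cast_sub hc]
    ring

end Biclique

/-- Every value of the tuple is attained at least twice. -/
def AllRepeated {α : Type} {j : ℕ} (t : Fin j → α) : Prop := ∀ i, ∃ i', i' ≠ i ∧ t i' = t i

lemma AllRepeated.exists_factor {α : Type} [DecidableEq α] {r : ℕ} (hr : 1 ≤ r)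
    {t : Fin (2 * r) → α} (ht : AllRepeated t) :
    ∃ (g : Fin r → α) (π : Fin (2 * r) → Fin r), t = g ∘ π ∧
      Finset.univ.image g = Finset.univ.image t := by
  set S := Finset.univ.image t with hS
  have hcard : S.card ≤ r := by
    have h1 : ∑ b ∈ S, 2 ≤ ∑ b ∈ S, (Finset.univ.filter fun i => t i = b).card := by
      refine Finset.sum_le_sum fun b hb => ?_
      obtain ⟨i, -, rfl⟩ := Finset.mem_image.mp hb
      obtain ⟨i', hne, he⟩ := ht i
      exact Finset.one_lt_card.mpr ⟨i', by simp [he], i, by simp, hne⟩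
    rw [← Finset.card_eq_sum_card_image, Finset.sum_const, Finset.card_univ, Fintype.card_fin,
      smul_eq_mul] at h1
    omega
  have hne : Nonempty S := ⟨⟨t ⟨0, by omega⟩, Finset.mem_image_of_mem _ (Finset.mem_univ _)⟩⟩
  obtain ⟨e⟩ : Nonempty (S ↪ Fin r) := Function.Embedding.nonempty_of_card_le (by simpa using hcard)
  refine ⟨fun j => (Function.invFun e j : S), fun i => e ⟨t i, Finset.mem_image_of_mem _
    (Finset.mem_univ _)⟩, ?_, ?_⟩
  · funext i
    simp [Function.leftInverse_invFun e.injective _]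
  · have hmem : ∀ b, b ∈ S ↔ ∃ i, t i = b := fun b => by simp [hS]
    ext b
    rw [hmem, Finset.mem_image]
    constructor
    · rintro ⟨j, -, rfl⟩
      exact (hmem _).mp (Function.invFun e j).2
    · rintro ⟨i, rfl⟩
      exact ⟨e ⟨t i, Finset.mem_image_of_mem _ (Finset.mem_univ _)⟩, Finset.mem_univ _,
        by rw [Function.leftInverse_invFun e.injective _]⟩

section Biclique
variable {k m : ℕ} {H : BipGraph k m}

/-- The monomial `∏ x_{t i}` in the left variables. -/
noncomputable def leftMon {k : ℕ} (m : ℕ) {j : ℕ} (t : Fin j → Fin k) :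
    MvPolynomial (Fin k ⊕ Fin m) ℤ :=
  ∏ i, X (Sum.inl (t i))

lemma sized_leftMon {j : ℕ} (t : Fin j → Fin k) : Sized (leftMon m t) j 1 := by
  simpa [leftMon] using Sized.prod fun i => Sized.X (Sum.inl (t i) : Fin k ⊕ Fin m)

lemma sizeX_pow (r : ℕ) : sizeX ℤ k m ^ r = ∑ t : Fin r → Fin k, leftMon m t := by
  rw [sizeX, Fintype.sum_pow]; rfl

/-- The product of the left variables in a list. -/
noncomputable def listMon {k : ℕ} (m : ℕ) (l : List (Fin k)) : MvPolynomial (Fin k ⊕ Fin m) ℤ :=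
  (l.map fun u => X (Sum.inl u)).prod

lemma sized_listMon (l : List (Fin k)) : Sized (listMon m l) l.length 1 := by
  induction l with
  | nil => simpa [listMon] using Sized.one
  | cons u l ih =>
    simp only [listMon, List.map_cons, List.prod_cons, List.length_cons] at ih ⊢
    exact ((Sized.X _).mul ih).mono (by omega) (by norm_num)

lemma listMon_reduce (l : List (Fin k)) : ∀ (h : List (Fin k)) {e : ℕ}, h.length + l.length ≤ e + 2 →
    IdealCert (bicliqueEq ℤ H) e l.length
      (listMon m h * (listMon m l - ∏ u ∈ l.toFinset, X (Sum.inl u))) := by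
  induction l with
  | nil => intro h e _; simpa [listMon] using IdealCert.zero
  | cons u l ih =>
    intro h e he
    simp only [List.length_cons] at he ⊢
    by_cases hu : u ∈ l
    · have h1 := ih h (e := e) (by omega)
      have hp : listMon m l = X (Sum.inl u) * listMon m (l.erase u) := by
        have := ((List.perm_cons_erase hu).map
          fun u => (X (Sum.inl u) : MvPolynomial (Fin k ⊕ Fin m) ℤ)).prod_eq
        simpa [listMon] using this
      have hlen : (l.erase u).length + 1 = l.length := by
        rw [List.length_erase_of_mem hu]
        have := List.length_pos_of_mem hu
        omega
      have h2 := (((sized_listMon (m := m) h).mul (sized_listMon (l.erase u))).mul_idealCert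
        (IdealCert.eqn (f := bicliqueEq ℤ H) (d := 0) (.inl u))).mono (e := e) (M := 1)
          (by omega) (by norm_num)
      refine ((h1.add h2).mono le_rfl le_rfl).congr ?_
      rw [List.toFinset_cons, Finset.insert_eq_of_mem (List.mem_toFinset.mpr hu)]
      have : listMon m (u :: l) = X (Sum.inl u) * listMon m l := by simp [listMon]
      rw [this, hp]
      simp only [bicliqueEq]
      ring
    · have h1 := ih (u :: h) (e := e) (by simp only [List.length_cons]; omega)
      refine (h1.mono le_rfl (Nat.le_succ _)).congr ?_
      rw [List.toFinset_cons, Finset.prod_insert (by simpa using hu)]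
      simp only [listMon, List.map_cons, List.prod_cons]
      ring

lemma leftMon_sub_idealCert {i j e : ℕ} (t : Fin i → Fin k) (g : Fin j → Fin k)
    (h : Finset.univ.image g = Finset.univ.image t) (hi : i ≤ e + 2) (hj : j ≤ e + 2) :
    IdealCert (bicliqueEq ℤ H) e (j + i) (leftMon m g - leftMon m t) := by
  have key : ∀ {i : ℕ} (t : Fin i → Fin k), i ≤ e + 2 → IdealCert (bicliqueEq ℤ H) e i
      (leftMon m t - ∏ u ∈ Finset.univ.image t, X (Sum.inl u)) := by
    intro i t hi
    have := listMon_reduce (H := H) (List.ofFn t) [] (e := e) (by simpa using hi)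
    have e1 : (List.ofFn t).toFinset = Finset.univ.image t := by
      ext; simp [List.mem_ofFn]
    rw [e1, List.length_ofFn] at this
    refine this.congr ?_
    simp [listMon, leftMon, List.map_ofFn, List.prod_ofFn]
  refine ((key g hj).add (key t hi).neg).congr ?_
  rw [h]; ring

lemma leftMon_intCert {j : ℕ} (t : Fin j → Fin k) :
    IntCert (bicliqueEq ℤ H) (2 * j) (4 * j + 4) (4 * leftMon m t) := by
  induction j with
  | zero =>
    have h4 : Sized (4 : MvPolynomial (Fin k ⊕ Fin m) ℤ) 0 4 := by
      simpa using (Sized.natCast (σ := Fin k ⊕ Fin m) (d := 0) 4)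
    have p4 : RealSOS (4 : MvPolynomial (Fin k ⊕ Fin m) ℤ) := by
      simpa using RealSOS.natCast (σ := Fin k ⊕ Fin m) 4
    simpa [leftMon] using IntCert.sos p4 h4
  | succ j ih =>
    have h1 := (ih fun i => t i.succ).sos_mul (RealSOS.sq (X (Sum.inl (t 0))))
      ((Sized.X (Sum.inl (t 0) : Fin k ⊕ Fin m)).pow 2)
    have h2 := ((sized_leftMon (m := m) fun i => t i.succ).mul_idealCert
      (IdealCert.eqn (f := bicliqueEq ℤ H) (d := 0) (.inl (t 0)))).neg.intCert (bicliqueEq_degree H)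
    refine ((h1.mono (by omega) le_rfl).add (h2.mono (by omega) le_rfl)).mono le_rfl ?_ |>.congr ?_
    · norm_num; omega
    · rw [leftMon, Fin.prod_univ_succ, leftMon]
      simp only [bicliqueEq]
      ring

end Biclique

section Biclique
variable {k m : ℕ} {H : BipGraph k m} {w s n r : ℕ}

/-- The sum over the right vertices of products of signed weights along a tuple of left vertices. -/
def tupleSum (H : BipGraph k m) (w s : ℕ) {j : ℕ} (t : Fin j → Fin k) : ℤ :=
  ∑ v, ∏ i, signed w s (H (t i, v))

lemma sum_colForm_pow (j : ℕ) :
    ∑ v, colForm H w s v ^ j = ∑ t : Fin j → Fin k, C (tupleSum H w s t) * leftMon m t := by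
  simp only [colForm, Fintype.sum_pow, Finset.prod_mul_distrib]
  rw [Finset.sum_comm]
  refine Finset.sum_congr rfl fun t _ => ?_
  rw [tupleSum, map_sum, Finset.sum_mul]
  exact Finset.sum_congr rfl fun v _ => by rw [map_prod]; rfl

lemma two_mul_pow_le (hn : 2 ≤ n) (e : ℕ) : n ^ e + n ^ e ≤ n ^ (e + 1) := by
  rw [pow_succ, ← mul_two]; gcongr

/-- Tuples in which every value is repeated are dominated by shorter tuples. -/
lemma allRepeated_intCert (hn : 20 ≤ n) (hk : k ≤ n) (hr : 1 ≤ r) (hrn : r ≤ n)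
    (S : Finset (Fin (2 * r) → Fin k)) (hS : ∀ t ∈ S, AllRepeated t) :
    IntCert (bicliqueEq ℤ H) (4 * r) (n ^ (4 * r + 9))
      (4 * ((r : MvPolynomial (Fin k ⊕ Fin m) ℤ) ^ (2 * r) * sizeX ℤ k m ^ r
        - ∑ t ∈ S, leftMon m t)) := by
  classical
  have hn1 : 1 ≤ n := by omega
  have pw : ∀ {e e' : ℕ}, e ≤ e' → n ^ e ≤ n ^ e' := fun h => Nat.pow_le_pow_right hn1 h
  have hchoose : ∀ t : Fin (2 * r) → Fin k, ∃ (g : Fin r → Fin k) (π : Fin (2 * r) → Fin r),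
      AllRepeated t → (t = g ∘ π ∧ Finset.univ.image g = Finset.univ.image t) := by
    intro t
    by_cases ht : AllRepeated t
    · obtain ⟨g, π, h⟩ := ht.exists_factor hr
      exact ⟨g, π, fun _ => h⟩
    · exact ⟨fun i => t ⟨i, by omega⟩, fun _ => ⟨0, by omega⟩, fun h => absurd h ht⟩
  choose g π hgπ using hchoose
  have hcount : ∀ h : Fin r → Fin k, (S.filter fun t => g t = h).card ≤ r ^ (2 * r) := by
    intro h
    have : Fintype.card (Fin (2 * r) → Fin r) = r ^ (2 * r) := by simp
    rw [← this, ← Finset.card_univ]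
    refine Finset.card_le_card_of_injOn π (fun _ _ => Finset.mem_coe.mpr (Finset.mem_univ _)) ?_
    intro t ht t' ht' he
    simp only [Finset.coe_filter, Set.mem_ofPred_eq] at ht ht'
    rw [(hgπ t (hS t ht.1)).1, (hgπ t' (hS t' ht'.1)).1, ht.2, ht'.2, he]
  have h1 : IntCert (bicliqueEq ℤ H) (4 * r) (n ^ (3 * r + 2))
      (∑ h : Fin r → Fin k, ((r ^ (2 * r) - (S.filter fun t => g t = h).card : ℕ) :
        MvPolynomial (Fin k ⊕ Fin m) ℤ) * (4 * leftMon m h)) := by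
    refine (IntCert.sum (L := r ^ (2 * r) * n ^ 2) fun h _ =>
      ((leftMon_intCert h).nat_mul _).mono (by omega) ?_).mono le_rfl ?_
    · gcongr
      · exact Nat.sub_le _ _
      · nlinarith
    · rw [Finset.card_univ, Fintype.card_fun, Fintype.card_fin, Fintype.card_fin]
      calc k ^ r * (r ^ (2 * r) * n ^ 2) ≤ n ^ r * (n ^ (2 * r) * n ^ 2) := by gcongr
        _ = n ^ (3 * r + 2) := by ring
  have h2 : IntCert (bicliqueEq ℤ H) (4 * r) (n ^ (4 * r + 8))
      (4 * ∑ t ∈ S, (leftMon m (g t) - leftMon m t)) := by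
    have := (IdealCert.sum (s := S) fun t ht => leftMon_sub_idealCert (H := H) (m := m) (e := 2 * r - 1)
      t (g t) (hgπ t (hS t ht)).2 (by omega) (by omega)).intCert (bicliqueEq_degree H)
    refine this.mono (by omega) ?_
    have hSc : S.card ≤ n ^ (2 * r) := by
      refine (Finset.card_le_univ S).trans ?_
      rw [Fintype.card_fun, Fintype.card_fin, Fintype.card_fin]
      gcongr
    calc (S.card * (r + 2 * r) + 1) ^ 2 ≤ (n ^ (2 * r) * n ^ 2 + n ^ (2 * r + 2)) ^ 2 := by
          gcongr
          · nlinarith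
          · exact Nat.one_le_pow _ _ hn1
      _ = (n ^ (2 * r + 2) + n ^ (2 * r + 2)) ^ 2 := by rw [← pow_add]
      _ ≤ (n ^ (2 * r + 3)) ^ 2 := by
          gcongr; exact two_mul_pow_le (by omega) _
      _ = n ^ (4 * r + 6) := by ring
      _ ≤ _ := pw (by omega)
  refine ((h1.add h2).mono le_rfl ?_).congr ?_
  · calc n ^ (3 * r + 2) + n ^ (4 * r + 8) ≤ n ^ (4 * r + 8) + n ^ (4 * r + 8) := by
          gcongr ?_ + _; exact pw (by omega)
      _ ≤ _ := two_mul_pow_le (by omega) _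
  · have e1 : ∑ t ∈ S, leftMon m (g t)
        = ∑ h : Fin r → Fin k, ((S.filter fun t => g t = h).card :
          MvPolynomial (Fin k ⊕ Fin m) ℤ) * leftMon m h := by
      rw [← Finset.sum_fiberwise S g]
      refine Finset.sum_congr rfl fun h _ => ?_
      rw [Finset.sum_congr rfl (g := fun _ => leftMon m h) fun t ht => by
        rw [(Finset.mem_filter.mp ht).2]]
      simp
    have e2 : ∑ h : Fin r → Fin k, ((r ^ (2 * r) - (S.filter fun t => g t = h).card : ℕ) :
        MvPolynomial (Fin k ⊕ Fin m) ℤ) * (4 * leftMon m h)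
        = 4 * ((r : MvPolynomial (Fin k ⊕ Fin m) ℤ) ^ (2 * r) * ∑ h : Fin r → Fin k, leftMon m h)
          - 4 * ∑ h : Fin r → Fin k, ((S.filter fun t => g t = h).card :
          MvPolynomial (Fin k ⊕ Fin m) ℤ) * leftMon m h := by
      rw [Finset.mul_sum, Finset.mul_sum, Finset.mul_sum, ← Finset.sum_sub_distrib]
      refine Finset.sum_congr rfl fun h _ => ?_
      rw [Nat.cast_sub (hcount h)]
      push_cast
      ring
    rw [e2, Finset.sum_sub_distrib, e1, sizeX_pow]
    ring

/-- `D |x|^r + Δ |x|^(2r) - w^(2r) |x|^(2r) |y|` -/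
noncomputable def gapPoly (k m w r D Δ : ℕ) : MvPolynomial (Fin k ⊕ Fin m) ℤ :=
  D * sizeX ℤ k m ^ r + Δ * sizeX ℤ k m ^ (2 * r)
    - (w : MvPolynomial (Fin k ⊕ Fin m) ℤ) ^ (2 * r) * sizeX ℤ k m ^ (2 * r) * sizeY ℤ k m

lemma pow_sub_colForm_idealCert (hn : 20 ≤ n) (hk : k ≤ n) (hws : w + s ≤ n)
    (hr : 1 ≤ r) (hrn : r ≤ n) (v : Fin m) :
    IdealCert (bicliqueEq ℤ H) (2 * r - 1) (n ^ (4 * r + 2))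
      (X (Sum.inr v) * (((w : MvPolynomial (Fin k ⊕ Fin m) ℤ) * sizeX ℤ k m) ^ (2 * r)
        - colForm H w s v ^ (2 * r))) := by
  have hn1 : 1 ≤ n := by omega
  have hsf : Sized (colForm H w s v) 1 (n ^ 2) := (sized_colForm H w s v).mono le_rfl (by
    rw [pow_two]; exact Nat.mul_le_mul hk hws)
  have hsw : Sized ((w : MvPolynomial (Fin k ⊕ Fin m) ℤ) * sizeX ℤ k m) 1 (n ^ 2) :=
    ((Sized.natCast (d := 0) w).mul sized_sizeX).mono (by norm_num) (by
      rw [pow_two]; exact Nat.mul_le_mul (by omega) hk)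
  have hg := Sized.sum (s := Finset.range (2 * r)) (d := 2 * r - 1) (L := n ^ (4 * r - 2))
    (f := fun i => ((w : MvPolynomial (Fin k ⊕ Fin m) ℤ) * sizeX ℤ k m) ^ i
      * colForm H w s v ^ (2 * r - 1 - i)) fun i hi => by
      have := Finset.mem_range.mp hi
      refine ((hsw.pow i).mul (hsf.pow (2 * r - 1 - i))).mono (by omega) ?_
      rw [← pow_mul, ← pow_mul, ← pow_add]
      exact Nat.pow_le_pow_right hn1 (by omega)
  refine ((hg.mul_idealCert (colForm_idealCert H w s v)).mono (by omega) ?_).congr ?_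
  · rw [Finset.card_range]
    have h2 : 2 ≤ n := by omega
    calc 2 * r * n ^ (4 * r - 2) * (k * (w + s)) ≤ n * n * n ^ (4 * r - 2) * (n * n) := by gcongr
      _ = n ^ (4 * r - 2 + 4) := by ring
      _ = n ^ (4 * r + 2) := by congr 1; omega
  · rw [← geom_sum₂_mul]; ring

end Biclique

section Biclique
variable {k m : ℕ} {H : BipGraph k m} {w s n r : ℕ}

lemma abs_tupleSum_le {μ j : ℕ} (hμ : ∀ b, |signed w s b| ≤ μ) (t : Fin j → Fin k) :
    |tupleSum H w s t| ≤ (m * μ ^ j : ℕ) := by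
  refine (Finset.abs_sum_le_sum_abs _ _).trans ?_
  have : ∀ v, |∏ i, signed w s (H (t i, v))| ≤ (μ : ℤ) ^ j := fun v => by
    rw [Finset.abs_prod]
    calc ∏ i, |signed w s (H (t i, v))| ≤ ∏ i : Fin j, (μ : ℤ) :=
          Finset.prod_le_prod (fun _ _ => abs_nonneg _) fun i _ => hμ _
      _ = _ := by simp
  calc ∑ v, |∏ i, signed w s (H (t i, v))| ≤ ∑ v : Fin m, (μ : ℤ) ^ j :=
        Finset.sum_le_sum fun v _ => this v
    _ = _ := by simp

/-- If the signed sums along all tuples with an unrepeated value are at most `Δ`, the gap polynomial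
is nonnegative. -/
lemma gapPoly_intCert {μ Δ : ℕ} (hn : 20 ≤ n) (hk : k ≤ n) (hm : m ≤ n) (hws : w + s ≤ n)
    (hμn : μ ≤ n) (hΔn : Δ ≤ n ^ (2 * r + 1)) (hr : 1 ≤ r) (hrn : r ≤ n)
    (hμ : ∀ b, |signed w s b| ≤ μ)
    (hΔ : ∀ t : Fin (2 * r) → Fin k, ¬ AllRepeated t → tupleSum H w s t ≤ Δ) :
    IntCert (bicliqueEq ℤ H) (4 * r) (n ^ (8 * r + 12))
      (4 * gapPoly k m w r (m * μ ^ (2 * r) * r ^ (2 * r)) Δ) := by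
  classical
  have hn1 : 1 ≤ n := by omega
  have hn2 : 2 ≤ n := by omega
  have pw : ∀ {e e' : ℕ}, e ≤ e' → n ^ e ≤ n ^ e' := fun h => Nat.pow_le_pow_right hn1 h
  have hmμ : m * μ ^ (2 * r) ≤ n ^ (2 * r + 1) := by
    rw [pow_succ']; gcongr
  set N := m * μ ^ (2 * r) with hN
  set S := Finset.univ.filter fun t : Fin (2 * r) → Fin k => AllRepeated t with hS
  set c : (Fin (2 * r) → Fin k) → ℤ := fun t =>
    Δ + (if AllRepeated t then (N : ℤ) else 0) - tupleSum H w s t with hc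
  have hc0 : ∀ t, 0 ≤ c t := by
    intro t
    simp only [hc]
    split_ifs with h
    · have := (abs_le.mp (abs_tupleSum_le (H := H) hμ t)).2
      omega
    · have := hΔ t h
      omega
  have hcn : ∀ t, (c t).toNat ≤ n ^ (2 * r + 2) := by
    intro t
    have h1 := (abs_le.mp (abs_tupleSum_le (H := H) hμ t)).1
    have h2 : 3 * n ^ (2 * r + 1) ≤ n ^ (2 * r + 2) := by
      rw [pow_succ n (2 * r + 1), mul_comm]; gcongr; omega
    rw [Int.toNat_le]
    have h3 : c t ≤ Δ + N + N := by
      simp only [hc]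
      split_ifs <;> omega
    refine h3.trans ?_
    exact_mod_cast (by omega : Δ + N + N ≤ n ^ (2 * r + 2))
  have t1 : IntCert (bicliqueEq ℤ H) (4 * r) (n ^ (8 * r + 11))
      (∑ t, ((c t).toNat : MvPolynomial (Fin k ⊕ Fin m) ℤ) * (4 * leftMon m t)) := by
    refine (IntCert.sum (L := n ^ (2 * r + 2) * n ^ 2) fun t _ =>
      ((leftMon_intCert t).nat_mul _).mono (by omega) ?_).mono le_rfl ?_
    · gcongr
      · exact hcn t
      · nlinarith
    · rw [Finset.card_univ, Fintype.card_fun, Fintype.card_fin, Fintype.card_fin]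
      calc k ^ (2 * r) * (n ^ (2 * r + 2) * n ^ 2)
          ≤ n ^ (2 * r) * (n ^ (2 * r + 2) * n ^ 2) := by gcongr
        _ = n ^ (4 * r + 4) := by ring
        _ ≤ _ := pw (by omega)
  have t2 : IntCert (bicliqueEq ℤ H) (4 * r) (n ^ (8 * r + 11))
      (N * (4 * ((r : MvPolynomial (Fin k ⊕ Fin m) ℤ) ^ (2 * r) * sizeX ℤ k m ^ r
        - ∑ t ∈ S, leftMon m t))) := by
    refine ((allRepeated_intCert hn hk hr hrn S fun t ht => (Finset.mem_filter.mp ht).2).nat_mul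
      N).mono le_rfl ?_
    calc N * n ^ (4 * r + 9) ≤ n ^ (2 * r + 1) * n ^ (4 * r + 9) := by gcongr
      _ = n ^ (6 * r + 10) := by ring
      _ ≤ _ := pw (by omega)
  have hsf : ∀ v, Sized (colForm H w s v ^ (2 * r)) (2 * r) (n ^ (4 * r)) := fun v =>
    (((sized_colForm H w s v).mono le_rfl (by
      rw [pow_two]; exact Nat.mul_le_mul hk hws : _ ≤ n ^ 2)).pow (2 * r)).mono (by omega) (by
      rw [← pow_mul]; exact pw (by omega))
  have hpf : ∀ v, RealSOS (colForm H w s v ^ (2 * r)) := fun v => by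
    rw [mul_comm 2 r, pow_mul]; exact RealSOS.sq _
  have t3 : IntCert (bicliqueEq ℤ H) (4 * r) (n ^ (8 * r + 11))
      (4 * ∑ v, (colForm H w s v ^ (2 * r) * (1 - X (Sum.inr v)) ^ 2
        + colForm H w s v ^ (2 * r) * -bicliqueEq ℤ H (.inr (.inl v)))) := by
    have h1 : ∀ v : Fin m, Sized ((1 - X (Sum.inr v) : MvPolynomial (Fin k ⊕ Fin m) ℤ) ^ 2) 2 4 :=
      fun v => ((Sized.one.sub (Sized.X _)).pow 2).mono (by norm_num) (by norm_num)
    have h2 := (IntCert.sum (s := Finset.univ) fun v _ =>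
      (IntCert.sos (f := bicliqueEq ℤ H) ((hpf v).mul (RealSOS.sq (1 - X (Sum.inr v))))
        ((hsf v).mul (h1 v))).add (IntCert.sos_mul_neg_eqn (hpf v) (hsf v) (bicliqueEq_degree H)
        (.inr (.inl v)))).nat_mul 4
    refine (h2.mono (by omega) ?_).congr (by push_cast; rfl)
    rw [Finset.card_univ, Fintype.card_fin]
    calc 4 * (m * (n ^ (4 * r) * 4 + n ^ (4 * r))) ≤ n * (n * (n ^ (4 * r) * n + n ^ (4 * r) * n)) := by
          gcongr
          · omega
          · omega
          · exact Nat.le_mul_of_pos_right _ hn1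
      _ = n ^ 2 * (n ^ (4 * r + 1) + n ^ (4 * r + 1)) := by ring
      _ ≤ n ^ 2 * n ^ (4 * r + 1 + 1) := by gcongr; exact two_mul_pow_le hn2 _
      _ = n ^ (4 * r + 4) := by ring
      _ ≤ _ := pw (by omega)
  have t4 : IntCert (bicliqueEq ℤ H) (4 * r) (n ^ (8 * r + 11))
      (4 * ∑ v, -(X (Sum.inr v) * (((w : MvPolynomial (Fin k ⊕ Fin m) ℤ) * sizeX ℤ k m) ^ (2 * r)
        - colForm H w s v ^ (2 * r)))) := by
    refine ((IdealCert.sum (s := Finset.univ) fun v _ =>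
      (pow_sub_colForm_idealCert hn hk hws hr hrn v).neg).intCert (bicliqueEq_degree H)).mono
      (by omega) ?_
    rw [Finset.card_univ, Fintype.card_fin]
    calc (m * n ^ (4 * r + 2) + 1) ^ 2 ≤ (n * n ^ (4 * r + 2) + n ^ (4 * r + 3)) ^ 2 := by
          gcongr; exact Nat.one_le_pow _ _ hn1
      _ = (n ^ (4 * r + 3) + n ^ (4 * r + 3)) ^ 2 := by ring
      _ ≤ (n ^ (4 * r + 3 + 1)) ^ 2 := by gcongr; exact two_mul_pow_le hn2 _
      _ = n ^ (8 * r + 8) := by ring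
      _ ≤ _ := pw (by omega)
  refine ((((t1.add t2).add t3).add t4).mono le_rfl ?_).congr ?_
  · rw [pow_succ n (8 * r + 11)]
    nlinarith [Nat.zero_le (n ^ (8 * r + 11))]
  · have e1 : ∑ t, ((c t).toNat : MvPolynomial (Fin k ⊕ Fin m) ℤ) * (4 * leftMon m t)
        = 4 * (Δ * sizeX ℤ k m ^ (2 * r) + N * ∑ t ∈ S, leftMon m t
          - ∑ v, colForm H w s v ^ (2 * r)) := by
      rw [sum_colForm_pow, sizeX_pow, hS, Finset.sum_filter, Finset.mul_sum, Finset.mul_sum,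
        ← Finset.sum_add_distrib, ← Finset.sum_sub_distrib, Finset.mul_sum]
      refine Finset.sum_congr rfl fun t _ => ?_
      have : ((c t).toNat : MvPolynomial (Fin k ⊕ Fin m) ℤ) = C (c t) := by
        have h := congrArg (Int.cast : ℤ → MvPolynomial (Fin k ⊕ Fin m) ℤ)
          (Int.toNat_of_nonneg (hc0 t))
        rw [Int.cast_natCast] at h
        rw [h, eq_intCast]
      rw [this]
      simp only [hc, C_sub, C_add]
      split_ifs <;> simp <;> ring
    have e3 : ∀ v, colForm H w s v ^ (2 * r) * (1 - X (Sum.inr v)) ^ 2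
        + colForm H w s v ^ (2 * r) * -bicliqueEq ℤ H (.inr (.inl v))
        = colForm H w s v ^ (2 * r) - X (Sum.inr v) * colForm H w s v ^ (2 * r) := by
      intro v; simp only [bicliqueEq]; ring
    have e4 : ∑ v : Fin m, X (Sum.inr v) * ((w : MvPolynomial (Fin k ⊕ Fin m) ℤ) * sizeX ℤ k m) ^ (2 * r)
        = (w : MvPolynomial (Fin k ⊕ Fin m) ℤ) ^ (2 * r) * sizeX ℤ k m ^ (2 * r) * sizeY ℤ k m := by
      rw [← Finset.sum_mul, sizeY]; ring
    rw [e1]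
    simp only [e3, mul_sub, Finset.sum_sub_distrib, Finset.sum_neg_distrib, e4, gapPoly]
    push_cast
    ring

/-- A right vertex of the biclique with at most `k - δ` neighbours forces `|y| ≥ δ`. -/
lemma sizeY_intCert {δ : ℕ} (hn : 20 ≤ n) (hk : k ≤ n) (v : Fin m)
    (hv : (Finset.univ.filter fun u => H (u, v) = true).card + δ ≤ k) :
    IntCert (bicliqueEq ℤ H) 4 (n ^ 4)
      (4 * (X (Sum.inr v) ^ 2 * (sizeY ℤ k m - (δ : MvPolynomial (Fin k ⊕ Fin m) ℤ)))) := by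
  classical
  set y : MvPolynomial (Fin k ⊕ Fin m) ℤ := X (Sum.inr v) with hy
  set d := (Finset.univ.filter fun u => H (u, v) = true).card with hd
  have hsy : Sized (y ^ 2) 2 1 := ((Sized.X _).pow 2).mono (by norm_num) (by norm_num)
  have t1 := ((IntCert.sos_mul_eqn (RealSOS.sq y) hsy (bicliqueEq_degree H)
    (.inr (.inr (.inl ())))).mono (e := 4) (by norm_num) le_rfl).nat_mul 4
  have t2 : IntCert (bicliqueEq ℤ H) 4 n (((k - δ - d : ℕ) : MvPolynomial (Fin k ⊕ Fin m) ℤ) * y ^ 2) :=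
    IntCert.sos ((RealSOS.natCast _).mul (RealSOS.sq _)) (((Sized.natCast (d := 0) _).mul hsy).mono
      (by norm_num) (by omega))
  have t3 : ∀ u, IntCert (bicliqueEq ℤ H) 4 20 (4 * (if H (u, v) = true
      then y ^ 2 * (1 - X (Sum.inl u)) else -(y ^ 2 * X (Sum.inl u)))) := by
    intro u
    split_ifs with h
    · have h1 : Sized ((1 - X (Sum.inl u) : MvPolynomial (Fin k ⊕ Fin m) ℤ) ^ 2) 2 4 :=
        ((Sized.one.sub (Sized.X _)).pow 2).mono (by norm_num) (by norm_num)
      have h2 := ((IntCert.sos (f := bicliqueEq ℤ H) ((RealSOS.sq y).mul (RealSOS.sq (1 - X (Sum.inl u))))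
        (hsy.mul h1)).add (IntCert.sos_mul_neg_eqn (RealSOS.sq y) hsy (bicliqueEq_degree H)
        (.inl u))).nat_mul 4
      refine (h2.mono (by norm_num) (by norm_num)).congr ?_
      simp only [bicliqueEq]; push_cast; ring
    · have h' : H (u, v) = false := by simpa using h
      have h2 := ((Sized.X (Sum.inr v)).mul_idealCert (IdealCert.eqn (f := bicliqueEq ℤ H) (d := 0)
          (.inr (.inr (.inr ⟨(u, v), h'⟩))))).neg.intCert (bicliqueEq_degree H)
      refine (h2.mono (by norm_num) (by norm_num)).congr ?_
      simp only [bicliqueEq]; ring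
  have t4 := IntCert.sum (s := Finset.univ) fun u _ => t3 u
  refine (((t1.add (t2.nat_mul 4)).add t4).mono le_rfl ?_).congr ?_
  · rw [Finset.card_univ, Fintype.card_fin]
    have : n ^ 4 = n ^ 2 * (n * n) := by ring
    have h3 : 400 ≤ n ^ 2 := by nlinarith
    nlinarith
  · rw [← Finset.mul_sum]
    have e1 : ∑ u, (if H (u, v) = true then y ^ 2 * (1 - X (Sum.inl u)) else -(y ^ 2 * X (Sum.inl u)))
        = y ^ 2 * (d - sizeX ℤ k m) := by
      have : ∀ u : Fin k, (if H (u, v) = true then y ^ 2 * (1 - X (Sum.inl u)) else -(y ^ 2 * X (Sum.inl u)))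
          = (if H (u, v) = true then y ^ 2 else 0) - y ^ 2 * X (Sum.inl u) := by
        intro u; split_ifs <;> ring
      simp only [this, Finset.sum_sub_distrib, ← Finset.sum_filter, Finset.sum_const, ← hd,
        ← Finset.mul_sum, sizeX, nsmul_eq_mul]
      ring
    rw [e1, Nat.cast_sub (by omega), Nat.cast_sub (by omega)]
    simp only [bicliqueEq]
    simp
    ring

end Biclique

section Biclique
variable {k m : ℕ} {H : BipGraph k m} {w s n r : ℕ}

set_option maxHeartbeats 1000000 in
/-- Bounds on the signed sums along tuples and on the degrees of the right vertices give a
certificate of degree `6r + 2`. -/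
theorem intCert_of_tupleSum {μ Δ δ c M : ℕ} (hn : 20 ≤ n) (hk : k ≤ n) (hm : m ≤ n)
    (hws : w + s ≤ n) (hμn : μ ≤ n) (hΔn : Δ ≤ n ^ (2 * r + 1)) (hr : 1 ≤ r) (hrn : r ≤ n)
    (hμ : ∀ b, |signed w s b| ≤ μ)
    (hΔ : ∀ t : Fin (2 * r) → Fin k, ¬ AllRepeated t → tupleSum H w s t ≤ Δ)
    (hδ : ∀ v, (Finset.univ.filter fun u => H (u, v) = true).card + δ ≤ k)
    (hδn : δ ≤ n) (hM : M + Δ = w ^ (2 * r) * δ) (hcn : c ≤ n ^ (40 * r))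
    (hc : m * (m * μ ^ (2 * r) * r ^ (2 * r)) ^ 4 ≤ c * M ^ 4) :
    IntCert (bicliqueEq ℤ H) (6 * r + 2) (n ^ (60 * r))
      (((4 * M ^ 4 : ℕ) : MvPolynomial (Fin k ⊕ Fin m) ℤ) *
        (c - sizeX ℤ k m ^ (4 * r) * sizeY ℤ k m)) := by
  have hn1 : 1 ≤ n := by omega
  have hn2 : 2 ≤ n := by omega
  have pw : ∀ {e e' : ℕ}, e ≤ e' → n ^ e ≤ n ^ e' := fun h => Nat.pow_le_pow_right hn1 h
  set D := m * μ ^ (2 * r) * r ^ (2 * r) with hD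
  have hgap := gapPoly_intCert (H := H) hn hk hm hws hμn hΔn hr hrn hμ hΔ
  rw [← hD] at hgap
  have hDn : D ≤ n ^ (4 * r + 1) := by
    calc D ≤ n * n ^ (2 * r) * n ^ (2 * r) := by rw [hD]; gcongr
      _ = _ := by ring
  have hMn : M ≤ n ^ (2 * r + 1) := by
    calc M ≤ w ^ (2 * r) * δ := by omega
      _ ≤ n ^ (2 * r) * n := by gcongr; omega
      _ = _ := by ring
  set a : MvPolynomial (Fin k ⊕ Fin m) ℤ := sizeX ℤ k m with ha
  set b : MvPolynomial (Fin k ⊕ Fin m) ℤ := sizeY ℤ k m with hb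
  set z := a ^ r with hz
  have hsz : Sized z r (n ^ r) := (sized_sizeX.pow r).mono (by omega) (by gcongr)
  obtain ⟨Dp, hDp⟩ : ∃ Dp : MvPolynomial (Fin k ⊕ Fin m) ℤ, Dp = (D : MvPolynomial (Fin k ⊕ Fin m) ℤ) := ⟨_, rfl⟩
  obtain ⟨Mp, hMp⟩ : ∃ Mp : MvPolynomial (Fin k ⊕ Fin m) ℤ, Mp = (M : MvPolynomial (Fin k ⊕ Fin m) ℤ) := ⟨_, rfl⟩
  have hM' : Mp = (w : MvPolynomial (Fin k ⊕ Fin m) ℤ) ^ (2 * r) * δ - Δ := by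
    rw [eq_sub_iff_add_eq, hMp]; exact_mod_cast congrArg (Nat.cast : ℕ → MvPolynomial (Fin k ⊕ Fin m) ℤ) hM
  have hsy : ∀ v : Fin m, Sized ((X (Sum.inr v) : MvPolynomial (Fin k ⊕ Fin m) ℤ) ^ 2) 2 1 :=
    fun v => ((Sized.X _).pow 2).mono (by norm_num) (by norm_num)
  have hsz2 : Sized (z ^ 2) (2 * r) (n ^ (2 * r)) := (hsz.pow 2).mono le_rfl (by
    rw [← pow_mul]; exact pw (by omega))
  have t1 : ∀ v : Fin m, IntCert (bicliqueEq ℤ H) (4 * r + 2) (n ^ (8 * r + 13))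
      (4 * (X (Sum.inr v) ^ 2 * (Dp * z - Mp * z ^ 2))) := by
    intro v
    have h1 := hgap.sos_mul (RealSOS.sq _) (hsy v)
    have h2 := ((sizeY_intCert hn hk v (hδ v)).sos_mul (RealSOS.sq z) hsz2).nat_mul (w ^ (2 * r))
    refine (((h1.mono (by omega) le_rfl).add (h2.mono (by omega) le_rfl)).mono le_rfl ?_).congr ?_
    · calc 1 * n ^ (8 * r + 12) + w ^ (2 * r) * (n ^ (2 * r) * n ^ 4)
          ≤ n ^ (8 * r + 12) + n ^ (2 * r) * (n ^ (2 * r) * n ^ 4) := by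
            rw [one_mul]; gcongr; omega
        _ = n ^ (8 * r + 12) + n ^ (4 * r + 4) := by ring
        _ ≤ n ^ (8 * r + 12) + n ^ (8 * r + 12) := Nat.add_le_add (pw (by omega)) (pw (by omega))
        _ ≤ _ := two_mul_pow_le hn2 _
    · rw [gapPoly, hM', hDp]
      push_cast
      ring
  have hsM : Sized Mp 0 (n ^ (2 * r + 1)) :=
    hMp ▸ (Sized.natCast M).mono le_rfl hMn
  have hsD : Sized Dp 0 (n ^ (4 * r + 1)) :=
    hDp ▸ (Sized.natCast D).mono le_rfl hDn
  have hsE : Sized (Dp ^ 2 + Mp ^ 2 * z ^ 2) (2 * r) (n ^ (8 * r + 3)) := by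
    refine (((hsD.pow 2).mono (by omega) le_rfl).add
      (((hsM.pow 2).mul hsz2).mono (by omega) le_rfl)).mono le_rfl ?_
    calc (n ^ (4 * r + 1)) ^ 2 + (n ^ (2 * r + 1)) ^ 2 * n ^ (2 * r)
        = n ^ (8 * r + 2) + n ^ (6 * r + 2) := by ring
      _ ≤ n ^ (8 * r + 2) + n ^ (8 * r + 2) := Nat.add_le_add (pw (by omega)) (pw (by omega))
      _ ≤ _ := two_mul_pow_le hn2 _
  have hpE : RealSOS (Dp ^ 2 + Mp ^ 2 * z ^ 2) :=
    (RealSOS.sq _).add ((RealSOS.sq _).mul (RealSOS.sq _))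
  have hsF : Sized ((Dp - Mp * z) ^ 2) (2 * r) (n ^ (8 * r + 4)) := by
    have h1 : Sized (Dp - Mp * z) r (n ^ (4 * r + 2)) := by
      refine ((hsD.mono (by omega) le_rfl).sub ((hsM.mul hsz).mono (by omega) ?_)).mono le_rfl
        (two_mul_pow_le hn2 _)
      rw [← pow_add]; exact pw (by omega)
    refine (h1.pow 2).mono le_rfl ?_
    rw [← pow_mul]; exact pw (by omega)
  have t2 : ∀ v : Fin m, IntCert (bicliqueEq ℤ H) (6 * r + 2) (n ^ (18 * r + 19))
      (4 * (X (Sum.inr v) ^ 2 * (Dp ^ 4 - Mp ^ 4 * z ^ 4))) := by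
    intro v
    have h1 := (IntCert.sos (f := bicliqueEq ℤ H) ((RealSOS.sq (X (Sum.inr v))).mul (hpE.mul
      (RealSOS.sq (Dp - Mp * z)))) ((hsy v).mul (hsE.mul hsF))).nat_mul 4
    have h2 := ((t1 v).sos_mul hpE hsE).nat_mul (2 * M)
    refine (((h1.mono (by omega) le_rfl).add (h2.mono (by omega) le_rfl)).mono le_rfl ?_).congr ?_
    · calc 4 * (1 * (n ^ (8 * r + 3) * n ^ (8 * r + 4))) + 2 * M * (n ^ (8 * r + 3) * n ^ (8 * r + 13))
          ≤ n * (1 * (n ^ (8 * r + 3) * n ^ (8 * r + 4)))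
            + n * n ^ (2 * r + 1) * (n ^ (8 * r + 3) * n ^ (8 * r + 13)) := by
            gcongr; omega
        _ = n ^ (16 * r + 8) + n ^ (18 * r + 18) := by ring
        _ ≤ n ^ (18 * r + 18) + n ^ (18 * r + 18) := Nat.add_le_add (pw (by omega)) (pw (by omega))
        _ ≤ _ := two_mul_pow_le hn2 _
    · push_cast; rw [← hMp]; ring
  have t3 : ∀ v : Fin m, IntCert (bicliqueEq ℤ H) (6 * r + 2) (n ^ (16 * r + 6))
      (4 * (Dp ^ 4 * (1 - X (Sum.inr v) ^ 2))) := by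
    intro v
    have hs1 : Sized ((1 - X (Sum.inr v) : MvPolynomial (Fin k ⊕ Fin m) ℤ) ^ 2) 2 4 :=
      ((Sized.one.sub (Sized.X _)).pow 2).mono (by norm_num) (by norm_num)
    have h1 := IntCert.sos (f := bicliqueEq ℤ H) (RealSOS.sq (1 - X (Sum.inr v))) hs1
    have h2 := (IntCert.sos_mul_neg_eqn RealSOS.one (Sized.one (d := 0)) (bicliqueEq_degree H)
      (.inr (.inl v))).nat_mul 2
    have h3 := ((h1.add h2).sos_mul ((RealSOS.sq (Dp ^ 2))) ((hsD.pow 2).pow 2)).nat_mul 4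
    refine (h3.mono (by omega) ?_).congr ?_
    · calc 4 * (((n ^ (4 * r + 1)) ^ 2) ^ 2 * (4 + 2 * 1))
          ≤ n * (((n ^ (4 * r + 1)) ^ 2) ^ 2 * n) := by gcongr <;> omega
        _ = n ^ (16 * r + 6) := by ring
    · simp only [bicliqueEq]; push_cast; ring
  have t4 : ∀ v : Fin m, IntCert (bicliqueEq ℤ H) (6 * r + 2) (n ^ (12 * r + 5))
      (4 * ((Mp ^ 2 * z ^ 2) ^ 2 * bicliqueEq ℤ H (.inr (.inl v)))) := by
    intro v
    have h1 := (IntCert.sos_mul_eqn (RealSOS.sq (Mp ^ 2 * z ^ 2)) (((hsM.pow 2).mul hsz2).pow 2)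
      (bicliqueEq_degree H) (.inr (.inl v))).nat_mul 4
    refine (h1.mono (by omega) ?_).congr (by push_cast; ring)
    calc 4 * ((n ^ (2 * r + 1)) ^ 2 * n ^ (2 * r)) ^ 2
        ≤ n * ((n ^ (2 * r + 1)) ^ 2 * n ^ (2 * r)) ^ 2 := by gcongr; omega
      _ = n ^ (12 * r + 5) := by ring
  have t5 : IntCert (bicliqueEq ℤ H) (6 * r + 2) (n ^ (48 * r + 5))
      ((4 * (c * M ^ 4 - m * D ^ 4) : ℕ) : MvPolynomial (Fin k ⊕ Fin m) ℤ) := by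
    refine IntCert.sos (RealSOS.natCast _) ((Sized.natCast _).mono le_rfl ?_)
    calc 4 * (c * M ^ 4 - m * D ^ 4) ≤ n * (n ^ (40 * r) * (n ^ (2 * r + 1)) ^ 4) := by
          gcongr
          · omega
          · exact (Nat.sub_le _ _).trans (by gcongr)
      _ = n ^ (48 * r + 5) := by ring
  have t6 := (IntCert.sum (s := Finset.univ) fun v _ =>
    (((t2 v).mono le_rfl (pw (by omega : _ ≤ 18 * r + 19))).add ((t3 v).mono le_rfl
      (pw (by omega : _ ≤ 18 * r + 19)))).add ((t4 v).mono le_rfl (pw (by omega : _ ≤ 18 * r + 19))))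
  refine ((t6.add t5).mono le_rfl ?_).congr ?_
  · rw [Finset.card_univ, Fintype.card_fin]
    calc m * (n ^ (18 * r + 19) + n ^ (18 * r + 19) + n ^ (18 * r + 19)) + n ^ (48 * r + 5)
        = m * 3 * n ^ (18 * r + 19) + n ^ (48 * r + 5) := by ring
      _ ≤ n * n * n ^ (18 * r + 19) + n ^ (48 * r + 5) := by gcongr; omega
      _ = n ^ (18 * r + 21) + n ^ (48 * r + 5) := by ring
      _ ≤ n ^ (48 * r + 5) + n ^ (48 * r + 5) := Nat.add_le_add (pw (by omega)) (pw (by omega))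
      _ ≤ n ^ (48 * r + 5 + 1) := two_mul_pow_le hn2 _
      _ ≤ _ := pw (by omega)
  · have e1 : ∀ v : Fin m, 4 * (X (Sum.inr v) ^ 2 * (Dp ^ 4 - Mp ^ 4 * z ^ 4))
        + 4 * (Dp ^ 4 * (1 - X (Sum.inr v) ^ 2))
        + 4 * ((Mp ^ 2 * z ^ 2) ^ 2 * bicliqueEq ℤ H (.inr (.inl v)))
        = 4 * Dp ^ 4 - 4 * (Mp ^ 4 * z ^ 4) * X (Sum.inr v) := by
      intro v; simp only [bicliqueEq]; ring
    simp only [e1, Finset.sum_sub_distrib, ← Finset.mul_sum, Finset.sum_const, Finset.card_univ,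
      Fintype.card_fin, nsmul_eq_mul]
    have e2 : ∑ v : Fin m, (X (Sum.inr v) : MvPolynomial (Fin k ⊕ Fin m) ℤ) = b := by rw [hb, sizeY]
    rw [e2]
    rw [show a ^ (4 * r) = z ^ 4 by rw [hz]; ring]
    push_cast [Nat.cast_sub hc]
    rw [← hMp, ← hDp]
    ring

end Biclique

/-- The weights of a Bernoulli variable. -/
def bernWeight (p : ℝ) (b : Bool) : ℝ := if b then p else 1 - p

/-- The expectation of a function of independent Bernoulli variables. -/
noncomputable def bernExp {ι : Type} [Fintype ι] [DecidableEq ι] (p : ℝ) (F : (ι → Bool) → ℝ) : ℝ :=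
  ∑ H, (∏ i, bernWeight p (H i)) * F H

section BernExp
variable {ι : Type} [Fintype ι] [DecidableEq ι] {p : ℝ}

lemma bernWeight_nonneg (h0 : 0 ≤ p) (h1 : p ≤ 1) (b : Bool) : 0 ≤ bernWeight p b := by
  cases b <;> simp [bernWeight] <;> linarith

lemma bernExp_prod (g : ι → Bool → ℝ) :
    bernExp p (fun H : ι → Bool => ∏ i, g i (H i))
      = ∏ i, (p * g i true + (1 - p) * g i false) := by
  unfold bernExp
  simp_rw [← Finset.prod_mul_distrib]
  have := Finset.prod_univ_sum (fun _ : ι => (Finset.univ : Finset Bool))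
    (fun i b => bernWeight p b * g i b)
  rw [Fintype.piFinset_univ] at this
  rw [← this]
  simp [bernWeight]

lemma bernExp_const (c : ℝ) : bernExp p (fun _ : ι → Bool => c) = c := by
  have := bernExp_prod (p := p) (fun (_ : ι) _ => (1 : ℝ))
  simp only [Finset.prod_const_one, mul_one, add_sub_cancel] at this
  unfold bernExp at this ⊢
  rw [← Finset.sum_mul]
  simp only [mul_one] at this
  rw [this, one_mul]

lemma bernExp_add (F G : (ι → Bool) → ℝ) :
    bernExp p (fun H => F H + G H) = bernExp p F + bernExp p G := by
  simp [bernExp, mul_add, Finset.sum_add_distrib]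

lemma bernExp_const_mul (c : ℝ) (F : (ι → Bool) → ℝ) :
    bernExp p (fun H => c * F H) = c * bernExp p F := by
  simp only [bernExp, Finset.mul_sum]
  exact Finset.sum_congr rfl fun _ _ => by ring

lemma bernExp_sum {κ : Type*} (s : Finset κ) (F : κ → (ι → Bool) → ℝ) :
    bernExp p (fun H => ∑ a ∈ s, F a H) = ∑ a ∈ s, bernExp p (F a) := by
  simp only [bernExp, Finset.mul_sum]
  rw [Finset.sum_comm]

lemma bernExp_mono (h0 : 0 ≤ p) (h1 : p ≤ 1) {F G : (ι → Bool) → ℝ} (h : ∀ H, F H ≤ G H) :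
    bernExp p F ≤ bernExp p G :=
  Finset.sum_le_sum fun H _ => mul_le_mul_of_nonneg_left (h H)
    (Finset.prod_nonneg fun _ _ => bernWeight_nonneg h0 h1 _)

lemma bernExp_nonneg (h0 : 0 ≤ p) (h1 : p ≤ 1) {F : (ι → Bool) → ℝ} (h : ∀ H, 0 ≤ F H) :
    0 ≤ bernExp p F :=
  Finset.sum_nonneg fun H _ => mul_nonneg (Finset.prod_nonneg fun _ _ =>
    bernWeight_nonneg h0 h1 _) (h H)

lemma bernExp_columns {k m : ℕ} (G : Fin m → (Fin k → Bool) → ℝ) :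
    bernExp p (fun H : Fin k × Fin m → Bool => ∏ v, G v (fun u => H (u, v)))
      = ∏ v, bernExp p (G v) := by
  let e : (Fin m → Fin k → Bool) ≃ (Fin k × Fin m → Bool) :=
    { toFun := fun ω x => ω x.2 x.1
      invFun := fun H v u => H (u, v)
      left_inv := fun _ => rfl
      right_inv := fun _ => rfl }
  unfold bernExp
  rw [← Equiv.sum_comp e]
  have := Finset.prod_univ_sum (fun _ : Fin m => (Finset.univ : Finset (Fin k → Bool)))
    (fun v c => (∏ u, bernWeight p (c u)) * G v c)
  rw [Fintype.piFinset_univ] at this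
  rw [this]
  refine Finset.sum_congr rfl fun ω _ => ?_
  rw [Finset.prod_mul_distrib, Fintype.prod_prod_type_right]
  rfl

end BernExp

lemma Real.exp_le_add_exp_sq (x : ℝ) : Real.exp x ≤ x + Real.exp (x ^ 2) := by
  have h1 := Real.add_one_le_exp (x ^ 2)
  rcases le_or_gt |x| 1 with h | h
  · have := (abs_le.mp (Real.abs_exp_sub_one_sub_id_le h)).2
    linarith
  · rcases le_or_gt 0 x with h0 | h0
    · rw [abs_of_nonneg h0] at h
      have : Real.exp x ≤ Real.exp (x ^ 2) := Real.exp_le_exp.mpr (by nlinarith)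
      linarith
    · rw [abs_of_neg h0] at h
      have : Real.exp x ≤ 1 := Real.exp_le_one_iff.mpr h0.le
      nlinarith

lemma bernExp_exp_le {ι : Type} [Fintype ι] [DecidableEq ι] {p : ℝ} (h0 : 0 ≤ p) (h1 : p ≤ 1)
    {Z : (ι → Bool) → ℝ} {c ν l : ℝ} (hl : 0 ≤ l) (hν : 0 ≤ ν) (hZ : ∀ H, |Z H| ≤ c)
    (hE : bernExp p Z ≤ ν) :
    bernExp p (fun H => Real.exp (l * Z H)) ≤ Real.exp (l ^ 2 * c ^ 2 + l * ν) := by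
  calc bernExp p (fun H => Real.exp (l * Z H))
      ≤ bernExp p (fun H => l * Z H + Real.exp (l ^ 2 * c ^ 2)) := by
        refine bernExp_mono h0 h1 fun H => (Real.exp_le_add_exp_sq _).trans ?_
        gcongr
        rw [mul_pow, ← sq_abs (Z H)]
        gcongr
        exact hZ H
    _ = l * bernExp p Z + Real.exp (l ^ 2 * c ^ 2) := by
        rw [bernExp_add, bernExp_const_mul, bernExp_const]
    _ ≤ l * ν + Real.exp (l ^ 2 * c ^ 2) := by gcongr
    _ ≤ Real.exp (l ^ 2 * c ^ 2) * (l * ν + 1) := by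
        have : 1 ≤ Real.exp (l ^ 2 * c ^ 2) := Real.one_le_exp (by positivity)
        have h2 : 0 ≤ l * ν := by positivity
        nlinarith
    _ ≤ Real.exp (l ^ 2 * c ^ 2) * Real.exp (l * ν) := by gcongr; exact Real.add_one_le_exp _
    _ = _ := (Real.exp_add _ _).symm

lemma randomBip_real_singleton {k m : ℕ} (p : unitInterval) (H : BipGraph k m) :
    (randomBip k m p).real {H} = ∏ e, bernWeight p (H e) := by
  rw [randomBip, Measure.real, Measure.pi_singleton, ENNReal.toReal_prod]
  refine Finset.prod_congr rfl fun e _ => ?_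
  have := bernoulliMeasure_real_apply (x := true) (y := false) p (s := {H e}) (by simp)
  rw [Measure.real] at this
  rw [this]
  cases H e <;> simp [bernWeight]

/-- Markov's inequality for the random bipartite graph. -/
lemma one_sub_le_randomBip {k m : ℕ} (p : unitInterval) {G : Set (BipGraph k m)}
    (F : BipGraph k m → ℝ) (h0 : ∀ H, 0 ≤ F H) (h1 : ∀ H, H ∉ G → 1 ≤ F H) :
    1 - bernExp (p : ℝ) F ≤ (randomBip k m p).real G := by
  classical
  have hfin : IsFiniteMeasure (randomBip k m p) := by unfold randomBip; infer_instance
  have e1 : (randomBip k m p).real G = ∑ H ∈ Finset.univ.filter (· ∈ G), ∏ e, bernWeight p (H e) := by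
    have : (randomBip k m p).real ((Finset.univ.filter (· ∈ G) : Finset (BipGraph k m)) : Set (BipGraph k m))
        = ∑ H ∈ Finset.univ.filter (· ∈ G), (randomBip k m p).real {H} :=
      (sum_measureReal_singleton _).symm
    simp only [randomBip_real_singleton] at this
    rw [← this]
    congr 1
    ext; simp
  have e2 : (1 : ℝ) = ∑ H : BipGraph k m, ∏ e, bernWeight p (H e) := by
    have := bernExp_const (ι := Fin k × Fin m) (p := (p : ℝ)) 1
    simpa [bernExp] using this.symm
  rw [e1, bernExp]
  nth_rewrite 1 [e2]
  rw [← Finset.sum_sub_distrib, Finset.sum_filter]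
  refine Finset.sum_le_sum fun H _ => ?_
  have hw : 0 ≤ ∏ e, bernWeight p (H e) :=
    Finset.prod_nonneg fun e _ => bernWeight_nonneg p.2.1 p.2.2 _
  split_ifs with h
  · have := mul_nonneg hw (h0 H)
    linarith
  · have := mul_le_mul_of_nonneg_left (h1 H h) hw
    linarith

section TupleSum
variable {k m n s w : ℕ} {p : ℝ}

lemma abs_signed_le (b : Bool) : |signed w s b| ≤ (max w s : ℕ) := by
  cases b <;> simp [signed]

lemma abs_signed_le_real (b : Bool) : |(signed w s b : ℝ)| ≤ (max w s : ℕ) := by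
  exact_mod_cast abs_signed_le b

/-- The expectation of the product of signed weights along a tuple with an unrepeated value. -/
lemma bernExp_signed_tuple (h0 : 0 ≤ p) (h1 : p ≤ 1) (hws : w + s = n) (hs : (s : ℝ) ≤ p * n)
    (hs' : p * n < s + 1) {j : ℕ} (t : Fin j → Fin k) (ht : ¬ AllRepeated t) :
    bernExp p (fun c : Fin k → Bool => ∏ i, (signed w s (c (t i)) : ℝ))
      ≤ ((max w s : ℕ) : ℝ) ^ (j - 1) := by
  classical
  set μ : ℝ := ((max w s : ℕ) : ℝ) with hμ
  obtain ⟨i₀, hi₀⟩ : ∃ i, ∀ i', i' ≠ i → t i' ≠ t i := by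
    simpa [AllRepeated] using ht
  have e : (fun c : Fin k → Bool => ∏ i, (signed w s (c (t i)) : ℝ))
      = fun c => ∏ u, (signed w s (c u) : ℝ) ^ (Finset.univ.filter fun i => t i = u).card := by
    funext c
    rw [← Finset.prod_fiberwise Finset.univ t]
    refine Finset.prod_congr rfl fun u _ => ?_
    rw [← Finset.prod_const]
    exact Finset.prod_congr rfl fun i hi => by rw [(Finset.mem_filter.mp hi).2]
  rw [e, bernExp_prod (fun u b => (signed w s b : ℝ) ^ (Finset.univ.filter fun i => t i = u).card)]
  refine (le_abs_self _).trans ?_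
  rw [Finset.abs_prod]
  have hone : (Finset.univ.filter fun i => t i = t i₀).card = 1 := by
    rw [Finset.card_eq_one]
    refine ⟨i₀, ?_⟩
    ext i
    simp only [Finset.mem_filter, Finset.mem_univ, true_and, Finset.mem_singleton]
    exact ⟨fun h => by_contra fun hne => hi₀ i hne h, fun h => by rw [h]⟩
  have hw : (w : ℝ) = n - s := by
    have : (w : ℝ) + s = n := by exact_mod_cast hws
    linarith
  rw [← Finset.mul_prod_erase _ _ (Finset.mem_univ (t i₀))]
  have hb1 : |p * (signed w s true : ℝ) ^ (Finset.univ.filter fun i => t i = t i₀).card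
      + (1 - p) * (signed w s false : ℝ) ^ (Finset.univ.filter fun i => t i = t i₀).card| ≤ 1 := by
    rw [hone]
    simp only [signed, if_true, Bool.false_eq_true, if_false, pow_one, Int.cast_natCast, Int.cast_neg]
    rw [hw, abs_le]
    constructor <;> nlinarith
  have hb2 : ∀ u, |p * (signed w s true : ℝ) ^ (Finset.univ.filter fun i => t i = u).card
      + (1 - p) * (signed w s false : ℝ) ^ (Finset.univ.filter fun i => t i = u).card|
      ≤ μ ^ (Finset.univ.filter fun i => t i = u).card := by
    intro u
    set q := (Finset.univ.filter fun i => t i = u).card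
    have hq : ∀ b, |(signed w s b : ℝ) ^ q| ≤ μ ^ q := fun b => by
      rw [abs_pow]; exact pow_le_pow_left₀ (abs_nonneg _) (abs_signed_le_real b) _
    have := abs_le.mp (hq true)
    have := abs_le.mp (hq false)
    rw [abs_le]
    constructor <;> nlinarith
  calc _ ≤ 1 * ∏ u ∈ Finset.univ.erase (t i₀), μ ^ (Finset.univ.filter fun i => t i = u).card := by
        gcongr with u _
        exact hb2 u
    _ = μ ^ (j - 1) := by
        rw [one_mul, Finset.prod_pow_eq_pow_sum]
        congr 1
        have h2 : ∑ u, (Finset.univ.filter fun i => t i = u).card = j := by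
          rw [Finset.sum_card_fiberwise_eq_card_filter]
          simp
        rw [← Finset.add_sum_erase _ _ (Finset.mem_univ (t i₀)), hone] at h2
        omega

/-- The exponential moment of the signed sum along a tuple with an unrepeated value. -/
lemma bernExp_exp_tupleSum (h0 : 0 ≤ p) (h1 : p ≤ 1) (hn : 1 ≤ n) (hm : m ≤ n) (hws : w + s = n)
    (hs : (s : ℝ) ≤ p * n) (hs' : p * n < s + 1) {j : ℕ} (hj : 1 ≤ j) (t : Fin j → Fin k)
    (ht : ¬ AllRepeated t) {x : ℝ} (hx : 0 ≤ x) (T : ℝ) :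
    bernExp p (fun H : BipGraph k m =>
        Real.exp (x * ((tupleSum H w s t : ℝ) / ((max w s : ℕ) : ℝ) ^ j - T)))
      ≤ Real.exp (n * x ^ 2 + 2 * x - x * T) := by
  set μ : ℝ := ((max w s : ℕ) : ℝ) with hμ
  have hμn : (n : ℝ) ≤ 2 * μ := by
    rw [hμ]; exact_mod_cast (by have := le_max_left w s; have := le_max_right w s; omega)
  have hn' : (1 : ℝ) ≤ n := by exact_mod_cast hn
  have hμ0 : 0 < μ := by linarith
  have hZ : ∀ c : Fin k → Bool, |∏ i, (signed w s (c (t i)) : ℝ)| ≤ μ ^ j := by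
    intro c
    rw [Finset.abs_prod]
    calc ∏ i, |(signed w s (c (t i)) : ℝ)| ≤ ∏ i : Fin j, μ :=
          Finset.prod_le_prod (fun _ _ => abs_nonneg _) fun i _ => abs_signed_le_real _
      _ = _ := by simp
  have hcol := bernExp_exp_le h0 h1 (l := x / μ ^ j) (by positivity) (by positivity) hZ
    (bernExp_signed_tuple h0 h1 hws hs hs' t ht)
  have hbound : (x / μ ^ j) ^ 2 * (μ ^ j) ^ 2 + x / μ ^ j * μ ^ (j - 1) ≤ x ^ 2 + 2 * x / n := by
    have e1 : (x / μ ^ j) ^ 2 * (μ ^ j) ^ 2 = x ^ 2 := by field_simp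
    have e2 : x / μ ^ j * μ ^ (j - 1) = x / μ := by
      obtain ⟨i, rfl⟩ : ∃ i, j = i + 1 := ⟨j - 1, by omega⟩
      rw [Nat.add_sub_cancel, pow_succ]; field_simp
    rw [e1, e2]
    have : x / μ ≤ 2 * x / n := by
      rw [div_le_div_iff₀ hμ0 (by linarith)]; nlinarith
    linarith
  have e : (fun H : BipGraph k m => Real.exp (x * ((tupleSum H w s t : ℝ) / μ ^ j - T)))
      = fun H => Real.exp (-(x * T)) * ∏ v, (fun c : Fin k → Bool =>
        Real.exp (x / μ ^ j * ∏ i, (signed w s (c (t i)) : ℝ))) (fun u => H (u, v)) := by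
    funext H
    rw [← Real.exp_sum, ← Real.exp_add, ← Finset.mul_sum]
    congr 1
    rw [tupleSum]; push_cast; ring
  rw [e, bernExp_const_mul, bernExp_columns (fun _ c =>
    Real.exp (x / μ ^ j * ∏ i, (signed w s (c (t i)) : ℝ)))]
  rw [Finset.prod_const, Finset.card_univ, Fintype.card_fin]
  calc Real.exp (-(x * T)) * _ ^ m
      ≤ Real.exp (-(x * T)) * Real.exp (x ^ 2 + 2 * x / n) ^ m := by
        gcongr
        · exact bernExp_nonneg h0 h1 fun _ => (Real.exp_pos _).le
        · exact hcol.trans (Real.exp_le_exp.mpr hbound)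
    _ = Real.exp (m * (x ^ 2 + 2 * x / n) - x * T) := by
        rw [← Real.exp_nat_mul, ← Real.exp_add]; congr 1; ring
    _ ≤ _ := by
        refine Real.exp_le_exp.mpr ?_
        have hm' : (m : ℝ) ≤ n := by exact_mod_cast hm
        have : (m : ℝ) * (x ^ 2 + 2 * x / n) ≤ n * (x ^ 2 + 2 * x / n) := by gcongr
        have e3 : (n : ℝ) * (x ^ 2 + 2 * x / n) = n * x ^ 2 + 2 * x := by field_simp
        linarith

lemma bernExp_exp_tupleSum_le (h0 : 0 ≤ p) (h1 : p ≤ 1) (hn : 3 ≤ n) (hm : m ≤ n)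
    (hws : w + s = n) (hs : (s : ℝ) ≤ p * n) (hs' : p * n < s + 1) {r : ℕ} (hr : 1 ≤ r)
    (t : Fin (2 * r) → Fin k) (ht : ¬ AllRepeated t) :
    bernExp p (fun H : BipGraph k m =>
        Real.exp (3 * Real.sqrt (r * n * Real.log n) / n *
          ((tupleSum H w s t : ℝ) / ((max w s : ℕ) : ℝ) ^ (2 * r)
            - 8 * Real.sqrt (r * n * Real.log n))))
      ≤ ((n : ℝ) ^ (9 * r))⁻¹ := by
  have hn' : (3 : ℝ) ≤ n := by exact_mod_cast hn
  have hr' : (1 : ℝ) ≤ r := by exact_mod_cast hr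
  have hlog : 1 ≤ Real.log n := by
    rw [Real.le_log_iff_exp_le (by linarith)]
    exact (Real.exp_one_lt_three.le).trans hn'
  set S := Real.sqrt (r * n * Real.log n) with hS
  have hS2 : S ^ 2 = r * n * Real.log n := Real.sq_sqrt (by positivity)
  have hS0 : 0 ≤ S := Real.sqrt_nonneg _
  refine (bernExp_exp_tupleSum h0 h1 (by omega) hm hws hs hs' (by omega) t ht (by positivity) _).trans ?_
  have e : ((n : ℝ) ^ (9 * r))⁻¹ = Real.exp (-(9 * (r * Real.log n))) := by
    rw [Real.exp_neg, show 9 * ((r : ℝ) * Real.log n) = ((9 * r : ℕ) : ℝ) * Real.log n by push_cast; ring,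
      Real.exp_nat_mul, Real.exp_log (by linarith)]
  rw [e]
  refine Real.exp_le_exp.mpr ?_
  have e1 : (n : ℝ) * (3 * S / n) ^ 2 = 9 * (r * Real.log n) := by
    rw [div_pow, mul_pow, hS2]; field_simp; ring
  have e2 : 3 * S / n * (8 * S) = 24 * (r * Real.log n) := by
    rw [show 3 * S / n * (8 * S) = 24 * S ^ 2 / n by ring, hS2]; field_simp
  have e3 : S / n ≤ r * Real.log n := by
    rw [div_le_iff₀ (by linarith)]
    refine abs_le_of_sq_le_sq' ?_ (by positivity) |>.2
    rw [hS2]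
    have h4 : 1 ≤ (r : ℝ) * Real.log n := by nlinarith
    nlinarith [mul_le_mul h4 (show (1:ℝ) ≤ n by linarith) (by norm_num) (by positivity),
      mul_pos (by linarith : (0:ℝ) < n) (by linarith : (0:ℝ) < r * Real.log n)]
  have e4 : 2 * (3 * S / n) = 6 * (S / n) := by ring
  rw [e1, e2, e4]
  nlinarith

/-- The exponential moment of the deviation of the degree of a right vertex. -/
lemma bernExp_exp_degree (h0 : 0 ≤ p) (h1 : p ≤ 1) (v : Fin m) :
    bernExp p (fun H : BipGraph k m => Real.exp ((1 - p) / 4 *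
        ((Finset.univ.filter fun u => H (u, v) = true).card - (k - k * (1 - p) / 2))))
      ≤ Real.exp (-(k * (1 - p) ^ 2 / 16)) := by
  set q := 1 - p with hq
  have hq0 : 0 ≤ q := by linarith
  set g : Bool → ℝ := fun b => if b then q else q - 1 with hg
  have e : (fun H : BipGraph k m => Real.exp (q / 4 *
        ((Finset.univ.filter fun u => H (u, v) = true).card - (k - k * q / 2))))
      = fun H => Real.exp (-(k * q ^ 2 / 8)) * ∏ v', (fun c : Fin k → Bool =>
        if v' = v then ∏ u, Real.exp (q / 4 * g (c u)) else 1) (fun u => H (u, v')) := by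
    funext H
    rw [Finset.prod_ite_eq' Finset.univ v]
    simp only [Finset.mem_univ, if_true]
    rw [← Real.exp_sum, ← Real.exp_add, ← Finset.mul_sum]
    congr 1
    have : ∀ b : Bool, g b = (if b = true then 1 else 0) + (q - 1) := by
      intro b; cases b <;> simp [hg]
    simp only [this, Finset.sum_add_distrib, Finset.sum_boole, Finset.sum_const, Finset.card_univ,
      Fintype.card_fin, nsmul_eq_mul]
    ring
  rw [e, bernExp_const_mul, bernExp_columns (fun v' c =>
    if v' = v then ∏ u, Real.exp (q / 4 * g (c u)) else 1)]
  have e2 : ∏ v', bernExp p (fun c : Fin k → Bool => if v' = v then ∏ u, Real.exp (q / 4 * g (c u)) else 1)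
      = bernExp p (fun c : Fin k → Bool => ∏ u, Real.exp (q / 4 * g (c u))) := by
    rw [Finset.prod_eq_single v]
    · simp
    · intro v' _ hne
      simp [hne, bernExp_const]
    · simp
  rw [e2, bernExp_prod (fun _ b => Real.exp (q / 4 * g b)), Finset.prod_const, Finset.card_univ,
    Fintype.card_fin]
  have e3 : p * Real.exp (q / 4 * g true) + (1 - p) * Real.exp (q / 4 * g false)
      ≤ Real.exp (q ^ 2 / 16) := by
    have hb : ∀ b, Real.exp (q / 4 * g b) ≤ q / 4 * g b + Real.exp (q ^ 2 / 16) := by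
      intro b
      refine (Real.exp_le_add_exp_sq _).trans ?_
      gcongr
      have : g b ^ 2 ≤ 1 := by
        cases b <;> simp only [hg, if_true, Bool.false_eq_true, if_false] <;> nlinarith
      nlinarith [sq_nonneg q]
    have t1 := mul_le_mul_of_nonneg_left (hb true) h0
    have t2 := mul_le_mul_of_nonneg_left (hb false) (by linarith : 0 ≤ 1 - p)
    simp only [hg, if_true, Bool.false_eq_true, if_false] at t1 t2 ⊢
    nlinarith
  calc Real.exp (-(k * q ^ 2 / 8)) * _ ^ k
      ≤ Real.exp (-(k * q ^ 2 / 8)) * Real.exp (q ^ 2 / 16) ^ k := by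
        gcongr
    _ = _ := by
        rw [← Real.exp_nat_mul, ← Real.exp_add]; congr 1; ring

end TupleSum

lemma certificate_bits_le {n k m a c W L e : ℕ} (hn : 20 ≤ n) (hk : k ≤ n) (hm : m ≤ n)
    (hL : L ≤ n ^ e) (hW : W ≤ n ^ e) (hc : c ≤ n ^ e) (ha : k ^ a * m ≤ n ^ e) :
    2 * (k + m + 1 + k * m) * (3 * (2 * k + m + 2)) + 3 * (c + k ^ a * m)
      + (1 + 2 * (k + m + 1 + k * m)) * (L * (2 + W.size)) ≤ n ^ (2 * e + 10) := by
  have h1 : 1 ≤ n ^ e := Nat.one_le_pow _ _ (by omega)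
  have hs : W.size ≤ n ^ e := (Nat.size_le.mpr Nat.lt_two_pow_self).trans hW
  have hkm : k * m ≤ n * n := by gcongr
  have h2 : 2 * (k + m + 1 + k * m) ≤ n ^ 3 := by nlinarith
  have h3 : 3 * (2 * k + m + 2) ≤ n ^ 2 := by nlinarith
  have h4 : 1 + 2 * (k + m + 1 + k * m) ≤ n ^ 3 := by nlinarith
  calc 2 * (k + m + 1 + k * m) * (3 * (2 * k + m + 2)) + 3 * (c + k ^ a * m)
      + (1 + 2 * (k + m + 1 + k * m)) * (L * (2 + W.size))
      ≤ n ^ 3 * n ^ 2 + 3 * (n ^ e + n ^ e) + n ^ 3 * (n ^ e * (2 * n ^ e + n ^ e)) := by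
        gcongr; omega
    _ ≤ n ^ 3 * n ^ 2 * (n ^ e * n ^ e) + 6 * (n ^ e * n ^ e) + n ^ 3 * (n ^ e * (2 * n ^ e + n ^ e)) := by
        have : n ^ e ≤ n ^ e * n ^ e := Nat.le_mul_of_pos_left _ h1
        have h5 : n ^ 3 * n ^ 2 ≤ n ^ 3 * n ^ 2 * (n ^ e * n ^ e) :=
          Nat.le_mul_of_pos_right _ (by positivity)
        omega
    _ = (n ^ 5 + 6 + 3 * n ^ 3) * (n ^ e * n ^ e) := by ring
    _ ≤ n ^ 10 * (n ^ e * n ^ e) := by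
        gcongr
        have e5 : 20 ≤ n ^ 5 := hn.trans (Nat.le_self_pow (by norm_num) n)
        have e3 : n ^ 3 ≤ n ^ 5 := Nat.pow_le_pow_right (by omega) (by norm_num)
        have : n ^ 10 = n ^ 5 * n ^ 5 := by ring
        nlinarith
    _ = n ^ (2 * e + 10) := by ring

/-- If there are no right vertices, every nonnegative bound is certified. -/
lemma bicliqueCertificate_of_isEmpty {k m : ℕ} (hm : m = 0) (hk : k = 1) (H : BipGraph k m)
    {d a B : ℕ} {b : ℝ} (hb : 0 ≤ b) (hB : 48 ≤ B) : BicliqueCertificate H d a b B := by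
  subst hm hk
  refine IntCert.bicliqueCertificate (W := 1) (c := 0) (L := 0) Nat.one_pos (by simpa using hb) ?_ ?_
  · have : sizeY ℤ 1 0 = 0 := by simp [sizeY]
    rw [this]
    simpa using IntCert.zero
  · simpa using hB

section PartTwo
variable {k n : ℕ} {p : ℝ}

/-- The bound of the second part after rewriting it in terms of `θ = max (p/q) (q/p) * p/q`. -/
lemma theta_pow_div {ρ q : ℝ} (x : ℝ) (r : ℕ) :
    ρ ^ r * x ^ r / q ^ (r + 1) = (ρ * x / q) ^ r / q := by
  rw [div_pow, mul_pow, pow_succ, div_div]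

lemma max_le_mul_theta {s w : ℕ} {q : ℝ} (hp : 0 < p) (hq : 0 < q) (hs : (s : ℝ) ≤ p * n)
    (hw : q * n ≤ w) (r : ℕ) :
    (((max w s : ℕ) : ℝ)) ^ (2 * r) ≤ (w : ℝ) ^ (2 * r) * (max (p / q) (q / p) * p / q) ^ r := by
  rw [pow_mul, pow_mul, ← mul_pow]
  refine pow_le_pow_left₀ (by positivity) ?_ r
  have h1 : (1 : ℝ) ≤ max (p / q) (q / p) * p / q := by
    have : q / p * p / q = 1 := by field_simp
    rw [← this]
    gcongr
    exact le_max_right _ _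
  have h2 : (p / q) ^ 2 ≤ max (p / q) (q / p) * p / q := by
    rw [pow_two, mul_div_assoc]
    gcongr
    exact le_max_left _ _
  have h3 : (s : ℝ) ≤ w * (p / q) := by
    rw [← mul_div_assoc, le_div_iff₀ hq]
    nlinarith
  rcases le_total w s with h | h
  · rw [max_eq_right h]
    calc (s : ℝ) ^ 2 ≤ (w * (p / q)) ^ 2 := by gcongr
      _ = (w : ℝ) ^ 2 * (p / q) ^ 2 := by ring
      _ ≤ _ := by gcongr
  · rw [max_eq_left h]
    exact le_mul_of_one_le_right (by positivity) h1

set_option maxHeartbeats 1000000 in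
/-- The certificate of the second part, for graphs with small signed sums and degrees. -/
lemma bicliqueCertificate_of_tupleSum {r s w : ℕ} (hn : 1000 ≤ n) (hkn : k ≤ n) (hp : 0 < p)
    (hp1 : p < 1) (hws : w + s = n) (hs : (s : ℝ) ≤ p * n) (hr : 1 ≤ r) {H : BipGraph k (n - k)}
    (hcond : 64 * (Real.sqrt (r * n * Real.log n) *
      (max (p / (1 - p)) ((1 - p) / p) ^ r * p ^ r / (1 - p) ^ (r + 1))) ≤ (k : ℝ))
    (hΔ : ∀ t : Fin (2 * r) → Fin k, ¬ AllRepeated t → (tupleSum H w s t : ℝ)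
      ≤ ((max w s : ℕ) : ℝ) ^ (2 * r) * (8 * Real.sqrt (r * n * Real.log n)))
    (hdeg : ∀ v, ((Finset.univ.filter fun u => H (u, v) = true).card : ℝ) ≤ k - k * (1 - p) / 2) :
    BicliqueCertificate H (6 * r + 2) (4 * r)
      ((1000 * (r : ℝ)) ^ (10 * r) * n *
        (n * max (p / (1 - p)) ((1 - p) / p) ^ r * p ^ r / (k * (1 - p) ^ (r + 1))) ^ 4)
      (200 * n ^ (200 * r)) := by
  set q := 1 - p with hq
  have hq0 : 0 < q := by linarith
  have hq1 : q < 1 := by linarith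
  set θ := max (p / q) (q / p) * p / q with hθ
  set S := Real.sqrt (r * n * Real.log n) with hS
  have hn' : (1000 : ℝ) ≤ n := by exact_mod_cast hn
  have hr' : (1 : ℝ) ≤ r := by exact_mod_cast hr
  have hkn' : (k : ℝ) ≤ n := by exact_mod_cast hkn
  have hlog : 1 ≤ Real.log n := by
    rw [Real.le_log_iff_exp_le (by linarith)]
    exact (Real.exp_one_lt_three.le).trans (by linarith)
  have hS2 : S ^ 2 = r * n * Real.log n := Real.sq_sqrt (by positivity)
  have hS0 : 0 ≤ S := Real.sqrt_nonneg _
  have hSr : (r : ℝ) * n ≤ S ^ 2 := by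
    rw [hS2]; exact le_mul_of_one_le_right (by positivity) hlog
  have hS1 : 1 ≤ S := by
    refine (one_le_sq_iff₀ hS0).mp (le_trans ?_ hSr)
    exact one_le_mul_of_one_le_of_one_le hr' (by linarith)
  have h1θ : (1 : ℝ) ≤ θ := by
    have : q / p * p / q = 1 := by field_simp
    calc (1 : ℝ) = q / p * p / q := this.symm
      _ ≤ θ := by
        rw [hθ]
        gcongr
        exact le_max_right _ _
  rw [theta_pow_div, ← hθ] at hcond
  set Y := θ ^ r with hY
  have hY1 : 1 ≤ Y := one_le_pow₀ h1θ
  have hcond' : 64 * (S * Y) ≤ k * q := by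
    have : 64 * (S * (Y / q)) = 64 * (S * Y) / q := by ring
    rw [this, div_le_iff₀ hq0] at hcond
    exact hcond
  have hSY : 1 ≤ S * Y := one_le_mul_of_one_le_of_one_le hS1 hY1
  have hkq : 0 < (k : ℝ) * q := by linarith
  have hkqn : (k : ℝ) * q ≤ n := (mul_le_of_le_one_right (Nat.cast_nonneg k) hq1.le).trans hkn'
  have hk0 : (0 : ℝ) < k := by
    by_contra h
    have : (k : ℝ) = 0 := le_antisymm (not_lt.mp h) (Nat.cast_nonneg k)
    rw [this] at hkq; simp at hkq
  have hrn : r ≤ n := by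
    have h1 : S ≤ n := by
      have := le_mul_of_one_le_right hS0 hY1
      linarith
    have h2 : (r : ℝ) * n ≤ n * n := hSr.trans (by rw [pow_two]; gcongr)
    exact_mod_cast le_of_mul_le_mul_right h2 (by linarith)
  set b : ℝ := (1000 * (r : ℝ)) ^ (10 * r) * n *
        (n * max (p / q) (q / p) ^ r * p ^ r / (k * q ^ (r + 1))) ^ 4 with hb
  have hb' : b = (1000 * (r : ℝ)) ^ (10 * r) * n * (n * Y / (k * q)) ^ 4 := by
    rw [hb, hY, hθ]
    congr 2
    rw [div_pow, mul_pow, pow_succ]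
    field_simp
  have hnY : 1 ≤ n * Y / (k * q) := by
    rw [one_le_div hkq]
    exact hkqn.trans (le_mul_of_one_le_right (by linarith) hY1)
  have hnY2 : n * Y / (k * q) ≤ n := by
    rw [div_le_iff₀ hkq]
    have h1 := le_mul_of_one_le_left (zero_le_one.trans hY1) hS1
    gcongr
    linarith
  have hbig : (1000 : ℝ) ≤ (1000 * (r : ℝ)) ^ (10 * r) := by
    calc (1000 : ℝ) ≤ 1000 * r := by linarith
      _ = (1000 * r) ^ 1 := (pow_one _).symm
      _ ≤ _ := pow_le_pow_right₀ (by linarith) (by omega)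
  have hb2 : 2 ≤ b := by
    rw [hb']
    have h1 : (1 : ℝ) ≤ (n * Y / (k * q)) ^ 4 := one_le_pow₀ hnY
    have h2 : (2 : ℝ) ≤ (1000 * (r : ℝ)) ^ (10 * r) * n :=
      (by norm_num : (2 : ℝ) ≤ 1000 * 1000).trans (mul_le_mul hbig hn' (by norm_num) (by linarith))
    calc (2 : ℝ) = 2 * 1 := by norm_num
      _ ≤ _ := mul_le_mul h2 h1 (by norm_num) (by linarith)
  have hbn : b ≤ (n : ℝ) ^ (40 * r) := by
    have h1 : 1000 * (r : ℝ) ≤ n ^ 2 := by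
      have : (r : ℝ) ≤ n := by exact_mod_cast hrn
      rw [pow_two]
      exact mul_le_mul hn' this (by linarith) (by linarith)
    calc b ≤ ((n : ℝ) ^ 2) ^ (10 * r) * n * n ^ 4 := by
          rw [hb']; gcongr
      _ = (n : ℝ) ^ (20 * r + 5) := by ring
      _ ≤ _ := pow_le_pow_right₀ (by linarith) (by omega)
  set μ := max w s with hμ
  set Δ := ⌊(μ : ℝ) ^ (2 * r) * (8 * S)⌋₊ with hΔd
  set δ := ⌈(k : ℝ) * q / 2⌉₊ with hδd
  have hwq : q * n ≤ w := by
    have : (w : ℝ) + s = n := by exact_mod_cast hws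
    rw [hq]; linarith
  have hμw : (μ : ℝ) ^ (2 * r) ≤ (w : ℝ) ^ (2 * r) * Y := max_le_mul_theta hp hq0 hs hwq r
  have hw0 : 0 < (w : ℝ) := lt_of_lt_of_le (by positivity) hwq
  have hΔ1 : (Δ : ℝ) ≤ (w : ℝ) ^ (2 * r) * (k * q / 4) := by
    calc (Δ : ℝ) ≤ (μ : ℝ) ^ (2 * r) * (8 * S) := Nat.floor_le (by positivity)
      _ ≤ (w : ℝ) ^ (2 * r) * Y * (8 * S) := by gcongr
      _ = (w : ℝ) ^ (2 * r) * (8 * (S * Y)) := by ring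
      _ ≤ _ := by gcongr; linarith
  have hδ1 : (k : ℝ) * q / 2 ≤ δ := Nat.le_ceil _
  have hδΔ : Δ ≤ w ^ (2 * r) * δ := by
    have : (Δ : ℝ) ≤ (w : ℝ) ^ (2 * r) * δ := hΔ1.trans (by gcongr; linarith)
    exact_mod_cast this
  set M := w ^ (2 * r) * δ - Δ with hM
  have hMΔ : M + Δ = w ^ (2 * r) * δ := by omega
  have hM1 : (w : ℝ) ^ (2 * r) * (k * q / 4) ≤ M := by
    have h1 : (M : ℝ) + Δ = (w : ℝ) ^ (2 * r) * δ := by exact_mod_cast hMΔ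
    have h2 : (w : ℝ) ^ (2 * r) * (k * q / 2) ≤ (w : ℝ) ^ (2 * r) * δ := by gcongr
    have h3 : (w : ℝ) ^ (2 * r) * (k * q / 2) = (w : ℝ) ^ (2 * r) * (k * q / 4) + (w : ℝ) ^ (2 * r) * (k * q / 4) := by ring
    linarith
  have hM0 : 0 < M := by
    have : (0 : ℝ) < M := lt_of_lt_of_le (by positivity) hM1
    exact_mod_cast this
  have hwn : w ≤ n := by omega
  have hδn : δ ≤ n := by
    rw [hδd, Nat.ceil_le]; linarith
  have hΔn : Δ ≤ n ^ (2 * r + 1) := by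
    have : (Δ : ℝ) ≤ (n : ℝ) ^ (2 * r + 1) := by
      refine hΔ1.trans ?_
      rw [pow_succ]
      gcongr
      linarith
    exact_mod_cast this
  have hcb : (⌊b⌋₊ : ℝ) ≤ b := Nat.floor_le (by linarith)
  have hcb2 : b / 2 ≤ (⌊b⌋₊ : ℝ) := by
    have := Nat.lt_floor_add_one b
    linarith
  have hcn : ⌊b⌋₊ ≤ n ^ (40 * r) := by
    have : (⌊b⌋₊ : ℝ) ≤ (n : ℝ) ^ (40 * r) := hcb.trans hbn
    exact_mod_cast this
  have hmn : n - k ≤ n := Nat.sub_le _ _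
  have hmain : (n - k) * ((n - k) * μ ^ (2 * r) * r ^ (2 * r)) ^ 4 ≤ ⌊b⌋₊ * M ^ 4 := by
    have hm' : ((n - k : ℕ) : ℝ) ≤ n := by exact_mod_cast hmn
    have hrr : (r : ℝ) ^ (8 * r) * 512 ≤ (1000 * (r : ℝ)) ^ (10 * r) := by
      rw [mul_pow, mul_comm]
      have h1 : (512 : ℝ) ≤ 1000 ^ (10 * r) := by
        calc (512 : ℝ) ≤ 1000 ^ 1 := by norm_num
          _ ≤ _ := pow_le_pow_right₀ (by norm_num) (by omega)
      have h2 : (r : ℝ) ^ (8 * r) ≤ (r : ℝ) ^ (10 * r) := pow_le_pow_right₀ hr' (by omega)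
      gcongr
    have : (((n - k : ℕ) : ℝ)) * ((n - k : ℕ) * (μ : ℝ) ^ (2 * r) * (r : ℝ) ^ (2 * r)) ^ 4
        ≤ (⌊b⌋₊ : ℝ) * (M : ℝ) ^ 4 := by
      calc (((n - k : ℕ) : ℝ)) * ((n - k : ℕ) * (μ : ℝ) ^ (2 * r) * (r : ℝ) ^ (2 * r)) ^ 4
          ≤ n * (n * ((w : ℝ) ^ (2 * r) * Y) * (r : ℝ) ^ (2 * r)) ^ 4 := by gcongr
        _ = (r : ℝ) ^ (8 * r) * (n * (n * ((w : ℝ) ^ (2 * r) * Y)) ^ 4) := by ring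
        _ ≤ (1000 * (r : ℝ)) ^ (10 * r) / 512 * (n * (n * ((w : ℝ) ^ (2 * r) * Y)) ^ 4) := by
            gcongr
            linarith
        _ = b / 2 * ((w : ℝ) ^ (2 * r) * (k * q / 4)) ^ 4 := by
            rw [hb']; field_simp; ring
        _ ≤ _ := by gcongr
    exact_mod_cast this
  have hcert := intCert_of_tupleSum (H := H) (w := w) (s := s) (n := n) (r := r) (μ := μ) (Δ := Δ)
    (δ := δ) (c := ⌊b⌋₊) (M := M) (by omega) hkn hmn hws.le
    (by omega) hΔn hr hrn (fun b => by exact_mod_cast abs_signed_le b)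
    (fun t ht => by
      have h1 := hΔ t ht
      by_contra hlt
      push Not at hlt
      have h2 : ((Δ : ℤ) : ℝ) + 1 ≤ (tupleSum H w s t : ℝ) := by exact_mod_cast hlt
      have h3 := Nat.lt_floor_add_one ((μ : ℝ) ^ (2 * r) * (8 * S))
      push_cast at h2
      linarith)
    (fun v => by
      have h1 := hdeg v
      have h2 : (Finset.univ.filter fun u => H (u, v) = true).card ≤ k := by
        simpa using Finset.card_le_univ (Finset.univ.filter fun u => H (u, v) = true)
      have h3 : δ ≤ k - (Finset.univ.filter fun u => H (u, v) = true).card := by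
        rw [hδd, Nat.ceil_le, Nat.cast_sub h2]
        linarith
      omega)
    hδn hMΔ hcn hmain
  refine hcert.bicliqueCertificate (by positivity) hcb ?_
  have pw : ∀ {e e' : ℕ}, e ≤ e' → n ^ e ≤ n ^ e' := fun h => Nat.pow_le_pow_right (by omega) h
  refine (certificate_bits_le (e := 60 * r) (by omega) hkn hmn le_rfl ?_ (hcn.trans (pw (by omega)))
    ?_).trans ?_
  · calc 4 * M ^ 4 ≤ n * (n ^ (2 * r) * n) ^ 4 := by
          gcongr
          · omega
          · exact (Nat.sub_le _ _).trans (by gcongr)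
      _ = n ^ (8 * r + 5) := by ring
      _ ≤ _ := pw (by omega)
  · calc k ^ (4 * r) * (n - k) ≤ n ^ (4 * r) * n := by gcongr
      _ = n ^ (4 * r + 1) := by ring
      _ ≤ _ := pw (by omega)
  · exact (pw (by omega)).trans (Nat.le_mul_of_pos_left _ (by norm_num))

end PartTwo

/-- A test function witnessing that the second part holds with high probability. -/
lemma exists_test_partTwo {n k : ℕ} {p : ℝ} (hk : 1 ≤ k) (hkn : k ≤ n) (hp : 0 < p) (hp1 : p < 1) :
    ∃ F : BipGraph k (n - k) → ℝ, (∀ H, 0 ≤ F H) ∧ bernExp p F ≤ 0.005 ∧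
      ∀ H, F H < 1 → ∀ r : ℕ, 1 ≤ r →
        64 * (Real.sqrt (r * n * Real.log n) *
          (max (p / (1 - p)) ((1 - p) / p) ^ r * p ^ r / (1 - p) ^ (r + 1))) ≤ (k : ℝ) →
        BicliqueCertificate H (6 * r + 2) (4 * r)
          ((1000 * (r : ℝ)) ^ (10 * r) * n *
            (n * max (p / (1 - p)) ((1 - p) / p) ^ r * p ^ r / (k * (1 - p) ^ (r + 1))) ^ 4)
          (200 * n ^ (200 * r)) := by
  classical
  set q := 1 - p with hq
  have hq0 : 0 < q := by linarith
  have hq1 : q < 1 := by linarith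
  rcases Nat.lt_or_ge n 2 with hn | hn
  · refine ⟨fun _ => 0, fun _ => le_rfl, by rw [bernExp_const]; norm_num, fun H _ r hr _ => ?_⟩
    have hn1 : n = 1 := by omega
    have hk1 : k = 1 := by omega
    refine bicliqueCertificate_of_isEmpty (by omega) hk1 H (by positivity) ?_
    rw [hn1, one_pow]; norm_num
  by_cases hcond : ∃ r : ℕ, 1 ≤ r ∧ 64 * (Real.sqrt (r * n * Real.log n) *
          (max (p / q) (q / p) ^ r * p ^ r / q ^ (r + 1))) ≤ (k : ℝ)
  swap
  · refine ⟨fun _ => 0, fun _ => le_rfl, by rw [bernExp_const]; norm_num, fun H _ r hr h => ?_⟩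
    exact absurd ⟨r, hr, h⟩ hcond
  have hn2 : (2 : ℝ) ≤ n := by exact_mod_cast hn
  have hkn' : (k : ℝ) ≤ n := by exact_mod_cast hkn
  have hlog0 : 1 / 2 ≤ Real.log n := by
    have h1 := Real.log_le_log (by norm_num) hn2
    have h2 := Real.log_two_gt_d9
    linarith
  have hkq : 4096 * (n * Real.log n) ≤ ((k : ℝ) * q) ^ 2 := by
    obtain ⟨r, hr, h⟩ := hcond
    rw [theta_pow_div] at h
    have h1θ : (1 : ℝ) ≤ max (p / q) (q / p) * p / q := by
      have : q / p * p / q = 1 := by field_simp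
      calc (1 : ℝ) = q / p * p / q := this.symm
        _ ≤ _ := by gcongr; exact le_max_right _ _
    have hY : (1 : ℝ) ≤ (max (p / q) (q / p) * p / q) ^ r := one_le_pow₀ h1θ
    have hr' : (1 : ℝ) ≤ r := by exact_mod_cast hr
    have h2 : 64 * Real.sqrt (n * Real.log n) ≤ k * q := by
      rw [← div_le_iff₀ hq0]
      refine le_trans ?_ h
      rw [mul_div_assoc]
      gcongr 64 * ?_
      rw [← mul_one_div]
      gcongr
      exact le_mul_of_one_le_left (by positivity) hr'
    calc 4096 * (n * Real.log n) = (64 * Real.sqrt (n * Real.log n)) ^ 2 := by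
          rw [mul_pow, Real.sq_sqrt (by positivity)]; norm_num
      _ ≤ _ := by gcongr
  have hkqn : (k : ℝ) * q ≤ n := by nlinarith
  have hkpos : (1 : ℝ) ≤ k := by exact_mod_cast hk
  have hn1000 : 1000 ≤ n := by
    have h1 : ((k : ℝ) * q) ^ 2 ≤ n * n := by
      rw [pow_two]; gcongr
    have h2 : (4096 * Real.log n) * n ≤ n * n := by linarith
    have h3 := le_of_mul_le_mul_right h2 (by linarith)
    have : (1000 : ℝ) ≤ n := by linarith
    exact_mod_cast this
  have hn' : (1000 : ℝ) ≤ n := by exact_mod_cast hn1000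
  have hkq2 : 64 * Real.log n ≤ k * q ^ 2 := by
    have h1 : 4096 * (k * Real.log n) ≤ ((k : ℝ) * q) ^ 2 :=
      le_trans (by gcongr) hkq
    have h2 : (4096 * Real.log n) * k ≤ (k * q ^ 2) * k := by linarith
    have := le_of_mul_le_mul_right h2 (by linarith)
    linarith
  set s := ⌊p * n⌋₊ with hsd
  have hs : (s : ℝ) ≤ p * n := Nat.floor_le (by positivity)
  have hs' : p * n < s + 1 := Nat.lt_floor_add_one _
  have hsn : s ≤ n := by
    have : (s : ℝ) ≤ n := by nlinarith
    exact_mod_cast this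
  set w := n - s with hwd
  have hws : w + s = n := by omega
  set Sq : ℕ → ℝ := fun r => Real.sqrt (r * n * Real.log n) with hSq
  set f1 : (r : ℕ) → (Fin (2 * r) → Fin k) → BipGraph k (n - k) → ℝ := fun r t H =>
    Real.exp (3 * Sq r / n * ((tupleSum H w s t : ℝ) / ((max w s : ℕ) : ℝ) ^ (2 * r) - 8 * Sq r))
    with hf1
  set f2 : Fin (n - k) → BipGraph k (n - k) → ℝ := fun v H => Real.exp (q / 4 *
        ((Finset.univ.filter fun u => H (u, v) = true).card - (k - k * q / 2))) with hf2
  set bad : (r : ℕ) → Finset (Fin (2 * r) → Fin k) := fun r =>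
    Finset.univ.filter fun t => ¬ AllRepeated t with hbad
  refine ⟨fun H => (∑ r ∈ Finset.Icc 1 n, ∑ t ∈ bad r, f1 r t H) + ∑ v, f2 v H,
    fun H => ?_, ?_, fun H hH r hr h => ?_⟩
  · exact add_nonneg (Finset.sum_nonneg fun r _ => Finset.sum_nonneg fun t _ => (Real.exp_pos _).le)
      (Finset.sum_nonneg fun v _ => (Real.exp_pos _).le)
  · rw [bernExp_add, bernExp_sum, bernExp_sum]
    have hn0 : (0 : ℝ) < n := by linarith
    have t1 : ∀ r ∈ Finset.Icc 1 n, bernExp p (fun H => ∑ t ∈ bad r, f1 r t H) ≤ ((n : ℝ) ^ 7)⁻¹ := by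
      intro r hr
      have hr1 := (Finset.mem_Icc.mp hr).1
      rw [bernExp_sum]
      calc ∑ t ∈ bad r, bernExp p (f1 r t) ≤ ∑ t ∈ bad r, ((n : ℝ) ^ (9 * r))⁻¹ :=
            Finset.sum_le_sum fun t ht => bernExp_exp_tupleSum_le hp.le hp1.le (by omega)
              (Nat.sub_le _ _) hws hs hs' hr1 t (Finset.mem_filter.mp ht).2
        _ = (bad r).card * ((n : ℝ) ^ (9 * r))⁻¹ := by simp
        _ ≤ (n : ℝ) ^ (2 * r) * ((n : ℝ) ^ (9 * r))⁻¹ := by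
            gcongr
            have h1 : (bad r).card ≤ k ^ (2 * r) := by
              simpa using Finset.card_le_univ (bad r)
            have h2 : k ^ (2 * r) ≤ n ^ (2 * r) := by gcongr
            exact_mod_cast h1.trans h2
        _ = ((n : ℝ) ^ (7 * r))⁻¹ := by
            rw [show 9 * r = 2 * r + 7 * r by ring, pow_add, mul_inv, ← mul_assoc,
              mul_inv_cancel₀ (by positivity), one_mul]
        _ ≤ ((n : ℝ) ^ 7)⁻¹ := by
            gcongr
            · linarith
            · omega
    have t2 : ∀ v, bernExp p (f2 v) ≤ ((n : ℝ) ^ 4)⁻¹ := by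
      intro v
      refine (bernExp_exp_degree hp.le hp1.le v).trans ?_
      have e : ((n : ℝ) ^ 4)⁻¹ = Real.exp (-(4 * Real.log n)) := by
        rw [Real.exp_neg, show 4 * Real.log n = ((4 : ℕ) : ℝ) * Real.log n by norm_num,
          Real.exp_nat_mul, Real.exp_log hn0]
      rw [e]
      refine Real.exp_le_exp.mpr ?_
      rw [← hq]
      linarith
    have s1 := Finset.sum_le_sum t1
    have s2 := Finset.sum_le_sum fun v (_ : v ∈ Finset.univ) => t2 v
    rw [Finset.sum_const, Nat.card_Icc, nsmul_eq_mul] at s1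
    rw [Finset.sum_const, Finset.card_univ, Fintype.card_fin, nsmul_eq_mul] at s2
    have hm : ((n - k : ℕ) : ℝ) ≤ n := by exact_mod_cast Nat.sub_le _ _
    have s3 : ((n + 1 - 1 : ℕ) : ℝ) * ((n : ℝ) ^ 7)⁻¹ ≤ 0.001 := by
      rw [Nat.add_sub_cancel, show (n : ℝ) ^ 7 = n * n ^ 6 by ring, mul_inv, ← mul_assoc,
        mul_inv_cancel₀ hn0.ne', one_mul]
      refine inv_le_of_inv_le₀ (by norm_num) ?_
      calc (0.001 : ℝ)⁻¹ = 1000 := by norm_num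
        _ ≤ n := hn'
        _ = n ^ 1 := (pow_one _).symm
        _ ≤ n ^ 6 := pow_le_pow_right₀ (by linarith) (by norm_num)
    have s4 : ((n - k : ℕ) : ℝ) * ((n : ℝ) ^ 4)⁻¹ ≤ 0.001 := by
      calc ((n - k : ℕ) : ℝ) * ((n : ℝ) ^ 4)⁻¹ ≤ n * ((n : ℝ) ^ 4)⁻¹ := by gcongr
        _ = ((n : ℝ) ^ 3)⁻¹ := by
          rw [show (n : ℝ) ^ 4 = n * n ^ 3 by ring, mul_inv, ← mul_assoc,
            mul_inv_cancel₀ hn0.ne', one_mul]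
        _ ≤ 0.001 := by
          refine inv_le_of_inv_le₀ (by norm_num) ?_
          calc (0.001 : ℝ)⁻¹ = 1000 := by norm_num
            _ ≤ n := hn'
            _ = n ^ 1 := (pow_one _).symm
            _ ≤ n ^ 3 := pow_le_pow_right₀ (by linarith) (by norm_num)
    calc _ ≤ (0.001 : ℝ) + 0.001 := add_le_add (s1.trans s3) (s2.trans s4)
      _ ≤ 0.005 := by norm_num
  · have hrn : r ≤ n ∨ n < r := le_or_gt r n
    have hA : 0 ≤ ∑ r ∈ Finset.Icc 1 n, ∑ t ∈ bad r, f1 r t H :=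
      Finset.sum_nonneg fun r _ => Finset.sum_nonneg fun t _ => (Real.exp_pos _).le
    have hB : 0 ≤ ∑ v, f2 v H := Finset.sum_nonneg fun v _ => (Real.exp_pos _).le
    have hrn : r ≤ n := by
      rw [theta_pow_div] at h
      have h1θ : (1 : ℝ) ≤ max (p / q) (q / p) * p / q := by
        have : q / p * p / q = 1 := by field_simp
        calc (1 : ℝ) = q / p * p / q := this.symm
          _ ≤ _ := by gcongr; exact le_max_right _ _
      have hY : (1 : ℝ) ≤ (max (p / q) (q / p) * p / q) ^ r / q := by
        rw [one_le_div hq0]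
        exact hq1.le.trans (one_le_pow₀ h1θ)
      have h2 : Sq r ≤ n := by
        have h3 : 0 ≤ Sq r := Real.sqrt_nonneg _
        have h4 : Sq r * 1 ≤ Sq r * ((max (p / q) (q / p) * p / q) ^ r / q) := by gcongr
        have h5 : 64 * (Sq r * ((max (p / q) (q / p) * p / q) ^ r / q)) ≤ k := h
        linarith
      have h3 : Sq r ^ 2 = r * n * Real.log n := Real.sq_sqrt (by positivity)
      have hlog : 1 ≤ Real.log n := by
        rw [Real.le_log_iff_exp_le (by linarith)]
        exact (Real.exp_one_lt_three.le).trans (by linarith)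
      have h4 : (r : ℝ) * n ≤ n * n := by
        calc (r : ℝ) * n ≤ r * n * Real.log n := le_mul_of_one_le_right (by positivity) hlog
          _ = Sq r ^ 2 := h3.symm
          _ ≤ n ^ 2 := pow_le_pow_left₀ (Real.sqrt_nonneg _) h2 2
          _ = n * n := pow_two _
      exact_mod_cast le_of_mul_le_mul_right h4 (by linarith)
    have hlog : 0 < Real.log n := by linarith
    have hSpos : 0 < Sq r := Real.sqrt_pos.mpr (by
      have : (0 : ℝ) < r := by exact_mod_cast hr
      have : (0 : ℝ) < n := by linarith
      positivity)
    have hμpos : 0 < ((max w s : ℕ) : ℝ) := by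
      exact_mod_cast (by omega : 0 < max w s)
    refine bicliqueCertificate_of_tupleSum hn1000 hkn hp hp1 hws hs hr h (fun t ht => ?_) fun v => ?_
    · have h1 : f1 r t H < 1 := by
        have e1 : f1 r t H ≤ ∑ t ∈ bad r, f1 r t H :=
          Finset.single_le_sum (f := fun t => f1 r t H) (fun t _ => (Real.exp_pos _).le)
            (Finset.mem_filter.mpr ⟨Finset.mem_univ _, ht⟩)
        have e2 : ∑ t ∈ bad r, f1 r t H ≤ ∑ r ∈ Finset.Icc 1 n, ∑ t ∈ bad r, f1 r t H :=
          Finset.single_le_sum (f := fun r => ∑ t ∈ bad r, f1 r t H)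
            (fun r _ => Finset.sum_nonneg fun t _ => (Real.exp_pos _).le)
            (Finset.mem_Icc.mpr ⟨hr, hrn⟩)
        linarith
      rw [hf1, Real.exp_lt_one_iff] at h1
      have h2 : (tupleSum H w s t : ℝ) / ((max w s : ℕ) : ℝ) ^ (2 * r) - 8 * Sq r < 0 := by
        by_contra hge
        push Not at hge
        have : 0 ≤ 3 * Sq r / n := by positivity
        have := mul_nonneg this hge
        linarith
      have h3 : (tupleSum H w s t : ℝ) / ((max w s : ℕ) : ℝ) ^ (2 * r) ≤ 8 * Sq r := by linarith
      rw [div_le_iff₀ (by positivity)] at h3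
      exact h3.trans_eq (mul_comm _ _)
    · have h1 : f2 v H < 1 := by
        have e1 : f2 v H ≤ ∑ v, f2 v H :=
          Finset.single_le_sum (f := fun v => f2 v H) (fun v _ => (Real.exp_pos _).le)
            (Finset.mem_univ v)
        linarith
      rw [hf2, Real.exp_lt_one_iff] at h1
      by_contra hge
      push Not at hge
      have : 0 ≤ q / 4 * (((Finset.univ.filter fun u => H (u, v) = true).card : ℝ) - (k - k * q / 2)) :=
        mul_nonneg (by positivity) (by linarith)
      linarith

section OperatorNorm
open scoped Matrix.Norms.L2Operator
variable {κ μ : Type} [Fintype κ] [Fintype μ] [DecidableEq μ]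

lemma Matrix.sum_mulVec_sq_le (Z : Matrix κ μ ℝ) (y : μ → ℝ) :
    ∑ u, (Z.mulVec y u) ^ 2 ≤ ‖Z‖ ^ 2 * ∑ v, y v ^ 2 := by
  have h := Z.l2_opNorm_mulVec (WithLp.toLp 2 y)
  have h2 := pow_le_pow_left₀ (norm_nonneg _) h 2
  rw [mul_pow, EuclideanSpace.norm_sq_eq, EuclideanSpace.norm_sq_eq] at h2
  simpa using h2

lemma Matrix.dotProduct_mulVec_le (Z : Matrix κ μ ℝ) (x : κ → ℝ) (y : μ → ℝ) {a c : ℝ} (ha : 0 ≤ a)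
    (hc : 0 ≤ c) (hx : ∑ u, x u ^ 2 ≤ a ^ 2) (hy : ∑ v, y v ^ 2 ≤ c ^ 2) :
    x ⬝ᵥ Z.mulVec y ≤ ‖Z‖ * a * c := by
  refine abs_le_of_sq_le_sq' ?_ (by positivity) |>.2
  calc (x ⬝ᵥ Z.mulVec y) ^ 2 ≤ (∑ u, x u ^ 2) * ∑ u, (Z.mulVec y u) ^ 2 :=
        Finset.sum_mul_sq_le_sq_mul_sq _ _ _
    _ ≤ a ^ 2 * (‖Z‖ ^ 2 * c ^ 2) := by
        refine mul_le_mul hx ((Z.sum_mulVec_sq_le y).trans (by gcongr)) (by positivity) (by positivity)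
    _ = _ := by ring

lemma Matrix.l2_opNorm_le_of_dotProduct_le (Z : Matrix κ μ ℝ) {c : ℝ} (hc : 0 ≤ c)
    (h : ∀ (x : κ → ℝ) (y : μ → ℝ), ∑ u, x u ^ 2 ≤ 1 → ∑ v, y v ^ 2 ≤ 1 → x ⬝ᵥ Z.mulVec y ≤ c) :
    ‖Z‖ ≤ c := by
  rw [Matrix.l2_opNorm_def]
  refine ContinuousLinearMap.opNorm_le_bound _ hc fun y => ?_
  have e : ‖((Matrix.toEuclideanLin ≪≫ₗ LinearMap.toContinuousLinearMap) Z) y‖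
      = ‖WithLp.toLp 2 (Z.mulVec y.ofLp)‖ := rfl
  rw [e]
  rcases eq_or_ne ‖WithLp.toLp 2 (Z.mulVec y.ofLp)‖ 0 with h0 | h0
  · rw [h0]; positivity
  rcases eq_or_ne ‖y‖ 0 with h1 | h1
  · rw [norm_eq_zero] at h1
    simp [h1]
  set W := ‖WithLp.toLp 2 (Z.mulVec y.ofLp)‖ with hW
  have hW2 : W ^ 2 = ∑ u, (Z.mulVec y.ofLp u) ^ 2 := by
    rw [hW, EuclideanSpace.norm_sq_eq]; simp
  have hY2 : ‖y‖ ^ 2 = ∑ u, (y u) ^ 2 := by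
    rw [EuclideanSpace.norm_sq_eq]; simp
  have hWpos : 0 < W := lt_of_le_of_ne (norm_nonneg _) (Ne.symm h0)
  have hYpos : 0 < ‖y‖ := lt_of_le_of_ne (norm_nonneg _) (Ne.symm h1)
  have := h (W⁻¹ • Z.mulVec y.ofLp) (‖y‖⁻¹ • y.ofLp) (by
      simp only [Pi.smul_apply, smul_eq_mul, mul_pow]
      rw [← Finset.mul_sum, ← hW2]; field_simp; rfl) (by
      simp only [Pi.smul_apply, smul_eq_mul, mul_pow]
      rw [← Finset.mul_sum, ← hY2]; field_simp; rfl)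
  rw [Matrix.mulVec_smul, smul_dotProduct, dotProduct_smul, smul_eq_mul, smul_eq_mul] at this
  have e2 : Z.mulVec y.ofLp ⬝ᵥ Z.mulVec y.ofLp = W ^ 2 := by
    rw [hW2]; simp [dotProduct, pow_two]
  rw [e2] at this
  have e3 : W⁻¹ * (‖y‖⁻¹ * W ^ 2) = W / ‖y‖ := by field_simp
  rwa [e3, div_le_iff₀ hYpos] at this

lemma Matrix.l2_opNorm_sq_le (Z : Matrix κ μ ℝ) : ‖Z‖ ^ 2 ≤ ∑ u, ∑ v, Z u v ^ 2 := by
  have h0 : 0 ≤ ∑ u, ∑ v, Z u v ^ 2 := by positivity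
  have : ‖Z‖ ≤ Real.sqrt (∑ u, ∑ v, Z u v ^ 2) := by
    refine Z.l2_opNorm_le_of_dotProduct_le (Real.sqrt_nonneg _) fun x y hx hy => ?_
    refine Real.le_sqrt_of_sq_le ?_
    calc (x ⬝ᵥ Z.mulVec y) ^ 2 ≤ (∑ u, x u ^ 2) * ∑ u, (Z.mulVec y u) ^ 2 :=
          Finset.sum_mul_sq_le_sq_mul_sq _ _ _
      _ ≤ 1 * ∑ u, ∑ v, Z u v ^ 2 := by
          refine mul_le_mul hx ?_ (by positivity) zero_le_one
          refine Finset.sum_le_sum fun u _ => ?_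
          refine (Finset.sum_mul_sq_le_sq_mul_sq _ _ _).trans ?_
          exact mul_le_of_le_one_right (by positivity) hy
      _ = _ := one_mul _
  calc ‖Z‖ ^ 2 ≤ Real.sqrt (∑ u, ∑ v, Z u v ^ 2) ^ 2 := by gcongr
    _ = _ := Real.sq_sqrt h0

variable [DecidableEq κ]

lemma Matrix.l2_opNorm_transpose (Z : Matrix κ μ ℝ) : ‖Z.transpose‖ = ‖Z‖ := by
  have := Z.l2_opNorm_conjTranspose
  rwa [Matrix.conjTranspose_eq_transpose_of_trivial] at this

lemma Matrix.l2_opNorm_mul_transpose (Z : Matrix κ μ ℝ) : ‖Z * Z.transpose‖ = ‖Z‖ ^ 2 := by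
  have := (Z.transpose).l2_opNorm_conjTranspose_mul_self
  rw [Matrix.conjTranspose_eq_transpose_of_trivial, Matrix.transpose_transpose,
    Matrix.l2_opNorm_transpose] at this
  rw [this, pow_two]

lemma Matrix.trace_mul_transpose_pow_le (Z : Matrix κ μ ℝ) (l : ℕ) :
    ((Z * Z.transpose) ^ l).trace ≤ Fintype.card κ * ‖Z‖ ^ (2 * l) := by
  have h : ∀ u, ((Z * Z.transpose) ^ l) u u ≤ ‖Z‖ ^ (2 * l) := by
    intro u
    have h1 := ((Z * Z.transpose) ^ l).dotProduct_mulVec_le (Pi.single u 1) (Pi.single u 1)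
      zero_le_one zero_le_one (by simp [Pi.single_apply]) (by simp [Pi.single_apply])
    have h2 : ‖(Z * Z.transpose) ^ l‖ ≤ ‖Z‖ ^ (2 * l) := by
      rcases Nat.eq_zero_or_pos l with rfl | hl
      · have : Nonempty κ := ⟨u⟩
        simp only [pow_zero, mul_zero]
        refine Matrix.l2_opNorm_le_of_dotProduct_le _ zero_le_one fun x y hx hy => ?_
        rw [Matrix.one_mulVec]
        refine abs_le_of_sq_le_sq' ?_ zero_le_one |>.2
        refine (Finset.sum_mul_sq_le_sq_mul_sq _ _ _).trans ?_
        rw [one_pow]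
        exact mul_le_one₀ hx (by positivity) hy
      · refine (norm_pow_le' _ hl).trans ?_
        rw [Matrix.l2_opNorm_mul_transpose, ← pow_mul]
    simp at h1
    linarith
  calc ((Z * Z.transpose) ^ l).trace ≤ ∑ _u : κ, ‖Z‖ ^ (2 * l) := Finset.sum_le_sum fun u _ => h u
    _ = _ := by simp

lemma Matrix.l2_opNorm_pow_le_trace (Z : Matrix κ μ ℝ) (i : ℕ) :
    ‖Z‖ ^ (2 * 2 ^ (i + 1)) ≤ ((Z * Z.transpose) ^ 2 ^ (i + 1)).trace := by
  set A := Z * Z.transpose with hA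
  have hsymm : A.transpose = A := by simp [hA]
  have hsa : IsSelfAdjoint A := by
    rw [IsSelfAdjoint, Matrix.star_eq_conjTranspose, Matrix.conjTranspose_eq_transpose_of_trivial,
      hsymm]
  have h1 : ‖A ^ 2 ^ i‖ = ‖A‖ ^ 2 ^ i := by
    have := hsa.nnnorm_pow_two_pow i
    exact congrArg NNReal.toReal this
  have h2 := (A ^ 2 ^ i).l2_opNorm_sq_le
  have h3 : ∑ u, ∑ v, (A ^ 2 ^ i) u v ^ 2 = (A ^ 2 ^ (i + 1)).trace := by
    rw [pow_succ 2 i, pow_mul, pow_two (A ^ 2 ^ i)]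
    nth_rewrite 3 [← hsymm]
    rw [← Matrix.transpose_pow, Matrix.trace]
    refine Finset.sum_congr rfl fun u _ => ?_
    rw [Matrix.diag_apply, Matrix.mul_apply]
    exact Finset.sum_congr rfl fun v _ => by rw [Matrix.transpose_apply, pow_two]
  rw [h3, h1, Matrix.l2_opNorm_mul_transpose] at h2
  refine le_of_eq_of_le ?_ h2
  rw [← pow_mul, ← pow_mul, pow_succ]

lemma Matrix.trace_mul_transpose_pow_nonneg (Z : Matrix κ μ ℝ) (i : ℕ) :
    0 ≤ ((Z * Z.transpose) ^ 2 ^ (i + 1)).trace :=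
  (pow_nonneg (norm_nonneg Z) _).trans (Z.l2_opNorm_pow_le_trace i)

lemma Matrix.sum_vecMul_sq_le_of_trace_le (Z : Matrix κ μ ℝ) {i : ℕ} {L : ℝ} (hL : 0 ≤ L)
    (h : ((Z * Z.transpose) ^ 2 ^ (i + 1)).trace ≤ L ^ 2 ^ (i + 1)) (x : κ → ℝ) :
    ∑ v, (∑ u, Z u v * x u) ^ 2 ≤ L * ∑ u, x u ^ 2 := by
  have h1 := (Z.l2_opNorm_pow_le_trace i).trans h
  rw [pow_mul] at h1
  have h2 : ‖Z‖ ^ 2 ≤ L := le_of_pow_le_pow_left₀ (by positivity) hL h1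
  have h3 := Z.transpose.sum_mulVec_sq_le x
  rw [Matrix.l2_opNorm_transpose] at h3
  calc ∑ v, (∑ u, Z u v * x u) ^ 2 = ∑ v, (Z.transpose.mulVec x v) ^ 2 := rfl
    _ ≤ _ := h3
    _ ≤ _ := by gcongr

end OperatorNorm

section LatticeNet

lemma exists_int_near (t : ℝ) : ∃ z : ℤ, (z : ℝ) ^ 2 ≤ t ^ 2 ∧ (t - z) ^ 2 ≤ 1 := by
  rcases le_or_gt 0 t with h | h
  · have h1 := Int.floor_le t
    have h2 := Int.lt_floor_add_one t
    have h3 : (0 : ℝ) ≤ ⌊t⌋ := by exact_mod_cast Int.floor_nonneg.mpr h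
    exact ⟨⌊t⌋, by nlinarith, by nlinarith⟩
  · have h1 := Int.le_ceil t
    have h2 := Int.ceil_lt_add_one t
    have h3 : (⌈t⌉ : ℝ) ≤ 0 := by exact_mod_cast Int.ceil_le.mpr (by simpa using h.le)
    exact ⟨⌈t⌉, by nlinarith, by nlinarith⟩

variable {κ μ : Type} [Fintype κ] [Fintype μ] [DecidableEq κ] [DecidableEq μ]

/-- The lattice points supported on `S` whose two halves have squared norm at most `16 * #S`. -/
noncomputable def latticeNet (S : Finset (κ ⊕ μ)) : Finset (κ ⊕ μ → ℤ) :=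
  (Fintype.piFinset fun w => if w ∈ S then Finset.Icc (-(16 * S.card : ℤ)) (16 * S.card) else {0}).filter
    fun z => ∑ u, z (Sum.inl u) ^ 2 ≤ 16 * S.card ∧ ∑ v, z (Sum.inr v) ^ 2 ≤ 16 * S.card

lemma mem_latticeNet {S : Finset (κ ⊕ μ)} {z : κ ⊕ μ → ℤ} :
    z ∈ latticeNet S ↔ (∀ w, w ∉ S → z w = 0) ∧
      ∑ u, z (Sum.inl u) ^ 2 ≤ 16 * S.card ∧ ∑ v, z (Sum.inr v) ^ 2 ≤ 16 * S.card := by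
  rw [latticeNet, Finset.mem_filter, Fintype.mem_piFinset]
  refine ⟨fun h => ⟨fun w hw => by simpa [hw] using h.1 w, h.2⟩, fun h => ⟨fun w => ?_, h.2⟩⟩
  by_cases hw : w ∈ S
  · rw [if_pos hw, Finset.mem_Icc, ← abs_le]
    have h1 : z w ^ 2 ≤ 16 * S.card := by
      rcases w with u | v
      · exact (Finset.single_le_sum (f := fun u => z (Sum.inl u) ^ 2) (fun _ _ => sq_nonneg _)
          (Finset.mem_univ u)).trans h.2.1
      · exact (Finset.single_le_sum (f := fun v => z (Sum.inr v) ^ 2) (fun _ _ => sq_nonneg _)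
          (Finset.mem_univ v)).trans h.2.2
    have h2 : |z w| ≤ z w ^ 2 := by
      rw [← sq_abs]; exact Int.le_self_sq _
    exact h2.trans h1
  · rw [if_neg hw, Finset.mem_singleton]; exact h.1 w hw

open scoped Matrix.Norms.L2Operator in
lemma Matrix.l2_opNorm_le_of_latticeNet (Z : Matrix κ μ ℝ) (S : Finset (κ ⊕ μ))
    (hZ : ∀ u v, Z u v ≠ 0 → Sum.inl u ∈ S ∧ Sum.inr v ∈ S) {N : ℝ} (hN : 0 ≤ N)
    (h : ∀ z ∈ latticeNet S,
      (fun u => (z (Sum.inl u) : ℝ)) ⬝ᵥ Z.mulVec (fun v => (z (Sum.inr v) : ℝ)) ≤ 16 * S.card * N) :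
    ‖Z‖ ≤ 2 * N := by
  rcases Nat.eq_zero_or_pos S.card with hS | hS
  · have : Z = 0 := by
      ext u v
      by_contra hne
      have := (hZ u v hne).1
      rw [Finset.card_eq_zero.mp hS] at this
      simp at this
    rw [this, norm_zero]; positivity
  have hS' : (0 : ℝ) < S.card := by exact_mod_cast hS
  set D : ℝ := 4 * Real.sqrt S.card with hD
  have hD0 : 0 < D := by positivity
  have hD2 : D ^ 2 = 16 * S.card := by
    rw [hD, mul_pow, Real.sq_sqrt hS'.le]; norm_num
  suffices ‖Z‖ ≤ N + ‖Z‖ / 2 by linarith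
  refine Z.l2_opNorm_le_of_dotProduct_le (by positivity) fun x y hx hy => ?_
  choose r hr1 hr2 using exists_int_near
  set a : κ → ℝ := fun u => if Sum.inl u ∈ S then x u else 0 with ha
  set b : μ → ℝ := fun v => if Sum.inr v ∈ S then y v else 0 with hb
  set z : κ ⊕ μ → ℤ := fun w => if w ∈ S then r (D * Sum.elim x y w) else 0 with hz
  set a' : κ → ℝ := fun u => D⁻¹ * z (Sum.inl u) with ha'
  set b' : μ → ℝ := fun v => D⁻¹ * z (Sum.inr v) with hb'
  have hza : ∀ u, (z (Sum.inl u) : ℝ) ^ 2 ≤ D ^ 2 * x u ^ 2 := by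
    intro u
    simp only [hz]
    split_ifs
    · rw [← mul_pow]; exact hr1 _
    · simp; positivity
  have hzb : ∀ v, (z (Sum.inr v) : ℝ) ^ 2 ≤ D ^ 2 * y v ^ 2 := by
    intro v
    simp only [hz]
    split_ifs
    · rw [← mul_pow]; exact hr1 _
    · simp; positivity
  have hzaS : ∑ u, (z (Sum.inl u) : ℝ) ^ 2 ≤ 16 * S.card := by
    calc _ ≤ ∑ u, D ^ 2 * x u ^ 2 := Finset.sum_le_sum fun u _ => hza u
      _ = D ^ 2 * ∑ u, x u ^ 2 := by rw [Finset.mul_sum]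
      _ ≤ D ^ 2 * 1 := by gcongr
      _ = _ := by rw [mul_one, hD2]
  have hzbS : ∑ v, (z (Sum.inr v) : ℝ) ^ 2 ≤ 16 * S.card := by
    calc _ ≤ ∑ v, D ^ 2 * y v ^ 2 := Finset.sum_le_sum fun u _ => hzb u
      _ = D ^ 2 * ∑ v, y v ^ 2 := by rw [Finset.mul_sum]
      _ ≤ D ^ 2 * 1 := by gcongr
      _ = _ := by rw [mul_one, hD2]
  have hzN : z ∈ latticeNet S := by
    refine mem_latticeNet.mpr ⟨fun w hw => by simp [hz, hw], ?_, ?_⟩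
    · exact_mod_cast hzaS
    · exact_mod_cast hzbS
  have hab : x ⬝ᵥ Z.mulVec y = a ⬝ᵥ Z.mulVec b := by
    simp only [dotProduct, Matrix.mulVec, Finset.mul_sum]
    refine Finset.sum_congr rfl fun u _ => Finset.sum_congr rfl fun v _ => ?_
    by_cases hne : Z u v = 0
    · simp [hne]
    · obtain ⟨h1, h2⟩ := hZ u v hne
      simp [ha, hb, h1, h2]
  have hspl : a ⬝ᵥ Z.mulVec b = a' ⬝ᵥ Z.mulVec b' + (a - a') ⬝ᵥ Z.mulVec b
      + a' ⬝ᵥ Z.mulVec (b - b') := by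
    rw [sub_dotProduct, Matrix.mulVec_sub, dotProduct_sub]; ring
  have ha'1 : ∑ u, a' u ^ 2 ≤ 1 ^ 2 := by
    simp only [ha', mul_pow, ← Finset.mul_sum]
    rw [inv_pow, hD2, inv_mul_le_iff₀ (by positivity)]
    simpa using hzaS
  have hb1 : ∑ v, b v ^ 2 ≤ 1 ^ 2 := by
    rw [one_pow]
    refine le_trans (Finset.sum_le_sum fun v _ => ?_) hy
    simp only [hb]; split_ifs
    · exact le_rfl
    · rw [zero_pow two_ne_zero]; positivity
  have hda : ∀ w, (if w ∈ S then Sum.elim x y w - D⁻¹ * z w else 0) ^ 2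
      ≤ if w ∈ S then (D ^ 2)⁻¹ else 0 := by
    intro w
    simp only [hz]
    split_ifs
    · have h1 := hr2 (D * Sum.elim x y w)
      have e : Sum.elim x y w - D⁻¹ * (r (D * Sum.elim x y w) : ℝ)
          = D⁻¹ * (D * Sum.elim x y w - r (D * Sum.elim x y w)) := by field_simp
      rw [e, mul_pow, inv_pow]
      exact mul_le_of_le_one_right (by positivity) h1
    · simp
  have hsum : ∑ w, (if w ∈ S then Sum.elim x y w - D⁻¹ * (z w : ℝ) else 0) ^ 2 ≤ (1 / 4) ^ 2 := by
    refine (Finset.sum_le_sum fun w _ => hda w).trans ?_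
    rw [Finset.sum_ite_mem, Finset.univ_inter, Finset.sum_const, nsmul_eq_mul, hD2]
    apply le_of_eq; field_simp; norm_num
  rw [Fintype.sum_sum_type] at hsum
  have hda2 : ∑ u, (a - a') u ^ 2 ≤ (1 / 4) ^ 2 := by
    refine le_trans ?_ (le_trans (le_add_of_nonneg_right (by positivity)) hsum)
    refine Finset.sum_le_sum fun u _ => le_of_eq ?_
    simp only [Pi.sub_apply, ha, ha', hz, Sum.elim_inl]
    split_ifs <;> simp
  have hdb2 : ∑ v, (b - b') v ^ 2 ≤ (1 / 4) ^ 2 := by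
    refine le_trans ?_ (le_trans (le_add_of_nonneg_left (by positivity)) hsum)
    refine Finset.sum_le_sum fun u _ => le_of_eq ?_
    simp only [Pi.sub_apply, hb, hb', hz, Sum.elim_inr]
    split_ifs <;> simp
  have t1 : a' ⬝ᵥ Z.mulVec b' ≤ N := by
    have e : a' ⬝ᵥ Z.mulVec b' = (D ^ 2)⁻¹ *
        ((fun u => (z (Sum.inl u) : ℝ)) ⬝ᵥ Z.mulVec (fun v => (z (Sum.inr v) : ℝ))) := by
      have e1 : a' = D⁻¹ • (fun u => (z (Sum.inl u) : ℝ)) := rfl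
      have e2 : b' = D⁻¹ • (fun u => (z (Sum.inr u) : ℝ)) := rfl
      rw [e1, e2, Matrix.mulVec_smul, smul_dotProduct, dotProduct_smul, smul_eq_mul, smul_eq_mul]
      ring
    rw [e, inv_mul_le_iff₀ (by positivity), hD2]
    exact h z hzN
  have t2 := Z.dotProduct_mulVec_le (a - a') b (by norm_num) zero_le_one hda2 hb1
  have t3 := Z.dotProduct_mulVec_le a' (b - b') zero_le_one (by norm_num) ha'1 hdb2
  rw [hab, hspl]
  linarith

lemma card_latticeNet_le (S : Finset (κ ⊕ μ)) :
    ((latticeNet S).card : ℝ) ≤ (3 * 2 ^ 32) ^ S.card := by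
  have hgeo : ∀ B : ℕ, ∑ z ∈ Finset.Icc (-(B : ℤ)) B, (1 / 2 : ℝ) ^ z.natAbs ≤ 3 := by
    intro B
    have : ∑ z ∈ Finset.Icc (-(B : ℤ)) B, (1 / 2 : ℝ) ^ z.natAbs = 3 - 2 * (1 / 2) ^ B := by
      induction B with
      | zero => norm_num
      | succ B ih =>
        have e : Finset.Icc (-((B + 1 : ℕ) : ℤ)) ((B + 1 : ℕ) : ℤ)
            = insert (-((B + 1 : ℕ) : ℤ)) (insert ((B + 1 : ℕ) : ℤ) (Finset.Icc (-(B : ℤ)) B)) := by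
          ext z; simp only [Finset.mem_Icc, Finset.mem_insert]; omega
        rw [e, Finset.sum_insert, Finset.sum_insert, ih]
        · rw [Int.natAbs_neg, Int.natAbs_natCast, pow_succ]; ring
        · simp only [Finset.mem_Icc]; omega
        · simp only [Finset.mem_Icc, Finset.mem_insert]; omega
    rw [this]
    have : (0 : ℝ) ≤ (1 / 2) ^ B := by positivity
    linarith
  have hz : ∀ z ∈ latticeNet S, (1 : ℝ) ≤ 2 ^ (32 * S.card) * ∏ w, (1 / 2 : ℝ) ^ (z w).natAbs := by
    intro z hz
    obtain ⟨-, h1, h2⟩ := mem_latticeNet.mp hz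
    rw [Finset.prod_pow_eq_pow_sum, one_div, inv_pow, ← div_eq_mul_inv, one_le_div (by positivity)]
    refine pow_le_pow_right₀ (by norm_num) ?_
    zify
    calc ∑ w, |z w| ≤ ∑ w, z w ^ 2 := Finset.sum_le_sum fun w _ => by
          rw [← sq_abs]; exact Int.le_self_sq _
      _ ≤ 16 * S.card + 16 * S.card := by
          rw [Fintype.sum_sum_type]; exact add_le_add h1 h2
      _ = _ := by ring
  calc ((latticeNet S).card : ℝ) = ∑ z ∈ latticeNet S, 1 := by simp
    _ ≤ ∑ z ∈ latticeNet S, 2 ^ (32 * S.card) * ∏ w, (1 / 2 : ℝ) ^ (z w).natAbs :=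
        Finset.sum_le_sum hz
    _ ≤ ∑ z ∈ Fintype.piFinset fun w => if w ∈ S then Finset.Icc (-(16 * S.card : ℤ)) (16 * S.card)
          else {0}, 2 ^ (32 * S.card) * ∏ w, (1 / 2 : ℝ) ^ (z w).natAbs :=
        Finset.sum_le_sum_of_subset_of_nonneg (Finset.filter_subset _ _) fun _ _ _ => by positivity
    _ = 2 ^ (32 * S.card) * ∏ w, ∑ j ∈ (if w ∈ S then Finset.Icc (-(16 * S.card : ℤ)) (16 * S.card)
          else {0}), (1 / 2 : ℝ) ^ j.natAbs := by
        rw [← Finset.mul_sum, Finset.prod_univ_sum]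
    _ ≤ 2 ^ (32 * S.card) * ∏ w, if w ∈ S then 3 else 1 := by
        gcongr with w _
        split_ifs
        · exact_mod_cast hgeo (16 * S.card)
        · simp
    _ = _ := by
        rw [Finset.prod_ite_mem, Finset.univ_inter, Finset.prod_const, mul_pow, pow_mul]; ring

end LatticeNet

section SparseMatrix

/-- A two-point variable that is centered when `true` has probability `1 / 3`. -/
def skewSign (b : Bool) : ℝ := if b then 2 else -1

variable {k m : ℕ}

/-- The matrix of skew signs whose rows and columns are selected by `ξ`. -/
noncomputable def sparseMatrix (ξ : Fin k ⊕ Fin m → Bool) (Y : Fin k × Fin m → Bool) :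
    Matrix (Fin k) (Fin m) ℝ :=
  Matrix.of fun u v => (ξ (Sum.inl u)).toNat * (ξ (Sum.inr v)).toNat * skewSign (Y (u, v))

lemma bernExp_skewSign (c : Fin k × Fin m → ℝ) :
    bernExp (1 / 3) (fun Y : Fin k × Fin m → Bool => Real.exp (∑ e, c e * skewSign (Y e)))
      ≤ Real.exp (4 * ∑ e, c e ^ 2) := by
  simp only [Real.exp_sum]
  rw [bernExp_prod (fun e b => Real.exp (c e * skewSign b)), Finset.mul_sum, Real.exp_sum]
  refine Finset.prod_le_prod (fun e _ => by positivity) fun e _ => ?_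
  have hb : ∀ b, Real.exp (c e * skewSign b) ≤ c e * skewSign b + Real.exp (4 * c e ^ 2) := by
    intro b
    refine (Real.exp_le_add_exp_sq _).trans ?_
    gcongr
    cases b <;> simp only [skewSign, if_true, Bool.false_eq_true, if_false] <;> nlinarith [sq_nonneg (c e)]
  have h1 := hb true
  have h2 := hb false
  simp only [skewSign, if_true, Bool.false_eq_true, if_false] at h1 h2 ⊢
  linarith

lemma pow_two_mul_le_exp {l : ℕ} (hl : 1 ≤ l) {x : ℝ} (hx : 0 ≤ x) :
    x ^ (2 * l) ≤ (l : ℝ) ^ l * Real.exp (2 * Real.sqrt l * x) := by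
  have hl' : (0 : ℝ) < l := by exact_mod_cast hl
  have hs : 0 < Real.sqrt l := Real.sqrt_pos.mpr hl'
  have h1 : x / Real.sqrt l ≤ Real.exp (x / Real.sqrt l) :=
    (by linarith : x / Real.sqrt l ≤ x / Real.sqrt l + 1).trans (Real.add_one_le_exp _)
  have h2 := pow_le_pow_left₀ (by positivity) h1 (2 * l)
  rw [← Real.exp_nat_mul, div_pow, div_le_iff₀ (by positivity)] at h2
  refine h2.trans (le_of_eq ?_)
  rw [pow_mul (Real.sqrt l), Real.sq_sqrt hl'.le, mul_comm]
  congr 2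
  push_cast
  have : (l : ℝ) = Real.sqrt l * Real.sqrt l := (Real.mul_self_sqrt hl'.le).symm
  field_simp
  rw [pow_two, ← this, mul_comm]

open scoped Matrix.Norms.L2Operator in
lemma bernExp_trace_sparseMatrix (ξ : Fin k ⊕ Fin m → Bool) {l : ℕ} (hl : 1 ≤ l) :
    bernExp (1 / 3) (fun Y : Fin k × Fin m → Bool =>
        ((sparseMatrix ξ Y * (sparseMatrix ξ Y).transpose) ^ l).trace)
      ≤ k * ((l : ℝ) ^ l * Real.exp (64 * l)) *
        (3 * 2 ^ 32) ^ (Finset.univ.filter fun w => ξ w = true).card := by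
  set S := Finset.univ.filter fun w => ξ w = true with hS
  set τ : ℝ := 4 * Real.sqrt l with hτ
  have hτ2 : τ ^ 2 = 16 * l := by rw [hτ, mul_pow, Real.sq_sqrt (by positivity)]; norm_num
  set c : (Fin k ⊕ Fin m → ℤ) → Fin k × Fin m → ℝ := fun z e =>
    τ * (16 * S.card : ℝ)⁻¹ * (z (Sum.inl e.1) * z (Sum.inr e.2) *
      ((ξ (Sum.inl e.1)).toNat * (ξ (Sum.inr e.2)).toNat)) with hc
  have key : ∀ Y, ((sparseMatrix ξ Y * (sparseMatrix ξ Y).transpose) ^ l).trace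
      ≤ k * (l : ℝ) ^ l * ∑ z ∈ latticeNet S, Real.exp (∑ e, c z e * skewSign (Y e)) := by
    intro Y
    set Z := sparseMatrix ξ Y with hZ
    refine (Z.trace_mul_transpose_pow_le l).trans ?_
    rw [Fintype.card_fin, mul_assoc]
    refine mul_le_mul_of_nonneg_left ?_ (by positivity)
    refine (pow_two_mul_le_exp hl (norm_nonneg Z)).trans ?_
    refine mul_le_mul_of_nonneg_left ?_ (by positivity)
    set b : (Fin k ⊕ Fin m → ℤ) → ℝ := fun z =>
      (fun u => (z (Sum.inl u) : ℝ)) ⬝ᵥ Z.mulVec (fun v => (z (Sum.inr v) : ℝ)) with hb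
    have h0 : (0 : Fin k ⊕ Fin m → ℤ) ∈ latticeNet S := mem_latticeNet.mpr (by simp)
    obtain ⟨z₀, hz₀, hmax⟩ := (latticeNet S).exists_max_image b ⟨0, h0⟩
    have hb0 : 0 ≤ b z₀ := by
      refine le_trans (le_of_eq ?_) (hmax 0 h0)
      simp [hb, dotProduct]
    have hcb : ∀ z, ∑ e, c z e * skewSign (Y e) = τ * ((16 * S.card : ℝ)⁻¹ * b z) := by
      intro z
      simp only [hb, hc, hZ, sparseMatrix, dotProduct, Matrix.mulVec, Matrix.of_apply,
        Finset.mul_sum, Fintype.sum_prod_type]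
      exact Finset.sum_congr rfl fun u _ => Finset.sum_congr rfl fun v _ => by ring
    have hnorm : ‖Z‖ ≤ 2 * ((16 * S.card : ℝ)⁻¹ * b z₀) := by
      refine Z.l2_opNorm_le_of_latticeNet S (fun u v huv => ?_) (by positivity) fun z hz => ?_
      · simp only [hS, Finset.mem_filter, Finset.mem_univ, true_and]
        by_contra hne
        refine huv ?_
        rw [not_and_or, Bool.not_eq_true, Bool.not_eq_true] at hne
        rcases hne with h | h <;> simp [hZ, sparseMatrix, h]
      · rcases Nat.eq_zero_or_pos S.card with h | h
        · have hz0 : z = 0 := by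
            funext w
            refine (mem_latticeNet.mp hz).1 w ?_
            rw [Finset.card_eq_zero.mp h]; simp
          simp [hz0, dotProduct, h]
        · have h' : (0 : ℝ) < S.card := by exact_mod_cast h
          rw [← mul_assoc, mul_inv_cancel₀ (by positivity), one_mul]
          exact hmax z hz
    calc Real.exp (2 * Real.sqrt l * ‖Z‖)
        ≤ Real.exp (∑ e, c z₀ e * skewSign (Y e)) := by
          refine Real.exp_le_exp.mpr ?_
          rw [hcb, hτ]
          calc 2 * Real.sqrt l * ‖Z‖ ≤ 2 * Real.sqrt l * (2 * ((16 * S.card : ℝ)⁻¹ * b z₀)) := by gcongr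
            _ = _ := by ring
      _ ≤ _ := Finset.single_le_sum (f := fun z => Real.exp (∑ e, c z e * skewSign (Y e)))
          (fun _ _ => (Real.exp_pos _).le) hz₀
  have hterm : ∀ z ∈ latticeNet S, bernExp (1 / 3) (fun Y : Fin k × Fin m → Bool =>
      Real.exp (∑ e, c z e * skewSign (Y e))) ≤ Real.exp (64 * l) := by
    intro z hz
    refine (bernExp_skewSign (c z)).trans (Real.exp_le_exp.mpr ?_)
    obtain ⟨-, h1, h2⟩ := mem_latticeNet.mp hz
    have h1' : ∑ u, (z (Sum.inl u) : ℝ) ^ 2 ≤ 16 * S.card := by exact_mod_cast h1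
    have h2' : ∑ v, (z (Sum.inr v) : ℝ) ^ 2 ≤ 16 * S.card := by exact_mod_cast h2
    have hbool : ∀ b : Bool, ((b.toNat : ℝ)) ^ 2 ≤ 1 := by intro b; cases b <;> simp
    calc 4 * ∑ e, c z e ^ 2
        ≤ 4 * ∑ e : Fin k × Fin m, τ ^ 2 * (16 * S.card : ℝ)⁻¹ ^ 2 *
            (z (Sum.inl e.1) ^ 2 * z (Sum.inr e.2) ^ 2) := by
          gcongr with e _
          simp only [hc, mul_pow]
          refine mul_le_mul_of_nonneg_left ?_ (by positivity)
          refine mul_le_of_le_one_right (by positivity) ?_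
          exact mul_le_one₀ (hbool _) (by positivity) (hbool _)
      _ = 4 * (τ ^ 2 * (16 * S.card : ℝ)⁻¹ ^ 2 *
            ((∑ u, (z (Sum.inl u) : ℝ) ^ 2) * ∑ v, (z (Sum.inr v) : ℝ) ^ 2)) := by
          rw [← Finset.mul_sum, Finset.sum_mul_sum, Fintype.sum_prod_type]
      _ ≤ 4 * (τ ^ 2 * (16 * S.card : ℝ)⁻¹ ^ 2 * ((16 * S.card) * (16 * S.card))) := by gcongr
      _ = 4 * τ ^ 2 * ((16 * S.card : ℝ)⁻¹ * (16 * S.card)) ^ 2 := by ring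
      _ ≤ 4 * τ ^ 2 * 1 := by
          gcongr
          exact pow_le_one₀ (by positivity) ((inv_mul_eq_div _ _).trans_le (div_self_le_one _))
      _ = 64 * l := by rw [hτ2]; ring
  calc _ ≤ bernExp (1 / 3) (fun Y : Fin k × Fin m → Bool => k * (l : ℝ) ^ l *
          ∑ z ∈ latticeNet S, Real.exp (∑ e, c z e * skewSign (Y e))) :=
        bernExp_mono (by norm_num) (by norm_num) key
    _ = k * (l : ℝ) ^ l * ∑ z ∈ latticeNet S, bernExp (1 / 3) (fun Y : Fin k × Fin m → Bool =>
          Real.exp (∑ e, c z e * skewSign (Y e))) := by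
        rw [bernExp_const_mul, bernExp_sum]
    _ ≤ k * (l : ℝ) ^ l * ∑ z ∈ latticeNet S, Real.exp (64 * l) := by
        gcongr with z hz
        exact hterm z hz
    _ = k * ((l : ℝ) ^ l * Real.exp (64 * l)) * (latticeNet S).card := by
        rw [Finset.sum_const, nsmul_eq_mul]; ring
    _ ≤ _ := by
        gcongr
        exact card_latticeNet_le S

lemma bernExp_bernExp_trace_sparseMatrix {n l : ℕ} (hl : 1 ≤ l) (hkm : k + m = n) {s : ℝ} (hs : 0 ≤ s)
    (hs1 : s ≤ 1) (hsl : n * s ≤ l) :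
    bernExp s (fun ξ : Fin k ⊕ Fin m → Bool => bernExp (1 / 3) (fun Y : Fin k × Fin m → Bool =>
        ((sparseMatrix ξ Y * (sparseMatrix ξ Y).transpose) ^ l).trace))
      ≤ k * ((l : ℝ) ^ l * Real.exp ((64 + 3 * 2 ^ 32) * l)) := by
  calc _ ≤ bernExp s (fun ξ : Fin k ⊕ Fin m → Bool => k * ((l : ℝ) ^ l * Real.exp (64 * l)) *
        ∏ w, (if ξ w = true then (3 * 2 ^ 32 : ℝ) else 1)) := by
        refine bernExp_mono hs hs1 fun ξ => (bernExp_trace_sparseMatrix ξ hl).trans (le_of_eq ?_)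
        rw [Finset.prod_ite, Finset.prod_const, Finset.prod_const_one, mul_one]
    _ = k * ((l : ℝ) ^ l * Real.exp (64 * l)) * (s * (3 * 2 ^ 32) + (1 - s)) ^ n := by
        rw [bernExp_const_mul, bernExp_prod (fun _ b => if b = true then (3 * 2 ^ 32 : ℝ) else 1)]
        simp [← hkm]
    _ ≤ k * ((l : ℝ) ^ l * Real.exp (64 * l)) * Real.exp (3 * 2 ^ 32 * l) := by
        gcongr
        calc (s * (3 * 2 ^ 32) + (1 - s)) ^ n ≤ Real.exp (3 * 2 ^ 32 * s) ^ n := by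
              gcongr
              refine le_trans ?_ (Real.add_one_le_exp _)
              linarith
          _ = Real.exp (3 * 2 ^ 32 * (n * s)) := by rw [← Real.exp_nat_mul]; congr 1; ring
          _ ≤ _ := by gcongr
    _ = _ := by
        rw [mul_assoc, mul_assoc, ← Real.exp_add]; congr 3; ring

end SparseMatrix

section Walks
variable {k m : ℕ}

/-- The vertices touched by the edges of a monomial in the entries of a matrix. -/
def touched (a : Fin k × Fin m →₀ ℕ) : Finset (Fin k ⊕ Fin m) :=
  a.support.biUnion fun e => {Sum.inl e.1, Sum.inr e.2}

/-- The edges of `a` lie in a vertex set containing `w` and `w'` and having at most one vertex more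
than `a` has distinct edges, as is the case for the edges of a walk from `w` to `w'`. -/
def WalkLike (a : Fin k × Fin m →₀ ℕ) (w w' : Fin k ⊕ Fin m) : Prop :=
  ∃ S : Finset (Fin k ⊕ Fin m), w ∈ S ∧ w' ∈ S ∧ touched a ⊆ S ∧ S.card ≤ a.support.card + 1

lemma WalkLike.zero (w : Fin k ⊕ Fin m) : WalkLike (0 : Fin k × Fin m →₀ ℕ) w w :=
  ⟨{w}, by simp, by simp, by simp [touched], by simp⟩

lemma WalkLike.add_single {a : Fin k × Fin m →₀ ℕ} {w w' w'' : Fin k ⊕ Fin m} (h : WalkLike a w w')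
    (e : Fin k × Fin m)
    (he : ({Sum.inl e.1, Sum.inr e.2} : Finset (Fin k ⊕ Fin m)) = {w', w''}) :
    WalkLike (a + Finsupp.single e 1) w w'' := by
  obtain ⟨S, h1, h2, h3, h4⟩ := h
  have hs : (a + Finsupp.single e 1).support = insert e a.support := by
    ext x
    simp only [Finsupp.mem_support_iff, Finsupp.add_apply, Finset.mem_insert, Finsupp.single_apply]
    by_cases hx : e = x
    · simp [hx]
    · simp [hx, Ne.symm hx]
  have hv : touched (a + Finsupp.single e 1) = {w', w''} ∪ touched a := by
    rw [touched, hs, Finset.biUnion_insert, he, touched]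
  have hsub : touched (a + Finsupp.single e 1) ⊆ insert w'' S := by
    rw [hv]
    refine Finset.union_subset (fun x hx => ?_) (h3.trans (Finset.subset_insert _ _))
    simp only [Finset.mem_insert, Finset.mem_singleton] at hx ⊢
    rcases hx with rfl | rfl
    · exact Or.inr h2
    · exact Or.inl rfl
  refine ⟨insert w'' S, Finset.mem_insert_of_mem h1, Finset.mem_insert_self _ _, hsub, ?_⟩
  by_cases hw : w'' ∈ S
  · rw [Finset.insert_eq_of_mem hw, hs]
    exact h4.trans (by gcongr; exact Finset.subset_insert _ _)
  · have hea : e ∉ a.support := by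
      intro hmem
      refine hw (h3 ?_)
      refine Finset.mem_biUnion.mpr ⟨e, hmem, ?_⟩
      rw [he]; simp
    rw [Finset.card_insert_of_notMem hw, hs, Finset.card_insert_of_notMem hea]
    omega

/-- The matrix of indeterminates. -/
noncomputable def genericMatrix (k m : ℕ) : Matrix (Fin k) (Fin m) (MvPolynomial (Fin k × Fin m) ℕ) :=
  Matrix.of fun u v => X (u, v)

lemma walkLike_of_mem_support {l : ℕ} {u u' : Fin k} {a : Fin k × Fin m →₀ ℕ}
    (ha : a ∈ (((genericMatrix k m * (genericMatrix k m).transpose) ^ l) u u').support) :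
    WalkLike a (Sum.inl u) (Sum.inl u') := by
  classical
  induction l generalizing u' a with
  | zero =>
    rw [pow_zero, Matrix.one_apply] at ha
    split_ifs at ha with h
    · subst h
      have : a = 0 := by simpa using ha
      rw [this]; exact WalkLike.zero _
    · simp at ha
  | succ l ih =>
    rw [pow_succ, Matrix.mul_apply] at ha
    obtain ⟨i, -, ha⟩ := Finset.mem_biUnion.mp (support_sum ha)
    rw [Matrix.mul_apply, Finset.mul_sum] at ha
    obtain ⟨v, -, ha⟩ := Finset.mem_biUnion.mp (support_sum ha)
    rw [Matrix.transpose_apply, genericMatrix, Matrix.of_apply, Matrix.of_apply, ← mul_assoc,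
      support_mul_X, Finset.mem_map] at ha
    obtain ⟨a', ha', rfl⟩ := ha
    rw [support_mul_X, Finset.mem_map] at ha'
    obtain ⟨a'', ha'', rfl⟩ := ha'
    simp only [addRightEmbedding_apply]
    exact ((ih ha'').add_single (w'' := Sum.inr v) (i, v) rfl).add_single (u', v) (Finset.pair_comm _ _)

lemma card_touched_le_of_mem_support_trace {l : ℕ} {a : Fin k × Fin m →₀ ℕ}
    (ha : a ∈ ((genericMatrix k m * (genericMatrix k m).transpose) ^ l).trace.support) :
    (touched a).card ≤ a.support.card + 1 := by
  classical
  obtain ⟨u, -, ha⟩ := Finset.mem_biUnion.mp (support_sum ha)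
  obtain ⟨S, -, -, h1, h2⟩ := walkLike_of_mem_support ha
  exact (Finset.card_le_card h1).trans h2

lemma trace_eq_sum_monomials (f : Fin k × Fin m → ℝ) (l : ℕ) :
    ((Matrix.of (fun u v => f (u, v)) * (Matrix.of fun u v => f (u, v)).transpose) ^ l).trace
      = ∑ a ∈ ((genericMatrix k m * (genericMatrix k m).transpose) ^ l).trace.support,
          ((coeff a ((genericMatrix k m * (genericMatrix k m).transpose) ^ l).trace : ℕ) : ℝ) *
            ∏ e, f e ^ a e := by
  have h := eval₂_eq' (Nat.castRingHom ℝ) f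
    ((genericMatrix k m * (genericMatrix k m).transpose) ^ l).trace
  simp only [Nat.coe_castRingHom] at h
  rw [← h]
  set φ := eval₂Hom (Nat.castRingHom ℝ) f with hφ
  have e1 : (genericMatrix k m).map φ = Matrix.of fun u v => f (u, v) := by
    ext u v; simp [genericMatrix, hφ]
  have e2 : eval₂ (Nat.castRingHom ℝ) f ((genericMatrix k m * (genericMatrix k m).transpose) ^ l).trace
      = (φ.mapMatrix ((genericMatrix k m * (genericMatrix k m).transpose) ^ l)).trace :=
    AddMonoidHom.map_trace φ.toAddMonoidHom _
  rw [e2, map_pow, RingHom.mapMatrix_apply, Matrix.map_mul, Matrix.transpose_map, e1]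

end Walks

section Comparison
variable {k m : ℕ} {p : ℝ}

/-- The centered Bernoulli variable. -/
def centered (p : ℝ) (b : Bool) : ℝ := if b then 1 - p else -p

lemma bernExp_centered_le (hp : 0 ≤ p) (hp1 : p ≤ 1) (a : Fin k × Fin m →₀ ℕ) :
    bernExp p (fun H : BipGraph k m => ∏ e, centered p (H e) ^ a e)
      ≤ if ∃ e, a e = 1 then 0 else (p * (1 - p)) ^ a.support.card := by
  rw [bernExp_prod (fun e b => centered p b ^ a e)]
  simp only [centered, if_true, Bool.false_eq_true, if_false]
  split_ifs with h
  · obtain ⟨e, he⟩ := h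
    rw [Finset.prod_eq_zero (Finset.mem_univ e)]
    rw [he]; ring
  · push Not at h
    refine (le_abs_self _).trans ?_
    rw [Finset.abs_prod]
    calc ∏ e, |p * (1 - p) ^ a e + (1 - p) * (-p) ^ a e|
        ≤ ∏ e, if e ∈ a.support then p * (1 - p) else 1 := by
          refine Finset.prod_le_prod (fun _ _ => abs_nonneg _) fun e _ => ?_
          split_ifs with he
          · obtain ⟨j, hj⟩ : ∃ j, a e = j + 2 :=
              ⟨a e - 2, by have := h e; have := Finsupp.mem_support_iff.mp he; omega⟩
            have h1 : (1 - p) ^ (j + 1) ≤ 1 - p := by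
              rw [pow_succ]; exact mul_le_of_le_one_left (by linarith) (pow_le_one₀ (by linarith) (by linarith))
            have h2 : p ^ (j + 1) ≤ p := by
              rw [pow_succ]; exact mul_le_of_le_one_left hp (pow_le_one₀ hp hp1)
            calc _ ≤ |p * (1 - p) ^ a e| + |(1 - p) * (-p) ^ a e| := abs_add_le _ _
              _ = p * (1 - p) * ((1 - p) ^ (j + 1) + p ^ (j + 1)) := by
                  rw [abs_mul, abs_mul, abs_pow, abs_pow, abs_neg, abs_of_nonneg hp,
                    abs_of_nonneg (by linarith : 0 ≤ 1 - p), hj]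
                  ring
              _ ≤ p * (1 - p) * ((1 - p) + p) := by
                  have : 0 ≤ p * (1 - p) := mul_nonneg hp (by linarith)
                  gcongr
              _ = _ := by ring
          · rw [Finsupp.notMem_support_iff] at he
            simp [he]
      _ = _ := by rw [Finset.prod_ite_mem, Finset.univ_inter, Finset.prod_const]

lemma bernExp_sparse_monomial (s : ℝ) (a : Fin k × Fin m →₀ ℕ) :
    bernExp s (fun ξ : Fin k ⊕ Fin m → Bool => bernExp (1 / 3) (fun Y : Fin k × Fin m → Bool =>
        ∏ e, ((ξ (Sum.inl e.1)).toNat * (ξ (Sum.inr e.2)).toNat * skewSign (Y e)) ^ a e))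
      = s ^ (touched a).card * ∏ e, (1 / 3 * (2 : ℝ) ^ a e + 2 / 3 * (-1) ^ a e) := by
  have h1 : ∀ ξ : Fin k ⊕ Fin m → Bool, ∏ e : Fin k × Fin m,
      (((ξ (Sum.inl e.1)).toNat : ℝ) * (ξ (Sum.inr e.2)).toNat) ^ a e
        = ∏ w, if w ∈ touched a then ((ξ w).toNat : ℝ) else 1 := by
    intro ξ
    by_cases h : ∀ w ∈ touched a, ξ w = true
    · rw [Finset.prod_eq_one, Finset.prod_eq_one]
      · intro w _
        split_ifs with hw
        · simp [h w hw]
        · rfl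
      · intro e _
        by_cases he : e ∈ a.support
        · rw [h (Sum.inl e.1) (Finset.mem_biUnion.mpr ⟨e, he, by simp⟩),
            h (Sum.inr e.2) (Finset.mem_biUnion.mpr ⟨e, he, by simp⟩)]
          simp
        · rw [Finsupp.notMem_support_iff.mp he, pow_zero]
    · push Not at h
      obtain ⟨w, hw, hξ⟩ := h
      simp only [ne_eq, Bool.not_eq_true] at hξ
      rw [Finset.prod_eq_zero (i := w) (Finset.mem_univ _) (by simp [hw, hξ])]
      obtain ⟨e, he, hwe⟩ := Finset.mem_biUnion.mp hw
      refine Finset.prod_eq_zero (i := e) (Finset.mem_univ _) ?_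
      simp only [Finset.mem_insert, Finset.mem_singleton] at hwe
      have := Finsupp.mem_support_iff.mp he
      rcases hwe with rfl | rfl <;> simp [hξ, this]
  have h2 : bernExp (1 / 3) (fun Y : Fin k × Fin m → Bool => ∏ e, skewSign (Y e) ^ a e)
      = ∏ e, (1 / 3 * (2 : ℝ) ^ a e + 2 / 3 * (-1) ^ a e) := by
    rw [bernExp_prod (fun e b => skewSign b ^ a e)]
    simp only [skewSign, if_true, Bool.false_eq_true, if_false]
    norm_num
  have h3 : bernExp s (fun ξ : Fin k ⊕ Fin m → Bool =>
      ∏ w, if w ∈ touched a then ((ξ w).toNat : ℝ) else 1) = s ^ (touched a).card := by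
    rw [bernExp_prod (fun w b => if w ∈ touched a then (b.toNat : ℝ) else 1)]
    calc _ = ∏ w, if w ∈ touched a then s else 1 := by
          refine Finset.prod_congr rfl fun w _ => ?_
          split_ifs <;> simp
      _ = _ := by rw [Finset.prod_ite_mem, Finset.univ_inter, Finset.prod_const]
  simp only [mul_pow _ (skewSign _), Finset.prod_mul_distrib, bernExp_const_mul]
  rw [h2]
  simp only [h1]
  simp only [mul_comm _ (∏ e, (1 / 3 * (2 : ℝ) ^ a e + 2 / 3 * (-1) ^ a e))]
  rw [bernExp_const_mul, h3]

/-- Moments of the centered random matrix are dominated by those of a sparse sign matrix. -/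
lemma bernExp_trace_centered_le (hp : 0 < p) (hp1 : p < 1) (l : ℕ) :
    bernExp p (fun H : BipGraph k m => ((Matrix.of (fun u v => centered p (H (u, v))) *
        (Matrix.of fun u v => centered p (H (u, v))).transpose) ^ l).trace)
      ≤ (p * (1 - p))⁻¹ * bernExp (p * (1 - p)) (fun ξ : Fin k ⊕ Fin m → Bool =>
          bernExp (1 / 3) (fun Y : Fin k × Fin m → Bool =>
            ((sparseMatrix ξ Y * (sparseMatrix ξ Y).transpose) ^ l).trace)) := by
  have hs0 : 0 < p * (1 - p) := mul_pos hp (by linarith)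
  have hs1 : p * (1 - p) ≤ 1 := by nlinarith
  have e1 : ∀ H : BipGraph k m, _ := fun H => trace_eq_sum_monomials (fun e => centered p (H e)) l
  have e2 : ∀ (ξ : Fin k ⊕ Fin m → Bool) (Y : Fin k × Fin m → Bool),
      ((sparseMatrix ξ Y * (sparseMatrix ξ Y).transpose) ^ l).trace = _ := fun ξ Y =>
    trace_eq_sum_monomials (fun e =>
      ((ξ (Sum.inl e.1)).toNat : ℝ) * (ξ (Sum.inr e.2)).toNat * skewSign (Y e)) l
  simp only [e1, e2, bernExp_sum, bernExp_const_mul, bernExp_sparse_monomial]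
  rw [Finset.mul_sum]
  refine Finset.sum_le_sum fun a ha => ?_
  rw [mul_left_comm]
  refine mul_le_mul_of_nonneg_left ?_ (by positivity)
  refine (bernExp_centered_le hp.le hp1.le a).trans ?_
  have hy : ∀ j : ℕ, j ≠ 1 → (1 : ℝ) ≤ 1 / 3 * 2 ^ j + 2 / 3 * (-1) ^ j := by
    intro j hj
    rcases Nat.even_or_odd j with hev | hod
    · rw [hev.neg_one_pow]
      have : (1 : ℝ) ≤ 2 ^ j := one_le_pow₀ (by norm_num)
      linarith
    · rw [hod.neg_one_pow]
      have : (2 : ℝ) ^ 3 ≤ 2 ^ j := pow_le_pow_right₀ (by norm_num) (by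
        obtain ⟨i, rfl⟩ := hod; omega)
      linarith
  have hy0 : ∀ j : ℕ, (0 : ℝ) ≤ 1 / 3 * 2 ^ j + 2 / 3 * (-1) ^ j := by
    intro j
    rcases eq_or_ne j 1 with rfl | hj
    · norm_num
    · exact zero_le_one.trans (hy j hj)
  split_ifs with h
  · exact mul_nonneg (inv_nonneg.mpr hs0.le) (mul_nonneg (by positivity)
      (Finset.prod_nonneg fun e _ => hy0 _))
  · push Not at h
    calc (p * (1 - p)) ^ a.support.card
        = (p * (1 - p))⁻¹ * (p * (1 - p)) ^ (a.support.card + 1) := by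
          rw [pow_succ', inv_mul_cancel_left₀ hs0.ne']
      _ ≤ (p * (1 - p))⁻¹ * ((p * (1 - p)) ^ (touched a).card * 1) := by
          rw [mul_one]
          refine mul_le_mul_of_nonneg_left ?_ (by positivity)
          exact pow_le_pow_of_le_one hs0.le hs1 (card_touched_le_of_mem_support_trace ha)
      _ ≤ _ := by
          gcongr
          have := Finset.prod_le_prod (s := Finset.univ) (f := fun _ : Fin k × Fin m => (1 : ℝ))
            (fun _ _ => zero_le_one) fun e _ => hy (a e) (h e)
          simpa using this

end Comparison

section PartOne
variable {n k : ℕ} {p : ℝ}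

lemma sum_signed_sq_le {m w s : ℕ} (hk : k ≤ n) (hm : m ≤ n) (hws : w + s = n) (hs : (s : ℝ) ≤ p * n)
    (hs' : p * n < s + 1) {H : BipGraph k m} {L : ℝ}
    (h : ∀ x : Fin k → ℝ, ∑ v, (∑ u, centered p (H (u, v)) * x u) ^ 2 ≤ L * ∑ u, x u ^ 2)
    (x : Fin k → ℝ) :
    ∑ v, (∑ u, (signed w s (H (u, v)) : ℝ) * x u) ^ 2
      ≤ (2 * n ^ 2 * L + 2 * n ^ 2) * ∑ u, x u ^ 2 := by
  have hw : (w : ℝ) = n - s := by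
    have : (w : ℝ) + s = n := by exact_mod_cast hws
    linarith
  have e : ∀ b, (signed w s b : ℝ) = n * centered p b + (n * p - s) := by
    intro b; cases b <;> simp [signed, centered, hw] <;> ring
  have hk' : (k : ℝ) ≤ n := by exact_mod_cast hk
  have hm' : (m : ℝ) ≤ n := by exact_mod_cast hm
  have hδ : (n * p - s) ^ 2 ≤ 1 := by nlinarith
  have h2 : (∑ u, x u) ^ 2 ≤ n * ∑ u, x u ^ 2 := by
    calc (∑ u, x u) ^ 2 ≤ (Finset.univ : Finset (Fin k)).card * ∑ u, x u ^ 2 :=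
          sq_sum_le_card_mul_sum_sq
      _ ≤ _ := by rw [Finset.card_univ, Fintype.card_fin]; gcongr
  have hv : ∀ v, (∑ u, (signed w s (H (u, v)) : ℝ) * x u) ^ 2
      ≤ 2 * n ^ 2 * (∑ u, centered p (H (u, v)) * x u) ^ 2 + 2 * (n * ∑ u, x u ^ 2) := by
    intro v
    have e2 : ∑ u, (signed w s (H (u, v)) : ℝ) * x u
        = n * (∑ u, centered p (H (u, v)) * x u) + (n * p - s) * ∑ u, x u := by
      rw [Finset.mul_sum, Finset.mul_sum, ← Finset.sum_add_distrib]
      exact Finset.sum_congr rfl fun u _ => by rw [e]; ring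
    rw [e2]
    refine add_sq_le.trans ?_
    rw [mul_pow, mul_pow]
    have : (n * p - s) ^ 2 * (∑ u, x u) ^ 2 ≤ 1 * (n * ∑ u, x u ^ 2) := by gcongr
    linarith
  calc _ ≤ ∑ v, (2 * n ^ 2 * (∑ u, centered p (H (u, v)) * x u) ^ 2 + 2 * (n * ∑ u, x u ^ 2)) :=
        Finset.sum_le_sum fun v _ => hv v
    _ = 2 * n ^ 2 * ∑ v, (∑ u, centered p (H (u, v)) * x u) ^ 2 + m * (2 * (n * ∑ u, x u ^ 2)) := by
        rw [Finset.sum_add_distrib, ← Finset.mul_sum, Finset.sum_const, Finset.card_univ,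
          Fintype.card_fin, nsmul_eq_mul]
    _ ≤ 2 * n ^ 2 * (L * ∑ u, x u ^ 2) + n * (2 * (n * ∑ u, x u ^ 2)) := by
        gcongr
        exact h x
    _ = _ := by ring

lemma bicliqueCertificate_of_centered {E₀ L : ℝ} (hE : 1 ≤ E₀) (hn : 20 ≤ n) (hnE : 4 * E₀ + 4 ≤ n)
    (hk : k ≤ n) (hp : 0 < p) (hp1 : p < 1) (hq : 1 ≤ n * (1 - p)) (hpq : 1 ≤ n * (p * (1 - p)))
    (hL0 : 0 ≤ L) (hL : L ≤ 2 * E₀ * (n * (p * (1 - p)))) {H : BipGraph k (n - k)}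
    (h : ∀ x : Fin k → ℝ, ∑ v, (∑ u, centered p (H (u, v)) * x u) ^ 2 ≤ L * ∑ u, x u ^ 2) :
    BicliqueCertificate H 4 1 ((4 * E₀ + 4) * (n * p / (1 - p))) (200 * n ^ 200) := by
  set q := 1 - p with hqd
  have hq0 : 0 < q := by linarith
  have hq1 : q < 1 := by linarith
  have hn' : (20 : ℝ) ≤ n := by exact_mod_cast hn
  set s := ⌊p * n⌋₊ with hsd
  have hs : (s : ℝ) ≤ p * n := Nat.floor_le (by positivity)
  have hs' : p * n < s + 1 := Nat.lt_floor_add_one _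
  have hsn : s ≤ n := by
    have : (s : ℝ) ≤ n := by nlinarith
    exact_mod_cast this
  set w := n - s with hwd
  have hws : w + s = n := by omega
  have hw : n * q ≤ (w : ℝ) := by
    have : (w : ℝ) + s = n := by exact_mod_cast hws
    rw [hqd]; linarith
  have hm : n - k ≤ n := Nat.sub_le _ _
  set b := (4 * E₀ + 4) * (n * p / q) with hb
  have hnp : 1 ≤ n * p / q := by
    rw [one_le_div hq0]
    nlinarith
  set c := ⌊b⌋₊ with hcd
  have hcb : (c : ℝ) ≤ b := Nat.floor_le (by positivity)
  have hcb' : b < c + 1 := Nat.lt_floor_add_one _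
  have hc1 : (4 * E₀ + 3) * (n * p / q) ≤ c := by
    have : b = (4 * E₀ + 3) * (n * p / q) + n * p / q := by rw [hb]; ring
    linarith
  set Λ := ⌈2 * (n : ℝ) ^ 2 * L + 2 * n ^ 2⌉₊ with hΛd
  have hΛ1 : 2 * (n : ℝ) ^ 2 * L + 2 * n ^ 2 ≤ Λ := Nat.le_ceil _
  have hΛ2 : (Λ : ℝ) < 2 * (n : ℝ) ^ 2 * L + 2 * n ^ 2 + 1 := Nat.ceil_lt_add_one (by positivity)
  have hΛ3 : (Λ : ℝ) ≤ (4 * E₀ + 3) * (n ^ 2 * (n * (p * q))) := by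
    have h1 : 2 * (n : ℝ) ^ 2 * L ≤ 2 * (n : ℝ) ^ 2 * (2 * E₀ * (n * (p * q))) := by gcongr
    have h2 : (n : ℝ) ^ 2 * 1 ≤ n ^ 2 * (n * (p * q)) := by gcongr
    have h3 : (1 : ℝ) ≤ n ^ 2 := one_le_pow₀ (by linarith)
    nlinarith
  have hcw : Λ ≤ c * w ^ 2 := by
    have : (Λ : ℝ) ≤ c * (w : ℝ) ^ 2 := by
      calc (Λ : ℝ) ≤ (4 * E₀ + 3) * (n ^ 2 * (n * (p * q))) := hΛ3
        _ = (4 * E₀ + 3) * (n * p / q) * (n * q) ^ 2 := by field_simp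
        _ ≤ _ := by gcongr
    exact_mod_cast this
  have hn6 : (n : ℝ) ^ 4 ≤ n ^ 6 := pow_le_pow_right₀ (by linarith) (by norm_num)
  have hΛn : Λ ≤ n ^ 6 := by
    have : (Λ : ℝ) ≤ (n : ℝ) ^ 6 := by
      refine le_trans ?_ hn6
      calc (Λ : ℝ) ≤ (4 * E₀ + 3) * (n ^ 2 * (n * (p * q))) := hΛ3
        _ ≤ n * (n ^ 2 * (n * 1)) := by
            gcongr
            · linarith
            · nlinarith
        _ = (n : ℝ) ^ 4 := by ring
    exact_mod_cast this
  have hcn : c ≤ n ^ 6 := by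
    have : (c : ℝ) ≤ (n : ℝ) ^ 6 := by
      refine hcb.trans (le_trans ?_ hn6)
      calc b ≤ n * (n * p * n) := by
            rw [hb]
            gcongr
            rw [div_le_iff₀ hq0, mul_assoc]
            exact le_mul_of_one_le_right (by positivity) hq
        _ ≤ n * (n * 1 * n) := by gcongr
        _ = (n : ℝ) ^ 3 := by ring
        _ ≤ _ := pow_le_pow_right₀ (by linarith) (by norm_num)
    exact_mod_cast this
  have hΛpos : 0 < Λ := by
    have : (0 : ℝ) < Λ := lt_of_lt_of_le (by positivity) hΛ1
    exact_mod_cast this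
  have hwpos : 0 < w := by
    have : (0 : ℝ) < w := lt_of_lt_of_le (by positivity) hw
    exact_mod_cast this
  have hcert := intCert_of_spectral (H := H) hn hk hm hws.le hΛn hcn hcw fun x =>
    (sum_signed_sq_le hk hm hws hs hs' h x).trans (by gcongr)
  refine hcert.bicliqueCertificate (by positivity) hcb ?_
  have pw : ∀ {e e' : ℕ}, e ≤ e' → n ^ e ≤ n ^ e' := fun h => Nat.pow_le_pow_right (by omega) h
  refine (certificate_bits_le (e := 40) hn hk hm le_rfl ?_ (hcn.trans (pw (by norm_num)))
    ?_).trans ?_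
  · calc 4 * Λ * w ^ 2 ≤ n * n ^ 6 * n ^ 2 := by
          gcongr
          · omega
          · omega
      _ = n ^ 9 := by ring
      _ ≤ _ := pw (by norm_num)
  · calc k ^ 1 * (n - k) ≤ n ^ 1 * n := by gcongr
      _ = n ^ 2 := by ring
      _ ≤ _ := pw (by norm_num)
  · exact (pw (by norm_num)).trans (Nat.le_mul_of_pos_left _ (by norm_num))

/-- A bound on the spectral moments of the centered matrix certifies the first part. -/
lemma exists_test_partOne {E₀ : ℝ} (hE : E₀ = Real.exp (66 + 3 * 2 ^ 32)) (hn : 20 ≤ n)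
    (hnE : 4 * E₀ + 4 ≤ n) (hk : k ≤ n) (hp : 0 < p) (hp1 : p < 1) (hq : 1 ≤ n * (1 - p))
    (hpq : 1 ≤ n * (p * (1 - p))) (hexp : n ^ 2 * Real.exp (-(2 * (n * (p * (1 - p))))) ≤ 0.005) :
    ∃ F : BipGraph k (n - k) → ℝ, (∀ H, 0 ≤ F H) ∧ bernExp p F ≤ 0.005 ∧
      ∀ H, F H < 1 →
        BicliqueCertificate H 4 1 ((4 * E₀ + 4) * (n * p / (1 - p))) (200 * n ^ 200) := by
  set σ := p * (1 - p) with hσ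
  have hσ0 : 0 < σ := mul_pos hp (by linarith)
  have hn' : (20 : ℝ) ≤ n := by exact_mod_cast hn
  obtain ⟨i, hi1, hi2⟩ := exists_nat_pow_near hpq (one_lt_two : (1 : ℝ) < 2)
  set l : ℕ := 2 ^ (i + 1) with hl
  have hl1 : 1 ≤ l := Nat.one_le_two_pow
  have hlr : (l : ℝ) = 2 ^ (i + 1) := by rw [hl]; push_cast; rfl
  have hlpos : (0 : ℝ) < l := by rw [hlr]; positivity
  have hl2 : (l : ℝ) ≤ 2 * (n * σ) := by rw [hlr, pow_succ]; linarith
  have hl3 : n * σ ≤ l := by rw [hlr]; exact hi2.le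
  have hE0 : 0 < E₀ := by rw [hE]; exact Real.exp_pos _
  have hE1 : 1 ≤ E₀ := by rw [hE]; exact Real.one_le_exp (by positivity)
  set T : BipGraph k (n - k) → ℝ := fun H =>
    ((Matrix.of (fun u v => centered p (H (u, v))) *
        (Matrix.of fun u v => centered p (H (u, v))).transpose) ^ l).trace with hT
  have hT0 : ∀ H, 0 ≤ T H := fun H => Matrix.trace_mul_transpose_pow_nonneg _ i
  have hTE : bernExp p T ≤ σ⁻¹ * (k * ((l : ℝ) ^ l * Real.exp ((64 + 3 * 2 ^ 32) * l))) := by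
    refine (bernExp_trace_centered_le hp hp1 l).trans ?_
    refine mul_le_mul_of_nonneg_left ?_ (by positivity)
    exact bernExp_bernExp_trace_sparseMatrix hl1 (Nat.add_sub_of_le hk) hσ0.le (by nlinarith) hl3
  refine ⟨fun H => ((E₀ * l) ^ l)⁻¹ * T H, fun H => mul_nonneg (by positivity) (hT0 H), ?_,
    fun H hH => ?_⟩
  · rw [bernExp_const_mul]
    have hσn : σ⁻¹ ≤ n := by
      rw [inv_le_iff_one_le_mul₀ hσ0]; exact hpq
    have hk' : (k : ℝ) ≤ n := by exact_mod_cast hk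
    calc ((E₀ * l) ^ l)⁻¹ * bernExp p T
        ≤ ((E₀ * l) ^ l)⁻¹ * (σ⁻¹ * (k * ((l : ℝ) ^ l * Real.exp ((64 + 3 * 2 ^ 32) * l)))) := by
          gcongr
      _ = σ⁻¹ * k * ((E₀ ^ l)⁻¹ * Real.exp ((64 + 3 * 2 ^ 32) * l)) := by
          rw [mul_pow, mul_inv]; field_simp
      _ = σ⁻¹ * k * Real.exp (-(2 * l)) := by
          rw [hE, ← Real.exp_nat_mul, ← Real.exp_neg, ← Real.exp_add]
          congr 2; ring
      _ ≤ n * n * Real.exp (-(2 * (n * σ))) := by gcongr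
      _ ≤ _ := by rw [← pow_two]; exact hexp
  · have h1 : T H ≤ (E₀ * l) ^ l := by
      rw [inv_mul_lt_iff₀ (by positivity), mul_one] at hH
      exact hH.le
    refine bicliqueCertificate_of_centered hE1 hn hnE hk hp hp1 hq hpq (L := E₀ * l) (by positivity) ?_
      fun x => ?_
    · calc E₀ * l ≤ E₀ * (2 * (n * σ)) := by gcongr
        _ = _ := by ring
    · exact Matrix.sum_vecMul_sq_le_of_trace_le _ (by positivity) h1 x

end PartOne

/-- The random graph is dense enough for the first part once `n` is large. -/
lemma exists_forall_dense {ε : ℝ} (hε : 0 < ε) (B : ℝ) : ∃ N : ℕ, ∀ (n : ℕ) (p : ℝ), N ≤ n →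
    0 < p → p < 1 → (n : ℝ) ^ (-(1 - ε)) ≤ p → (n : ℝ) ^ (-(1 - ε)) ≤ 1 - p →
      20 ≤ n ∧ B ≤ n ∧ 1 ≤ n * (1 - p) ∧ 1 ≤ n * (p * (1 - p)) ∧
        n ^ 2 * Real.exp (-(2 * (n * (p * (1 - p))))) ≤ 0.005 := by
  have ht : Filter.Tendsto (fun n : ℕ => (n : ℝ) ^ ε) Filter.atTop Filter.atTop :=
    (tendsto_rpow_atTop hε).comp tendsto_natCast_atTop_atTop
  have h1 := ht.eventually_ge_atTop 2
  have h2 := (tendsto_rpow_mul_exp_neg_mul_atTop_nhds_zero (2 / ε) 1 one_pos).comp ht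
  have h3 := h2.eventually_le_const (show (0 : ℝ) < 0.005 by norm_num)
  have h4 : ∀ᶠ n : ℕ in Filter.atTop, B ≤ (n : ℝ) := tendsto_natCast_atTop_atTop.eventually_ge_atTop B
  obtain ⟨N, hN⟩ := Filter.eventually_atTop.mp
    (h1.and (h3.and (h4.and (Filter.eventually_ge_atTop 20))))
  refine ⟨N, fun n p hn hp hp1 hd hd' => ?_⟩
  obtain ⟨g1, g2, g3, g4⟩ := hN n hn
  have hn0 : (0 : ℝ) < n := by
    have : (20 : ℝ) ≤ n := by exact_mod_cast g4
    linarith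
  have e : (n : ℝ) * (n : ℝ) ^ (-(1 - ε)) = (n : ℝ) ^ ε := by
    nth_rewrite 1 [← Real.rpow_one (n : ℝ)]
    rw [← Real.rpow_add hn0]; congr 1; ring
  have hnp : (n : ℝ) ^ ε ≤ n * p := by rw [← e]; gcongr
  have hnq : (n : ℝ) ^ ε ≤ n * (1 - p) := by rw [← e]; gcongr
  have hpq : (n : ℝ) ^ ε / 2 ≤ n * (p * (1 - p)) := by
    rcases le_or_gt p (1 / 2) with h | h <;> nlinarith
  refine ⟨g4, g3, by linarith, by linarith, ?_⟩
  simp only [Function.comp_apply, one_mul, neg_mul] at g2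
  rw [← Real.rpow_mul hn0.le, mul_div_cancel₀ _ hε.ne', Real.rpow_two] at g2
  refine le_trans ?_ g2
  gcongr
  linarith

theorem theorem4p6 :
    ∃ (A : ℝ) (K : ℕ), 0 < A ∧
      ∀ ε : ℝ, 0 < ε → ∃ N : ℕ,
        ∀ (n k : ℕ) (p : unitInterval), 1 ≤ k → k ≤ n → 0 < (p : ℝ) → (p : ℝ) < 1 →
          0.99 ≤ (randomBip k (n - k) p).real
            {H : BipGraph k (n - k) |
              (N ≤ n → (n : ℝ) ^ (-(1 - ε)) ≤ (p : ℝ) → (n : ℝ) ^ (-(1 - ε)) ≤ 1 - (p : ℝ) →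
                BicliqueCertificate H 4 1 (A * ((n : ℝ) * p / (1 - p))) (K * n ^ K)) ∧
              (∀ r : ℕ, 1 ≤ r →
                A * (Real.sqrt (r * n * Real.log n) *
                    (max ((p : ℝ) / (1 - p)) ((1 - p) / p) ^ r * (p : ℝ) ^ r
                      / (1 - (p : ℝ)) ^ (r + 1))) ≤ (k : ℝ) →
                A * (Real.log n * (p : ℝ) / (1 - p)) ≤ (k : ℝ) →
                BicliqueCertificate H (6 * r + 2) (4 * r)
                  ((1000 * (r : ℝ)) ^ (10 * r) * n *
                    (n * max ((p : ℝ) / (1 - p)) ((1 - p) / p) ^ r * (p : ℝ) ^ r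
                      / (k * (1 - (p : ℝ)) ^ (r + 1))) ^ 4)
                  (K * n ^ (K * r)))} := by
  obtain ⟨E₀, hE⟩ : ∃ E₀ : ℝ, E₀ = Real.exp (66 + 3 * 2 ^ 32) := ⟨_, rfl⟩
  have hE64 : 64 ≤ 4 * E₀ + 4 := by
    have : (66 + 3 * 2 ^ 32 : ℝ) + 1 ≤ E₀ := hE ▸ Real.add_one_le_exp _
    linarith
  refine ⟨4 * E₀ + 4, 200, by linarith, fun ε hε => ?_⟩
  obtain ⟨N, hN⟩ := exists_forall_dense hε (4 * E₀ + 4)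
  refine ⟨N, fun n k p hk hkn hp hp1 => ?_⟩
  obtain ⟨F₂, hF₂0, hF₂E, hF₂⟩ := exists_test_partTwo hk hkn hp hp1
  obtain ⟨F₁, hF₁0, hF₁E, hF₁⟩ : ∃ F : BipGraph k (n - k) → ℝ, (∀ H, 0 ≤ F H) ∧
      bernExp (p : ℝ) F ≤ 0.005 ∧ ∀ H, F H < 1 → N ≤ n → (n : ℝ) ^ (-(1 - ε)) ≤ (p : ℝ) →
        (n : ℝ) ^ (-(1 - ε)) ≤ 1 - (p : ℝ) →
          BicliqueCertificate H 4 1 ((4 * E₀ + 4) * ((n : ℝ) * p / (1 - p))) (200 * n ^ 200) := by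
    by_cases h : N ≤ n ∧ (n : ℝ) ^ (-(1 - ε)) ≤ (p : ℝ) ∧ (n : ℝ) ^ (-(1 - ε)) ≤ 1 - (p : ℝ)
    · obtain ⟨g1, g2, g3, g4, g5⟩ := hN n p h.1 hp hp1 h.2.1 h.2.2
      obtain ⟨F, hF0, hFE, hF⟩ := exists_test_partOne (n := n) (k := k) hE g1 g2 hkn hp hp1 g3 g4 g5
      exact ⟨F, hF0, hFE, fun H hH _ _ _ => hF H hH⟩
    · refine ⟨fun _ => 0, fun _ => le_rfl, by rw [bernExp_const]; norm_num,
        fun H _ h1 h2 h3 => absurd ⟨h1, h2, h3⟩ h⟩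
  have hmain := one_sub_le_randomBip p (G := {H : BipGraph k (n - k) |
      (N ≤ n → (n : ℝ) ^ (-(1 - ε)) ≤ (p : ℝ) → (n : ℝ) ^ (-(1 - ε)) ≤ 1 - (p : ℝ) →
        BicliqueCertificate H 4 1 ((4 * E₀ + 4) * ((n : ℝ) * p / (1 - p))) (200 * n ^ 200)) ∧
      (∀ r : ℕ, 1 ≤ r →
        (4 * E₀ + 4) * (Real.sqrt (r * n * Real.log n) *
            (max ((p : ℝ) / (1 - p)) ((1 - p) / p) ^ r * (p : ℝ) ^ r
              / (1 - (p : ℝ)) ^ (r + 1))) ≤ (k : ℝ) →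
        (4 * E₀ + 4) * (Real.log n * (p : ℝ) / (1 - p)) ≤ (k : ℝ) →
        BicliqueCertificate H (6 * r + 2) (4 * r)
          ((1000 * (r : ℝ)) ^ (10 * r) * n *
            (n * max ((p : ℝ) / (1 - p)) ((1 - p) / p) ^ r * (p : ℝ) ^ r
              / (k * (1 - (p : ℝ)) ^ (r + 1))) ^ 4)
          (200 * n ^ (200 * r)))}) (fun H => F₁ H + F₂ H)
    (fun H => add_nonneg (hF₁0 H) (hF₂0 H)) fun H hH => by
      by_contra hlt
      push Not at hlt
      have h1 := hF₁0 H
      have h2 := hF₂0 H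
      refine hH ⟨hF₁ H (by linarith), fun r hr h _ => hF₂ H (by linarith) r hr (le_trans ?_ h)⟩
      have hq : 0 < 1 - (p : ℝ) := by linarith
      gcongr
  rw [bernExp_add] at hmain
  refine le_trans ?_ hmain
  linarith
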